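/- Let $R$ be an associative ring with identity and let $T$ be a (not necessarily complete) first-order theory of left $R$-modules, i.e. a theory in the language of left $R$-modules extending the theory $\mathbf{Th}_R$ of left $R$-modules; put $|T| := |R|+\aleph_0$. Let $\mathbf{K}^T=(\mathrm{Mod}(T),\leq_{pp})$ be the class of models of $T$ with the relation "pure submodule": $M\leq_{pp}N$ iff $M$ is a submodule of $N$ and $\varphi[N]\cap M^n=\varphi[M]$ for every positive primitive formula $\varphi$ in $n$ free variables (an existentially quantified finite system of linear equations), for every $n$. A pure embedding is an injective homomorphism with pure image. Assume that $T$ has an infinite model, that $\mathbf{K}^T$ has joint embedding (any two members embed purely into a common member) and amalgamation (for any pure embeddings $M\to N_1$, $M\to N_2$ of members there are a member $L$ and pure embeddings $N_1\to L$, $N_2\to L$ agreeing on $M$), and that $\mathbf{K}^T$ is closed under direct sums (of nonempty families). Terminology. $\mathbf{K}^T_\lambda$ is the class of members of cardinality $\lambda$. For $N\leq_{pp}M$ in $\mathbf{K}^T_\lambda$, $M$ is universal over $N$ if every $N^*\in\mathbf{K}^T_\lambda$ with $N\leq_{pp}N^*$ has a pure embedding into $M$ fixing $N$ pointwise. For $\lambda$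 an infinite cardinal and $\alpha<\lambda^+$ a limit ordinal, $M$ is a $(\lambda,\alpha)$-limit model if $M=\bigcup_{i<\alpha}M_i$ for some $\leq_{pp}$-increasing continuous chain $(M_i)_{i<\alpha}$ in $\mathbf{K}^T_\lambda$ with $M_{i+1}$ universal over $M_i$ for all $i<\alpha$; it is a limit model of cardinality $\lambda$ if this holds for some such $\alpha$, and a limit model if moreover this holds for some infinite $\lambda$. $\mathbf{K}^T$ has uniqueness of limit models of cardinality $\lambda$ if it has a limit model of cardinality $\lambda$ and any two of them are isomorphic. $\mathbf{K}^T$ is superstable if there is a cardinal $\mu$ such that it has uniqueness of limit models of cardinality $\lambda$ for every $\lambda\geq\mu$. $M$ is a universal model in $\mathbf{K}^T_\lambda$ if $M\in\mathbf{K}^T_\lambda$ and every $N\in\mathbf{K}^T_\lambda$ embeds purely into $M$. A module $M$ is pure-injective if it is a direct summand of every module containing it as a pure submodule, and $\Sigma$-pure-injective if $M^{(I)}$ is pure-injective for every index set $I$. Then the following are equivalent. 1. $\mathbf{K}^T$ is superstable. 2. There is $\lambda\geq|T|^+$ such that $\mathbf{K}^T$ has uniqueness of limit models of cardinality $\lambda$.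 3. Every $M\in\mathbf{K}^T$ is pure-injective. 4. There is $\lambda\geq|T|^+$ such that $\mathbf{K}^T_\lambda$ has a universal model that is $\Sigma$-pure-injective. 5. Every limit model in $\mathbf{K}^T$ is $\Sigma$-pure-injective. -/

import Mathlib

universe u

namespace ModuleClass

/-- Function symbols of the language of left `R`-modules: a constant `0`, unary symbols for `-`
and for multiplication by each `r : R`, and a binary symbol `+`. -/
inductive Func (R : Type u) : ℕ → Type u
  | zero : Func R 0
  | neg : Func R 1
  | smul (r : R) : Func R 1
  | add : Func R 2

/-- The first-order language of left `R`-modules; it has no relation symbols. -/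
def lang (R : Type u) : FirstOrder.Language.{u, 0} := ⟨Func R, fun _ => Empty⟩

/-- Every left `R`-module is a structure in the language of modules. -/
instance structureOfModule (R : Type u) [Ring R] (M : Type u) [AddCommGroup M] [Module R M] :
    (lang R).Structure M where
  funMap := fun {_} f =>
    match f with
    | Func.zero => fun _ => 0
    | Func.neg => fun x => -x 0
    | Func.smul r => fun x => r • x 0
    | Func.add => fun x => x 0 + x 1
  RelMap := fun r => r.elim

section Purity

/-- A positive primitive formula in `n` free variables `x`: the existentially quantified finite
system of linear equations `∃ y, A x + B y = 0`. -/
structure PPFormula (R : Type u) (n : ℕ) where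
  /-- number of equations -/
  eqs : ℕ
  /-- number of quantified variables -/
  bound : ℕ
  /-- coefficients of the free variables -/
  A : Fin eqs → Fin n → R
  /-- coefficients of the quantified variables -/
  B : Fin eqs → Fin bound → R

/-- `φ.Realize x` : the tuple `x` of elements of `M` satisfies `φ` in `M`. -/
def PPFormula.Realize {R : Type u} [Ring R] {n : ℕ} (φ : PPFormula R n)
    {M : Type u} [AddCommGroup M] [Module R M] (x : Fin n → M) : Prop :=
  ∃ y : Fin φ.bound → M, ∀ i, (∑ j, φ.A i j • x j) + (∑ j, φ.B i j • y j) = 0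

variable (R : Type u) [Ring R]
variable {M N : Type u} [AddCommGroup M] [Module R M] [AddCommGroup N] [Module R N]

/-- A pure embedding: an injective linear map `f : M → N` whose image is a pure submodule, that
is, for every pp-formula `φ`, a tuple of `M` satisfies `φ` in `M` iff its image satisfies `φ`
in `N`. -/
def IsPureEmbedding (f : M →ₗ[R] N) : Prop :=
  Function.Injective f ∧
    ∀ (n : ℕ) (φ : PPFormula R n) (x : Fin n → M),
      φ.Realize (fun i => f (x i)) ↔ φ.Realize x

variable (M)

/-- `M` is pure-injective: whenever `M` is (embedded as) a pure submodule of a module `N`, it is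
a direct summand of `N`, i.e. the embedding has a linear retraction. -/
def PureInjective : Prop :=
  ∀ (N : Type u) [AddCommGroup N] [Module R N] (f : M →ₗ[R] N), IsPureEmbedding R f →
    ∃ g : N →ₗ[R] M, g ∘ₗ f = LinearMap.id

/-- `M` is `Σ`-pure-injective: every direct sum `M^(I)` of copies of `M` is pure-injective. -/
def SigmaPureInjective : Prop :=
  ∀ I : Type u, PureInjective R (I →₀ M)

end Purity

variable {R : Type u} [Ring R]

/-- `|T|`, which by convention is `|R| + ℵ₀` for every theory `T` of left `R`-modules. -/
noncomputable def theoryCard (R : Type u) : Cardinal.{u} := Cardinal.mk R + Cardinal.aleph0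

/-- Membership in the class `K^T = (Mod(T), ≤_pp)`: the left `R`-module `M` satisfies `T`.
Since the carrier is a module, this is being a model of `T` together with the axioms of left
`R`-modules; so an arbitrary set `T` of sentences stands for the theory of modules that it
generates. The strong embeddings of the class are the pure embeddings. -/
def InClass (T : (lang R).Theory) (M : Type u) [AddCommGroup M] [Module R M] : Prop :=
  FirstOrder.Language.Theory.Model M T

/-- `K^T` has joint embedding. -/
def JointEmbedding (T : (lang R).Theory) : Prop :=
  ∀ (M N : Type u) [AddCommGroup M] [Module R M] [AddCommGroup N] [Module R N],
    InClass T M → InClass T N →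
    ∃ (L : Type u) (_ : AddCommGroup L) (_ : Module R L) (f : M →ₗ[R] L) (g : N →ₗ[R] L),
      InClass T L ∧ IsPureEmbedding R f ∧ IsPureEmbedding R g

/-- `K^T` has amalgamation. -/
def Amalgamation (T : (lang R).Theory) : Prop :=
  ∀ (M N₁ N₂ : Type u) [AddCommGroup M] [Module R M] [AddCommGroup N₁] [Module R N₁]
    [AddCommGroup N₂] [Module R N₂] (f₁ : M →ₗ[R] N₁) (f₂ : M →ₗ[R] N₂),
    InClass T M → InClass T N₁ → InClass T N₂ → IsPureEmbedding R f₁ → IsPureEmbedding R f₂ →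
    ∃ (L : Type u) (_ : AddCommGroup L) (_ : Module R L) (g₁ : N₁ →ₗ[R] L) (g₂ : N₂ →ₗ[R] L),
      InClass T L ∧ IsPureEmbedding R g₁ ∧ IsPureEmbedding R g₂ ∧ g₁ ∘ₗ f₁ = g₂ ∘ₗ f₂

/-- `T` has an infinite model. -/
def HasInfiniteModel (T : (lang R).Theory) : Prop :=
  ∃ (M : Type u) (_ : AddCommGroup M) (_ : Module R M), InClass T M ∧ Infinite M

/-- `K^T` is closed under direct sums of (nonempty) families. -/
def ClosedUnderDirectSums (T : (lang R).Theory) : Prop :=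
  ∀ (ι : Type u) [Nonempty ι] (M : ι → Type u) [∀ i, AddCommGroup (M i)] [∀ i, Module R (M i)],
    (∀ i, InClass T (M i)) → InClass T (DirectSum ι M)

/-- `M` is universal over `N`, where `N` is a strong submodel of `M` via `e`: both lie in `K^T`
and have the same cardinality, and every strong extension of `N` in `K^T` of that cardinality
embeds into `M` over `N`. -/
def UniversalOver (T : (lang R).Theory) {N M : Type u} [AddCommGroup N] [Module R N]
    [AddCommGroup M] [Module R M] (e : N →ₗ[R] M) : Prop :=
  InClass T N ∧ InClass T M ∧ IsPureEmbedding R e ∧ Cardinal.mk M = Cardinal.mk N ∧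
    ∀ (N' : Type u) [AddCommGroup N'] [Module R N'] (g : N →ₗ[R] N'),
      InClass T N' → Cardinal.mk N' = Cardinal.mk N → IsPureEmbedding R g →
      ∃ f : N' →ₗ[R] M, IsPureEmbedding R f ∧ f ∘ₗ g = e

/-- The family `C` of submodules of `M`, restricted to indices below `α`, witnesses that `M` is a
`(lam, α)`-limit model: it is an increasing (for pure embeddings) continuous chain of members of
`K^T` of cardinality `lam`, each successor is universal over its predecessor, and the union is
`M`. -/
structure IsLimitChain (T : (lang R).Theory) (lam : Cardinal.{u}) (α : Ordinal.{u})
    (M : Type u) [AddCommGroup M] [Module R M] (C : Ordinal.{u} → Submodule R M) : Prop where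
  mem : ∀ i < α, InClass T (C i)
  card : ∀ i < α, Cardinal.mk (C i) = lam
  increasing : ∀ i j, i ≤ j → j < α →
    ∃ h : C i ≤ C j, IsPureEmbedding R (Submodule.inclusion h)
  continuous : ∀ δ < α, Order.IsSuccLimit δ → (C δ : Set M) = ⋃ i ∈ Set.Iio δ, (C i : Set M)
  universal : ∀ i < α, ∃ h : C i ≤ C (Order.succ i), UniversalOver T (Submodule.inclusion h)
  union : (⋃ i ∈ Set.Iio α, (C i : Set M)) = Set.univ

/-- `M` is a `(lam, α)`-limit model of `K^T`. -/
def IsLimitModelOfLength (T : (lang R).Theory) (lam : Cardinal.{u}) (α : Ordinal.{u})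
    (M : Type u) [AddCommGroup M] [Module R M] : Prop :=
  Cardinal.aleph0 ≤ lam ∧ Order.IsSuccLimit α ∧ α < (Order.succ lam).ord ∧
    ∃ C : Ordinal.{u} → Submodule R M, IsLimitChain T lam α M C

/-- `M` is a limit model of `K^T` of cardinality `lam`. -/
def IsLimitModel (T : (lang R).Theory) (lam : Cardinal.{u})
    (M : Type u) [AddCommGroup M] [Module R M] : Prop :=
  ∃ α : Ordinal.{u}, IsLimitModelOfLength T lam α M

/-- `K^T` has uniqueness of limit models of cardinality `lam`: there is one, and any two are
isomorphic. -/
def UniquenessOfLimitModels (T : (lang R).Theory) (lam : Cardinal.{u}) : Prop :=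
  (∃ (M : Type u) (_ : AddCommGroup M) (_ : Module R M), IsLimitModel T lam M) ∧
    ∀ (M N : Type u) [AddCommGroup M] [Module R M] [AddCommGroup N] [Module R N],
      IsLimitModel T lam M → IsLimitModel T lam N → Nonempty (M ≃ₗ[R] N)

/-- `K^T` is superstable: it has uniqueness of limit models in a tail of cardinals. -/
def Superstable (T : (lang R).Theory) : Prop :=
  ∃ μ : Cardinal.{u}, ∀ lam, μ ≤ lam → UniquenessOfLimitModels T lam

/-- `M` is a universal model in `K^T_lam`. -/
def IsUniversalModel (T : (lang R).Theory) (lam : Cardinal.{u})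
    (M : Type u) [AddCommGroup M] [Module R M] : Prop :=
  InClass T M ∧ Cardinal.mk M = lam ∧
    ∀ (N : Type u) [AddCommGroup N] [Module R N], InClass T N → Cardinal.mk N = lam →
      ∃ f : N →ₗ[R] M, IsPureEmbedding R f

end ModuleClass

/-!
All five conditions are equivalent to the descending chain condition on pp-definable subgroups
(`PPDescending`) for the modules of the definable category generated by `K^T`
(`InDefinableClosure`): those in which all implications between pp-formulas in one variable that
are valid in `K^T` hold. This category is closed under pure submodules, pure quotients, products
and double character duals, unlike `K^T` itself. What makes it useful is a small model `E` of `T`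
such that each module of the category containing `E` as a pure submodule is a model of `T`
(`exists_absorbing_model`). Indeed, a direct sum of sufficiently many models realizes every proper
pp-pair, with infinite index, and a complete theory of modules all of whose pp-pairs have index `1`
or infinity is determined by which pairs are trivial (`IsFull.inClass`); this is a special case of
the Baur–Monk quantifier elimination, with B. H. Neumann's lemma on coverings by cosets as the
combinatorial core. So `N ⊕ E` is a model for each `N` in the definable category, and statements
about models can be transferred to small modules and back.

Pure-injectivity is used in the form of algebraic compactness: maps into an algebraically compact
module extend along pure embeddings (`AlgebraicallyCompact.exists_extension`). The descending chain
condition implies algebraic compactness and passes to pure submodules and to powers; hence it is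
equivalent to `Σ`-pure-injectivity, and one pure-injective sum `(N ⊕ E)^(ℕ)` forces it on `N`.
Algebraically compact modules in the definable category come from double character duals
(`Bidual`), and the modules of functions with bounded support in such a module
(`boundedSupport`) give algebraically compact modules in which all modules up to a given cardinality
embed purely (`exists_pure_boundedSupport`).

Under the descending chain condition, limit models of a fixed cardinality embed purely in each other
and are therefore isomorphic by a Cantor–Bernstein argument due to Bumby
(`nonempty_linearEquiv_of_pure`); they exist in all large cardinals. Conversely, a universal model
or a limit model contains all small modules of the definable category, and a failure of the chain
condition is witnessed by countably many elements, hence by a small module; so one such model that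
is `Σ`-pure-injective suffices. Finally, one limit model of cardinality `lam` yields limit models of
all limit lengths below `lam⁺`. In those of length `ω₁` all coherent sequences of cosets of
pp-definable subgroups have a common point (`IsLimitChain.countablySolvable`), as this can be arranged at a stage
that follows the sequence; in those of length `ω` this fails if the chain condition does
(`IsLimitChain.ppDescending`), because the partial sums of a sequence of sufficiently independent
witnesses do not converge to an element of any stage. So uniqueness of limit models of a single
cardinality `lam > |T|` implies the chain condition.
-/

namespace ModuleClass

/-! ### Positive primitive formulas -/

section Formulas

variable {R : Type u} [Ring R] {M N : Type u} [AddCommGroup M] [Module R M] [AddCommGroup N]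
  [Module R N] {n m : ℕ}

namespace PPFormula

/-- The pp-formula of a linear system whose equations and quantified variables are indexed by
arbitrary finite types. -/
noncomputable def ofSystem {σ τ : Type} [Fintype σ] [Fintype τ] (A : σ → Fin n → R)
    (B : σ → τ → R) : PPFormula R n where
  eqs := Fintype.card σ
  bound := Fintype.card τ
  A i := A ((Fintype.equivFin σ).symm i)
  B i j := B ((Fintype.equivFin σ).symm i) ((Fintype.equivFin τ).symm j)

theorem realize_ofSystem {σ τ : Type} [Fintype σ] [Fintype τ] (A : σ → Fin n → R)
    (B : σ → τ → R) (x : Fin n → M) :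
    (ofSystem A B).Realize x ↔
      ∃ y : τ → M, ∀ i, (∑ j, A i j • x j) + (∑ j, B i j • y j) = 0 := by
  constructor
  · rintro ⟨y, hy⟩
    refine ⟨fun j => y (Fintype.equivFin τ j), fun i => ?_⟩
    have h := hy (Fintype.equivFin σ i)
    simp only [ofSystem, Equiv.symm_apply_apply] at h
    rw [← h]
    congr 1
    exact Fintype.sum_equiv (Fintype.equivFin τ) _ _ (fun j => by simp)
  · rintro ⟨y, hy⟩
    refine ⟨fun j => y ((Fintype.equivFin τ).symm j), fun i => ?_⟩
    rw [← hy ((Fintype.equivFin σ).symm i)]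
    congr 1
    exact Fintype.sum_equiv (Fintype.equivFin τ).symm _ _ (fun j => by simp [ofSystem])

/-- Conjunction of two pp-formulas. -/
noncomputable def conj (φ ψ : PPFormula R n) : PPFormula R n :=
  ofSystem (σ := Fin φ.eqs ⊕ Fin ψ.eqs) (τ := Fin φ.bound ⊕ Fin ψ.bound)
    (Sum.elim φ.A ψ.A)
    (Sum.elim (fun i => Sum.elim (φ.B i) (fun _ => 0)) (fun i => Sum.elim (fun _ => 0) (ψ.B i)))

@[simp]
theorem realize_conj (φ ψ : PPFormula R n) (x : Fin n → M) :
    (φ.conj ψ).Realize x ↔ φ.Realize x ∧ ψ.Realize x := by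
  rw [conj, realize_ofSystem]
  constructor
  · rintro ⟨y, hy⟩
    refine ⟨⟨fun j => y (Sum.inl j), fun i => ?_⟩, ⟨fun j => y (Sum.inr j), fun i => ?_⟩⟩
    · simpa using hy (Sum.inl i)
    · simpa using hy (Sum.inr i)
  · rintro ⟨⟨y, hy⟩, ⟨z, hz⟩⟩
    refine ⟨Sum.elim y z, ?_⟩
    rintro (i | i)
    · simpa using hy i
    · simpa using hz i

/-- The pp-formula that holds of every tuple. -/
def top : PPFormula R n := ⟨0, 0, fun i => i.elim0, fun i => i.elim0⟩

@[simp]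
theorem realize_top (x : Fin n → M) : (top : PPFormula R n).Realize x :=
  ⟨0, fun i => i.elim0⟩

/-- Conjunction of a finite family of pp-formulas. -/
theorem exists_conj {ι : Type*} (s : Finset ι) (φ : ι → PPFormula R n) :
    ∃ ψ : PPFormula R n, ∀ (M : Type u) [AddCommGroup M] [Module R M] (x : Fin n → M),
      ψ.Realize x ↔ ∀ i ∈ s, (φ i).Realize x := by
  classical
  induction s using Finset.induction_on with
  | empty => exact ⟨top, by simp⟩
  | insert i s _ ih =>
    obtain ⟨ψ, hψ⟩ := ih
    exact ⟨(φ i).conj ψ, fun M _ _ x => by simp [hψ]⟩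

/-- Existential quantification over the last variable. -/
noncomputable def ex (φ : PPFormula R (n + 1)) : PPFormula R n :=
  ofSystem (σ := Fin φ.eqs) (τ := Unit ⊕ Fin φ.bound)
    (fun i j => φ.A i j.castSucc)
    (fun i => Sum.elim (fun _ => φ.A i (Fin.last n)) (φ.B i))

theorem realize_ex (φ : PPFormula R (n + 1)) (x : Fin n → M) :
    φ.ex.Realize x ↔ ∃ y : M, φ.Realize (Fin.snoc x y : Fin (n + 1) → M) := by
  rw [ex, realize_ofSystem]
  constructor
  · rintro ⟨y, hy⟩
    refine ⟨y (Sum.inl ()), fun j => y (Sum.inr j), fun i => ?_⟩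
    have := hy i
    simp only [Fintype.sum_sum_type, Sum.elim_inl, Sum.elim_inr, Finset.univ_unique,
      Finset.sum_singleton] at this
    rw [Fin.sum_univ_castSucc]
    simpa [add_assoc] using this
  · rintro ⟨y, z, hz⟩
    refine ⟨Sum.elim (fun _ => y) z, fun i => ?_⟩
    have := hz i
    rw [Fin.sum_univ_castSucc] at this
    simpa [add_assoc] using this

/-- Linear substitution: `φ.subst L` says that the tuple `L x` satisfies `φ`. -/
def subst (φ : PPFormula R n) (L : Fin n → Fin m → R) : PPFormula R m where
  eqs := φ.eqs
  bound := φ.bound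
  A i k := ∑ j, φ.A i j * L j k
  B := φ.B

theorem realize_subst (φ : PPFormula R n) (L : Fin n → Fin m → R) (x : Fin m → M) :
    (φ.subst L).Realize x ↔ φ.Realize (fun j => ∑ k, L j k • x k) := by
  have key : ∀ i, (∑ k, (∑ j, φ.A i j * L j k) • x k) = ∑ j, φ.A i j • ∑ k, L j k • x k := by
    intro i
    simp only [Finset.sum_smul, Finset.smul_sum, mul_smul]
    exact Finset.sum_comm
  constructor
  · rintro ⟨y, hy⟩
    exact ⟨y, fun i => by rw [← key]; exact hy i⟩
  · rintro ⟨y, hy⟩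
    exact ⟨y, fun i => (congrArg (· + _) (key i)).trans (hy i)⟩

/-- Renaming of variables. -/
def rename (φ : PPFormula R n) (e : Fin n → Fin m) : PPFormula R m :=
  φ.subst (fun j k => if e j = k then 1 else 0)

@[simp]
theorem realize_rename (φ : PPFormula R n) (e : Fin n → Fin m) (x : Fin m → M) :
    (φ.rename e).Realize x ↔ φ.Realize (fun j => x (e j)) := by
  rw [rename, realize_subst]
  simp

/-- The formula in the last variable obtained by substituting `0` for the other ones. -/
def lastVar (φ : PPFormula R (n + 1)) : PPFormula R 1 :=
  φ.subst (fun j _ => if j = Fin.last n then 1 else 0)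

theorem realize_lastVar (φ : PPFormula R (n + 1)) (x : Fin 1 → M) :
    φ.lastVar.Realize x ↔ φ.Realize (Fin.snoc 0 (x 0) : Fin (n + 1) → M) := by
  rw [lastVar, realize_subst]
  have : (fun j : Fin (n + 1) => ∑ k : Fin 1, (if j = Fin.last n then (1 : R) else 0) • x k) =
      (Fin.snoc 0 (x 0) : Fin (n + 1) → M) := by
    funext j
    refine Fin.lastCases ?_ (fun j => ?_) j
    · simp
    · simp [(Fin.castSucc_lt_last j).ne]
  rw [this]

/-- The linear equation `∑ c j • x j = 0`. -/
noncomputable def linear (c : Fin n → R) : PPFormula R n :=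
  ofSystem (σ := Unit) (τ := Empty) (fun _ => c) (fun _ j => j.elim)

@[simp]
theorem realize_linear (c : Fin n → R) (x : Fin n → M) :
    (linear c).Realize x ↔ ∑ j, c j • x j = 0 := by
  rw [linear, realize_ofSystem]
  simp

theorem Realize.add {φ : PPFormula R n} {x y : Fin n → M} (hx : φ.Realize x) (hy : φ.Realize y) :
    φ.Realize (x + y) := by
  obtain ⟨a, ha⟩ := hx
  obtain ⟨b, hb⟩ := hy
  refine ⟨a + b, fun i => ?_⟩
  simp only [Pi.add_apply, smul_add, Finset.sum_add_distrib]
  rw [add_add_add_comm, ha, hb, add_zero]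

theorem Realize.neg {φ : PPFormula R n} {x : Fin n → M} (hx : φ.Realize x) :
    φ.Realize (-x) := by
  obtain ⟨a, ha⟩ := hx
  refine ⟨-a, fun i => ?_⟩
  simp only [Pi.neg_apply, smul_neg, Finset.sum_neg_distrib]
  rw [← neg_add, ha, neg_zero]

theorem realize_zero (φ : PPFormula R n) : φ.Realize (0 : Fin n → M) :=
  ⟨0, fun i => by simp⟩

theorem Realize.sub {φ : PPFormula R n} {x y : Fin n → M} (hx : φ.Realize x) (hy : φ.Realize y) :
    φ.Realize (x - y) := by
  rw [sub_eq_add_neg]; exact hx.add hy.neg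

theorem Realize.map {φ : PPFormula R n} {x : Fin n → M} (hx : φ.Realize x) (f : M →ₗ[R] N) :
    φ.Realize (fun i => f (x i)) := by
  obtain ⟨y, hy⟩ := hx
  refine ⟨fun j => f (y j), fun i => ?_⟩
  have := congrArg f (hy i)
  simpa using this

theorem realize_pi {I : Type u} {Y : I → Type u} [∀ i, AddCommGroup (Y i)] [∀ i, Module R (Y i)]
    (φ : PPFormula R n) (x : Fin n → ∀ i, Y i) :
    φ.Realize x ↔ ∀ i, φ.Realize (fun j => x j i) := by
  constructor
  · intro h i
    exact h.map (LinearMap.proj i)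
  · intro h
    choose y hy using h
    refine ⟨fun j i => y i j, fun e => ?_⟩
    funext i
    have := hy i e
    simpa using this

theorem realize_prod (φ : PPFormula R n) (x : Fin n → M × N) :
    φ.Realize x ↔ φ.Realize (fun j => (x j).1) ∧ φ.Realize (fun j => (x j).2) := by
  constructor
  · intro h
    exact ⟨h.map (LinearMap.fst R M N), h.map (LinearMap.snd R M N)⟩
  · rintro ⟨⟨y, hy⟩, ⟨z, hz⟩⟩
    refine ⟨fun j => (y j, z j), fun e => ?_⟩
    ext
    · simpa [Prod.fst_sum] using hy e
    · simpa [Prod.snd_sum] using hz e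

/-- The subgroup of `M` defined by a pp-formula in one variable. -/
def sol (φ : PPFormula R 1) (M : Type u) [AddCommGroup M] [Module R M] : AddSubgroup M where
  carrier := {x | φ.Realize (fun _ => x)}
  zero_mem' := φ.realize_zero
  add_mem' := fun hx hy => Realize.add hx hy
  neg_mem' := fun hx => Realize.neg hx

theorem mem_sol {φ : PPFormula R 1} {x : M} : x ∈ φ.sol M ↔ φ.Realize (fun _ => x) := Iff.rfl

theorem realize_iff_mem_sol {φ : PPFormula R 1} {x : Fin 1 → M} :
    φ.Realize x ↔ x 0 ∈ φ.sol M := by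
  rw [mem_sol]
  have : x = fun _ => x 0 := by funext i; rw [Subsingleton.elim i 0]
  rw [← this]

theorem map_mem_sol {φ : PPFormula R 1} {x : M} (hx : x ∈ φ.sol M) (f : M →ₗ[R] N) :
    f x ∈ φ.sol N := Realize.map hx f

theorem mem_sol_pi {I : Type u} {Y : I → Type u} [∀ i, AddCommGroup (Y i)]
    [∀ i, Module R (Y i)] {φ : PPFormula R 1} {x : ∀ i, Y i} :
    x ∈ φ.sol (∀ i, Y i) ↔ ∀ i, x i ∈ φ.sol (Y i) := realize_pi _ _

theorem mem_sol_prod {φ : PPFormula R 1} {x : M × N} :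
    x ∈ φ.sol (M × N) ↔ x.1 ∈ φ.sol M ∧ x.2 ∈ φ.sol N := realize_prod _ _

end PPFormula

end Formulas

/-! ### Pure embeddings -/

section Purity

variable {R : Type u} [Ring R] {M N P Q : Type u} [AddCommGroup M] [Module R M] [AddCommGroup N]
  [Module R N] [AddCommGroup P] [Module R P] [AddCommGroup Q] [Module R Q]

/-- A linear map that reflects pp-formulas is a pure embedding; injectivity is the reflection of
the formula `x = 0`. -/
theorem isPureEmbedding_of_reflect {f : M →ₗ[R] N}
    (h : ∀ (n : ℕ) (φ : PPFormula R n) (x : Fin n → M),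
      φ.Realize (fun i => f (x i)) → φ.Realize x) : IsPureEmbedding R f := by
  refine ⟨?_, fun n φ x => ⟨h n φ x, fun hx => hx.map f⟩⟩
  rw [injective_iff_map_eq_zero]
  intro a ha
  have := h 1 (PPFormula.linear (fun _ => 1)) (fun _ => a) (by simp [ha])
  simpa using this

/-- A map that splits locally, on each finite tuple, is a pure embedding. -/
theorem isPureEmbedding_of_locallySplit {f : M →ₗ[R] N}
    (h : ∀ (n : ℕ) (x : Fin n → M), ∃ g : N →ₗ[R] M, ∀ i, g (f (x i)) = x i) :
    IsPureEmbedding R f := by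
  refine isPureEmbedding_of_reflect fun n φ x hx => ?_
  obtain ⟨g, hg⟩ := h n x
  simpa [hg] using hx.map g

theorem isPureEmbedding_of_retraction {f : M →ₗ[R] N} {g : N →ₗ[R] M}
    (h : g ∘ₗ f = LinearMap.id) : IsPureEmbedding R f :=
  isPureEmbedding_of_locallySplit fun _ x => ⟨g, fun i => LinearMap.congr_fun h (x i)⟩

theorem isPureEmbedding_equiv (e : M ≃ₗ[R] N) : IsPureEmbedding R (e : M →ₗ[R] N) :=
  isPureEmbedding_of_retraction (g := (e.symm : N →ₗ[R] M)) (by ext; simp)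

theorem isPureEmbedding_id : IsPureEmbedding R (LinearMap.id : M →ₗ[R] M) :=
  isPureEmbedding_equiv (LinearEquiv.refl R M)

theorem isPureEmbedding_inl : IsPureEmbedding R (LinearMap.inl R M N) :=
  isPureEmbedding_of_retraction (g := LinearMap.fst R M N) (by ext; simp)

theorem isPureEmbedding_inr : IsPureEmbedding R (LinearMap.inr R M N) :=
  isPureEmbedding_of_retraction (g := LinearMap.snd R M N) (by ext; simp)

theorem IsPureEmbedding.comp {g : N →ₗ[R] P} {f : M →ₗ[R] N} (hg : IsPureEmbedding R g)
    (hf : IsPureEmbedding R f) : IsPureEmbedding R (g ∘ₗ f) :=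
  ⟨hg.1.comp hf.1, fun n φ x => (hg.2 n φ (fun i => f (x i))).trans (hf.2 n φ x)⟩

theorem IsPureEmbedding.of_comp {g : N →ₗ[R] P} {f : M →ₗ[R] N}
    (h : IsPureEmbedding R (g ∘ₗ f)) : IsPureEmbedding R f :=
  isPureEmbedding_of_reflect fun n φ x hx => (h.2 n φ x).1 (hx.map g)

theorem IsPureEmbedding.mem_sol {f : M →ₗ[R] N} (hf : IsPureEmbedding R f) {φ : PPFormula R 1}
    {x : M} : f x ∈ φ.sol N ↔ x ∈ φ.sol M := hf.2 1 φ (fun _ => x)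

theorem IsPureEmbedding.codRestrict {f : M →ₗ[R] N} (hf : IsPureEmbedding R f)
    (S : Submodule R N) (h : ∀ x, f x ∈ S) : IsPureEmbedding R (f.codRestrict S h) :=
  IsPureEmbedding.of_comp (g := S.subtype) hf

/-- A submodule is pure if its inclusion is a pure embedding. -/
def IsPureSubmodule (S : Submodule R M) : Prop := IsPureEmbedding R S.subtype

theorem IsPureSubmodule.inclusion {S S' : Submodule R M} (hS : IsPureSubmodule S) (h : S ≤ S') :
    IsPureEmbedding R (Submodule.inclusion h) :=
  IsPureEmbedding.of_comp (g := S'.subtype) hS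

theorem IsPureEmbedding.range {f : M →ₗ[R] N} (hf : IsPureEmbedding R f) :
    IsPureSubmodule (LinearMap.range f) := by
  have : (LinearMap.range f).subtype =
      f ∘ₗ ((LinearEquiv.ofInjective f hf.1).symm : LinearMap.range f →ₗ[R] M) := by
    ext ⟨_, y, rfl⟩
    have : (LinearEquiv.ofInjective f hf.1).symm ⟨f y, y, rfl⟩ = y := by
      rw [LinearEquiv.symm_apply_eq]; rfl
    simp [this]
  rw [IsPureSubmodule, this]
  exact hf.comp (isPureEmbedding_equiv _)

/-- A submodule is pure as soon as each solvable system with parameters in it has a solution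
in it. -/
theorem isPureSubmodule_of_witness {S : Submodule R M}
    (h : ∀ (n : ℕ) (φ : PPFormula R n) (x : Fin n → S), φ.Realize (fun i => (x i : M)) →
      ∃ S' ≤ S, ∃ x' : Fin n → S', (∀ i, (x' i : M) = x i) ∧ φ.Realize x') :
    IsPureSubmodule S :=
  isPureEmbedding_of_reflect fun n φ x hx => by
    obtain ⟨S', hS', x', hx', hr⟩ := h n φ x hx
    have := hr.map (Submodule.inclusion hS')
    convert this using 2 with i
    ext
    simp [hx']

/-- A tuple of elements of the union of a chain satisfies a pp-formula only if it does so in a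
member of the chain. -/
theorem exists_realize_of_directed {ι : Type*} [Nonempty ι] {C : ι → Submodule R M}
    (hdir : Directed (· ≤ ·) C) {S : Submodule R M} (hS : (S : Set M) = ⋃ i, (C i : Set M))
    {n : ℕ} {φ : PPFormula R n} {x : Fin n → S} (hx : φ.Realize x) :
    ∃ i, ∃ x' : Fin n → C i, (∀ j, (x' j : M) = x j) ∧ φ.Realize x' := by
  obtain ⟨y, hy⟩ := hx
  have hmem : ∀ s : S, ∃ i, (s : M) ∈ C i := fun s => by
    have : (s : M) ∈ (S : Set M) := s.2
    rw [hS] at this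
    simpa using this
  choose c hc using hmem
  obtain ⟨z, hz⟩ := hdir.finite_le (fun j : Fin n ⊕ Fin φ.bound => c (Sum.elim x y j))
  refine ⟨z, fun j => ⟨x j, hz (Sum.inl j) (hc _)⟩, fun j => rfl, fun j => ⟨y j,
    hz (Sum.inr j) (hc _)⟩, fun i => ?_⟩
  have := congrArg (Subtype.val) (hy i)
  ext
  simpa using this

theorem isPureSubmodule_of_directed {ι : Type*} [Nonempty ι] {C : ι → Submodule R M}
    (hdir : Directed (· ≤ ·) C) (hC : ∀ i, IsPureSubmodule (C i)) {S : Submodule R M}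
    (hS : (S : Set M) = ⋃ i, (C i : Set M)) : IsPureSubmodule S := by
  have hle : ∀ i, C i ≤ S := fun i x hx => by
    have : x ∈ (S : Set M) := by rw [hS]; exact Set.mem_iUnion_of_mem i hx
    exact this
  refine isPureSubmodule_of_witness fun n φ x hx => ?_
  have hmem : ∀ s : S, ∃ i, (s : M) ∈ C i := fun s => by
    have : (s : M) ∈ (S : Set M) := s.2
    rw [hS] at this
    simpa using this
  choose c hc using hmem
  obtain ⟨z, hz⟩ := hdir.finite_le (fun j : Fin n => c (x j))
  refine ⟨C z, hle z, fun j => ⟨x j, hz j (hc _)⟩, fun _ => rfl, ?_⟩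
  exact ((hC z).2 n φ _).1 hx

/-- Solutions of a pp-formula in the quotient by a pure submodule lift to solutions. -/
theorem IsPureSubmodule.exists_lift_of_ker {S : Submodule R M} (hS : IsPureSubmodule S)
    {π : M →ₗ[R] N} (hπ : Function.Surjective π) (hker : LinearMap.ker π = S) {n : ℕ}
    {φ : PPFormula R n} {x : Fin n → M} (hx : φ.Realize (fun i => π (x i))) :
    ∃ a : Fin n → S, φ.Realize (fun i => x i - a i) := by
  obtain ⟨y, hy⟩ := hx
  choose z hz using fun j => hπ (y j)
  have hmem : ∀ i, (∑ j, φ.A i j • x j) + (∑ j, φ.B i j • z j) ∈ S := by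
    intro i
    rw [← hker, LinearMap.mem_ker, ← hy i]
    simp only [map_add, map_sum, map_smul, hz]
  -- the right-hand sides are treated as parameters of an inhomogeneous system over `S`
  let ψ : PPFormula R φ.eqs := PPFormula.ofSystem (σ := Fin φ.eqs) (τ := Fin n ⊕ Fin φ.bound)
    (fun i j => if i = j then -1 else 0) (fun i => Sum.elim (φ.A i) (φ.B i))
  have h1 : ψ.Realize (fun i => S.subtype
      (⟨(∑ j, φ.A i j • x j) + (∑ j, φ.B i j • z j), hmem i⟩ : S)) := by
    rw [PPFormula.realize_ofSystem]
    refine ⟨Sum.elim x z, fun i => ?_⟩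
    simp only [ite_smul, neg_smul, one_smul, zero_smul, Finset.sum_ite_eq, Finset.mem_univ,
      if_true, Fintype.sum_sum_type, Sum.elim_inl, Sum.elim_inr, Submodule.subtype_apply]
    exact neg_add_cancel _
  have h2 := (hS.2 _ ψ _).1 h1
  rw [PPFormula.realize_ofSystem] at h2
  obtain ⟨w, hw⟩ := h2
  refine ⟨fun j => w (Sum.inl j), fun j => z j - w (Sum.inr j), fun i => ?_⟩
  have := congrArg Subtype.val (hw i)
  simp only [Fintype.sum_sum_type, Sum.elim_inl, Sum.elim_inr, ite_smul, neg_smul, one_smul,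
    zero_smul, Finset.sum_ite_eq, Finset.mem_univ, if_true, Submodule.coe_add, Submodule.coe_neg,
    Submodule.coe_sum, Submodule.coe_smul, Submodule.coe_zero] at this
  simp only [smul_sub, Finset.sum_sub_distrib]
  rw [neg_add_eq_zero] at this
  rw [sub_add_sub_comm, this, sub_self]

theorem IsPureSubmodule.exists_lift {S : Submodule R M} (hS : IsPureSubmodule S) {n : ℕ}
    {φ : PPFormula R n} {x : Fin n → M} (hx : φ.Realize (fun i => S.mkQ (x i))) :
    ∃ a : Fin n → S, φ.Realize (fun i => x i - a i) :=
  hS.exists_lift_of_ker S.mkQ_surjective S.ker_mkQ hx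

/-- The preimage of a pure submodule of a quotient by a pure submodule is pure. -/
theorem IsPureSubmodule.comap_mkQ {S : Submodule R M} (hS : IsPureSubmodule S)
    {T : Submodule R (M ⧸ S)} (hT : IsPureSubmodule T) : IsPureSubmodule (T.comap S.mkQ) := by
  refine isPureEmbedding_of_reflect fun n φ x hx => ?_
  have hle : S ≤ T.comap S.mkQ := fun a ha => by
    rw [Submodule.mem_comap, (Submodule.Quotient.mk_eq_zero S).2 ha |> (id : S.mkQ a = 0 → _)]
    exact T.zero_mem
  have h1 : φ.Realize (fun i => T.subtype (⟨S.mkQ (x i), (x i).2⟩ : T)) := hx.map S.mkQ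
  obtain ⟨y, hy⟩ := (hT.2 n φ _).1 h1
  choose z hz using fun j => S.mkQ_surjective (y j : M ⧸ S)
  have hzT : ∀ j, z j ∈ T.comap S.mkQ := fun j => by
    rw [Submodule.mem_comap, hz]; exact (y j).2
  -- work in the preimage, over its pure submodule `S`
  let S' : Submodule R (T.comap S.mkQ) := S.comap (T.comap S.mkQ).subtype
  have hS' : IsPureSubmodule S' := by
    refine isPureEmbedding_of_reflect fun n φ x hx => ?_
    have h := (hS.2 n φ (fun i => ⟨(x i).1.1, (x i).2⟩)).1 (hx.map (T.comap S.mkQ).subtype)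
    exact h.map (LinearMap.codRestrict S' (Submodule.inclusion hle) (fun a => a.2))
  have h3 : φ.Realize (fun i => S'.mkQ (x i)) := by
    refine ⟨fun j => S'.mkQ ⟨z j, hzT j⟩, fun i => ?_⟩
    have h4 := congrArg Subtype.val (hy i)
    simp only [Submodule.coe_add, Submodule.coe_sum, Submodule.coe_smul, Submodule.coe_zero,
      ← hz] at h4
    simp only [← map_smul, ← map_sum, ← map_add] at h4 ⊢
    rw [← LinearMap.mem_ker, Submodule.ker_mkQ] at h4 ⊢
    rw [Submodule.mem_comap]
    simpa using h4
  obtain ⟨a, ha⟩ := hS'.exists_lift h3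
  have h5 : φ.Realize (fun i => (a i : T.comap S.mkQ)) := by
    refine PPFormula.Realize.map (f := S'.subtype) ((hS.2 n φ (fun i => ⟨(a i).1.1, (a i).2⟩)).1 ?_
      |>.map (LinearMap.codRestrict S' (Submodule.inclusion hle) (fun a => a.2)))
    have := hx.sub (ha.map (T.comap S.mkQ).subtype)
    convert this using 1
    funext i
    simp
  have := ha.add h5
  convert this using 1
  funext i
  simp

/-- A map on `N` that is pure on a pure submodule `S`, and whose composition with a further map is
a pure embedding of the quotient `N ⧸ S`, given by a surjection `π` with kernel `S`, is a pure
embedding. -/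
theorem isPureEmbedding_of_quotient {S : Submodule R N} (hS : IsPureSubmodule S) {π : N →ₗ[R] M}
    (hπ : Function.Surjective π) (hker : LinearMap.ker π = S) {g : N →ₗ[R] P}
    (hg : IsPureEmbedding R (g ∘ₗ S.subtype)) {s : P →ₗ[R] Q} {c : M →ₗ[R] Q}
    (hc : IsPureEmbedding R c) (h : s ∘ₗ g = c ∘ₗ π) : IsPureEmbedding R g := by
  refine isPureEmbedding_of_reflect fun n φ x hx => ?_
  have h1 : φ.Realize (fun i => c (π (x i))) := by
    convert hx.map s using 2 with i
    exact (LinearMap.congr_fun h (x i)).symm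
  obtain ⟨a, ha⟩ := hS.exists_lift_of_ker hπ hker ((hc.2 n φ _).1 h1)
  have h2 : φ.Realize (fun i => (g ∘ₗ S.subtype) (a i)) := by
    convert hx.sub (ha.map g) using 1
    funext i
    simp
  have := ha.add (((hg.2 n φ _).1 h2).map S.subtype)
  convert this using 1
  funext i
  simp

/-- A variant in which the pure submodule is the range of a pure embedding `i`. -/
theorem isPureEmbedding_of_range {L : Type u} [AddCommGroup L] [Module R L] {i : L →ₗ[R] N}
    (hi : IsPureEmbedding R i) {g : N →ₗ[R] P} (hg : IsPureEmbedding R (g ∘ₗ i)) {s : P →ₗ[R] Q}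
    {c : N ⧸ LinearMap.range i →ₗ[R] Q} (hc : IsPureEmbedding R c)
    (h : s ∘ₗ g = c ∘ₗ (LinearMap.range i).mkQ) : IsPureEmbedding R g := by
  refine isPureEmbedding_of_quotient hi.range (Submodule.mkQ_surjective _)
    (Submodule.ker_mkQ _) ?_ hc h
  have : g ∘ₗ (LinearMap.range i).subtype =
      (g ∘ₗ i) ∘ₗ ((LinearEquiv.ofInjective i hi.1).symm : LinearMap.range i →ₗ[R] L) := by
    ext ⟨_, y, rfl⟩
    have : (LinearEquiv.ofInjective i hi.1).symm ⟨i y, y, rfl⟩ = y := by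
      rw [LinearEquiv.symm_apply_eq]; rfl
    simp [this]
  rw [this]
  exact hg.comp (isPureEmbedding_equiv _)

end Purity

/-! ### Modules whose pp-indices are `1` or infinite -/

section Elimination

variable {R : Type u} [Ring R]

/-- Given a relation `Δ` between pp-formulas in one variable, `M` is `Δ`-full if `φ[M] ≤ ψ[M]`
whenever `Δ φ ψ`, while otherwise `φ[M] ∩ ψ[M]` has infinite index in `φ[M]`, as witnessed by a
sequence of elements of `φ[M]` lying in different cosets of `ψ[M]`. -/
def IsFull (Δ : PPFormula R 1 → PPFormula R 1 → Prop) (M : Type u) [AddCommGroup M]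
    [Module R M] : Prop :=
  ∀ φ ψ : PPFormula R 1, (Δ φ ψ → φ.sol M ≤ ψ.sol M) ∧
    (¬ Δ φ ψ → ∃ x : ℕ → M, (∀ n, x n ∈ φ.sol M) ∧ ∀ n m, n ≠ m → x n - x m ∉ ψ.sol M)

variable {Δ : PPFormula R 1 → PPFormula R 1 → Prop} {M N : Type u} [AddCommGroup M] [Module R M]
  [AddCommGroup N] [Module R N]

open scoped Pointwise in
/-- B. H. Neumann's lemma: in a full module, a pp-definable subgroup `φ[M]` is not covered by
finitely many cosets of subgroups `ψ[M]` that do not contain it. -/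
theorem IsFull.exists_notMem_cosets (hM : IsFull Δ M) (φ : PPFormula R 1) {ι : Type*}
    (s : Finset ι) (ψ : ι → PPFormula R 1) (c : ι → M) (hs : ∀ i ∈ s, ¬ Δ φ (ψ i)) :
    ∃ h ∈ φ.sol M, ∀ i ∈ s, h - c i ∉ (ψ i).sol M := by
  classical
  by_contra! hcon
  let K : ι → AddSubgroup (φ.sol M) := fun i => ((ψ i).sol M).addSubgroupOf (φ.sol M)
  let s' := s.filter fun i => ∃ g : φ.sol M, (g : M) - c i ∈ (ψ i).sol M
  let g : ι → φ.sol M := fun i =>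
    if h : ∃ g : φ.sol M, (g : M) - c i ∈ (ψ i).sol M then h.choose else 0
  have hcov : ⋃ i ∈ s', g i +ᵥ (K i : Set (φ.sol M)) = Set.univ := by
    refine Set.eq_univ_of_forall fun h => ?_
    obtain ⟨i, hi, hmem⟩ := hcon h h.2
    have hex : ∃ g : φ.sol M, (g : M) - c i ∈ (ψ i).sol M := ⟨h, hmem⟩
    refine Set.mem_biUnion (x := i) (Finset.mem_filter.2 ⟨hi, hex⟩) ?_
    rw [Set.mem_vadd_set_iff_neg_vadd_mem]
    have hg : g i = hex.choose := dif_pos hex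
    have h2 := hex.choose_spec
    rw [← hg] at h2
    change -((g i : φ.sol M) : M) + (h : M) ∈ (ψ i).sol M
    have := (ψ i).sol M |>.sub_mem hmem h2
    rwa [sub_sub_sub_cancel_right, sub_eq_neg_add] at this
  obtain ⟨k, hk, hfin⟩ := AddSubgroup.exists_finiteIndex_of_leftCoset_cover hcov
  obtain ⟨x, hx, hne⟩ := (hM φ (ψ k)).2 (hs k (Finset.mem_filter.1 hk).1)
  have : Finite (φ.sol M ⧸ K k) := inferInstance
  obtain ⟨n, m, hnm, heq⟩ := Finite.exists_ne_map_eq_of_infinite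
    (fun n : ℕ => (QuotientAddGroup.mk (⟨x n, hx n⟩ : φ.sol M) : φ.sol M ⧸ K k))
  rw [QuotientAddGroup.eq] at heq
  refine hne m n hnm.symm ?_
  have h3 : -(x n) + x m ∈ (ψ k).sol M := heq
  rwa [sub_eq_neg_add]

/-- Terms in the language of modules are linear forms. -/
theorem exists_linear_term {n : ℕ} (t : (lang R).Term (Empty ⊕ Fin n)) :
    ∃ c : Fin n → R, ∀ (M : Type u) [AddCommGroup M] [Module R M] (v : Empty → M)
      (x : Fin n → M), t.realize (Sum.elim v x) = ∑ j, c j • x j := by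
  induction t with
  | var i =>
    rcases i with i | i
    · exact i.elim
    · exact ⟨Pi.single i 1, fun M _ _ v x => by simp [Pi.single_apply]⟩
  | @func l f ts ih =>
    choose c hc using ih
    cases f with
    | zero => exact ⟨0, fun M _ _ v x => by simp; rfl⟩
    | neg =>
      refine ⟨-c 0, fun M _ _ v x => ?_⟩
      have : (FirstOrder.Language.Term.func (L := lang R) Func.neg ts).realize (Sum.elim v x) =
        -((ts 0).realize (Sum.elim v x)) := rfl
      rw [this, hc]
      simp
    | smul r =>
      refine ⟨r • c 0, fun M _ _ v x => ?_⟩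
      have : (FirstOrder.Language.Term.func (L := lang R) (Func.smul r) ts).realize
        (Sum.elim v x) = r • ((ts 0).realize (Sum.elim v x)) := rfl
      rw [this, hc]
      simp [Finset.smul_sum, mul_smul]
    | add =>
      refine ⟨c 0 + c 1, fun M _ _ v x => ?_⟩
      have : (FirstOrder.Language.Term.func (L := lang R) Func.add ts).realize (Sum.elim v x) =
        (ts 0).realize (Sum.elim v x) + (ts 1).realize (Sum.elim v x) := rfl
      rw [this, hc, hc]
      simp [add_smul, Finset.sum_add_distrib]

/-- The step for a quantifier in the elimination of quantifiers: if `a` and `b` satisfy the same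
formulas `∃ y, ⋀ S`, for `S` a finite subset of `Φ`, then each extension of `a` by one element is
matched, with respect to `Φ`, by an extension of `b`. -/
theorem IsFull.exists_match {n : ℕ} [DecidableEq (PPFormula R (n + 1))]
    (hM : IsFull Δ M) (hN : IsFull Δ N)
    (Φ : Finset (PPFormula R (n + 1))) (χ : Finset (PPFormula R (n + 1)) → PPFormula R (n + 1))
    (hχ : ∀ (S : Finset (PPFormula R (n + 1))) (M : Type u) [AddCommGroup M] [Module R M]
      (x : Fin (n + 1) → M), (χ S).Realize x ↔ ∀ φ ∈ S, φ.Realize x)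
    {a : Fin n → M} {b : Fin n → N}
    (hab : ∀ S ⊆ Φ, (χ S).ex.Realize a ↔ (χ S).ex.Realize b) (y : M) :
    ∃ z : N, ∀ φ ∈ Φ, φ.Realize (Fin.snoc a y : Fin (n + 1) → M) ↔
      φ.Realize (Fin.snoc b z : Fin (n + 1) → N) := by
  classical
  have hshift : ∀ (L : Type u) [AddCommGroup L] [Module R L] (φ : PPFormula R (n + 1))
      (d : Fin n → L) (p q : L), φ.Realize (Fin.snoc d p : Fin (n + 1) → L) →
      (φ.Realize (Fin.snoc d q : Fin (n + 1) → L) ↔ q - p ∈ φ.lastVar.sol L) := by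
    intro L _ _ φ d p q hp
    rw [PPFormula.mem_sol, PPFormula.realize_lastVar]
    have h1 : (Fin.snoc 0 (q - p) : Fin (n + 1) → L) =
        (Fin.snoc d q : Fin (n + 1) → L) - (Fin.snoc d p : Fin (n + 1) → L) := by
      funext j
      refine Fin.lastCases ?_ (fun j => ?_) j <;> simp
    change _ ↔ φ.Realize (Fin.snoc 0 (q - p) : Fin (n + 1) → L)
    rw [h1]
    refine ⟨fun hq => hq.sub hp, fun h => ?_⟩
    have := h.add hp
    rwa [sub_add_cancel] at this
  let S := Φ.filter fun φ => φ.Realize (Fin.snoc a y : Fin (n + 1) → M)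
  have hSa : (χ S).Realize (Fin.snoc a y : Fin (n + 1) → M) :=
    (hχ _ _ _).2 fun φ hφ => (Finset.mem_filter.1 hφ).2
  have hSb : (χ S).ex.Realize b :=
    (hab S (Finset.filter_subset _ _)).1 ((PPFormula.realize_ex _ _).2 ⟨y, hSa⟩)
  obtain ⟨z₀, hz₀⟩ := (PPFormula.realize_ex _ _).1 hSb
  -- only formulas outside `S` that are realized somewhere on the coset of `z₀` need avoiding
  let J := (Φ \ S).filter fun φ => ∃ z, (χ S).Realize (Fin.snoc b z : Fin (n + 1) → N) ∧
    φ.Realize (Fin.snoc b z : Fin (n + 1) → N)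
  have hJ : ∀ φ ∈ J, ¬ Δ (χ S).lastVar φ.lastVar := by
    intro φ hφ hΔ
    obtain ⟨h1, z, hz1, hz2⟩ := Finset.mem_filter.1 hφ
    obtain ⟨h1, h2⟩ := Finset.mem_sdiff.1 h1
    have h3 : (χ (insert φ S)).ex.Realize b := by
      rw [PPFormula.realize_ex]
      refine ⟨z, (hχ _ _ _).2 fun ψ hψ => ?_⟩
      rcases Finset.mem_insert.1 hψ with rfl | hψ
      · exact hz2
      · exact (hχ _ _ _).1 hz1 ψ hψ
    have h4 := (hab _ (Finset.insert_subset h1 (Finset.filter_subset _ _))).2 h3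
    obtain ⟨y', hy'⟩ := (PPFormula.realize_ex _ _).1 h4
    have h5 := (hχ _ _ _).1 hy'
    have h6 : (χ S).Realize (Fin.snoc a y' : Fin (n + 1) → M) :=
      (hχ _ _ _).2 fun ψ hψ => h5 ψ (Finset.mem_insert_of_mem hψ)
    have h7 := (hM _ _).1 hΔ ((hshift M _ a y' y h6).1 hSa)
    have h8 := (hshift M φ a y' y (h5 φ (Finset.mem_insert_self _ _))).2 h7
    exact h2 (Finset.mem_filter.2 ⟨h1, h8⟩)
  choose! w hw using fun (φ : PPFormula R (n + 1)) (hφ : φ ∈ J) => (Finset.mem_filter.1 hφ).2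
  obtain ⟨h, hh, hav⟩ := hN.exists_notMem_cosets (χ S).lastVar J (fun φ => φ.lastVar)
    (fun φ => w φ - z₀) hJ
  have hz : (χ S).Realize (Fin.snoc b (z₀ + h) : Fin (n + 1) → N) :=
    (hshift N _ b z₀ _ hz₀).2 (by rwa [add_sub_cancel_left])
  refine ⟨z₀ + h, fun φ hφ => ⟨fun hφy => ?_, fun hφz => ?_⟩⟩
  · exact (hχ _ _ _).1 hz φ (Finset.mem_filter.2 ⟨hφ, hφy⟩)
  · by_contra hφy
    have hφJ : φ ∈ J := Finset.mem_filter.2 ⟨Finset.mem_sdiff.2 ⟨hφ, fun h =>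
      hφy (Finset.mem_filter.1 h).2⟩, _, hz, hφz⟩
    refine hav φ hφJ ?_
    have := (hshift N φ b (w φ) _ (hw φ hφJ).2).1 hφz
    rwa [sub_sub_eq_add_sub, add_comm h z₀]

open FirstOrder in
/-- Elimination of quantifiers for full modules: the truth of a first-order formula at a tuple is
determined by finitely many pp-formulas. -/
theorem exists_finset_determines {n : ℕ} (θ : (lang R).BoundedFormula Empty n) :
    ∃ Φ : Finset (PPFormula R n), ∀ (M N : Type u) [AddCommGroup M] [Module R M]
      [AddCommGroup N] [Module R N], IsFull Δ M → IsFull Δ N →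
      ∀ (v : Empty → M) (w : Empty → N) (a : Fin n → M) (b : Fin n → N),
        (∀ φ ∈ Φ, φ.Realize a ↔ φ.Realize b) → (θ.Realize v a ↔ θ.Realize w b) := by
  classical
  induction θ with
  | falsum => exact ⟨∅, fun M N _ _ _ _ _ _ v w a b _ => Iff.rfl⟩
  | equal t₁ t₂ =>
    obtain ⟨c, hc⟩ := exists_linear_term t₁
    obtain ⟨d, hd⟩ := exists_linear_term t₂
    refine ⟨{PPFormula.linear (c - d)}, fun M N _ _ _ _ _ _ v w a b h => ?_⟩
    have := h _ (Finset.mem_singleton_self _)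
    simp only [PPFormula.realize_linear, Pi.sub_apply, sub_smul, Finset.sum_sub_distrib,
      sub_eq_zero] at this
    change t₁.realize (Sum.elim v a) = t₂.realize (Sum.elim v a) ↔
      t₁.realize (Sum.elim w b) = t₂.realize (Sum.elim w b)
    rw [hc, hc, hd, hd, this]
  | rel r => exact r.elim
  | imp f₁ f₂ ih₁ ih₂ =>
    obtain ⟨Φ₁, h₁⟩ := ih₁
    obtain ⟨Φ₂, h₂⟩ := ih₂
    refine ⟨Φ₁ ∪ Φ₂, fun M N _ _ _ _ hM hN v w a b h => ?_⟩
    have e₁ := h₁ M N hM hN v w a b fun φ hφ => h φ (Finset.mem_union_left _ hφ)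
    have e₂ := h₂ M N hM hN v w a b fun φ hφ => h φ (Finset.mem_union_right _ hφ)
    rw [Language.BoundedFormula.realize_imp, Language.BoundedFormula.realize_imp, e₁, e₂]
  | @all n f ih =>
    obtain ⟨Φ, hΦ⟩ := ih
    choose χ hχ using fun S : Finset (PPFormula R (n + 1)) => PPFormula.exists_conj S id
    refine ⟨Φ.powerset.image fun S => (χ S).ex, fun M N _ _ _ _ hM hN v w a b h => ?_⟩
    have hab : ∀ S ⊆ Φ, (χ S).ex.Realize a ↔ (χ S).ex.Realize b := fun S hS =>
      h _ (Finset.mem_image_of_mem _ (Finset.mem_powerset.2 hS))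
    rw [Language.BoundedFormula.realize_all, Language.BoundedFormula.realize_all]
    constructor
    · intro H z
      obtain ⟨y, hy⟩ := hN.exists_match hM Φ χ hχ (fun S hS => (hab S hS).symm) z
      exact (hΦ M N hM hN v w _ _ fun φ hφ => (hy φ hφ).symm).1 (H y)
    · intro H y
      obtain ⟨z, hz⟩ := hM.exists_match hN Φ χ hχ hab y
      exact (hΦ M N hM hN v w _ _ hz).2 (H z)

open FirstOrder in
/-- Two `Δ`-full modules are elementarily equivalent. -/
theorem IsFull.inClass {T : (lang R).Theory} (hM : IsFull Δ M) (hN : IsFull Δ N)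
    (h : InClass T M) : InClass T N := by
  refine ⟨fun σ hσ => ?_⟩
  have h1 : M ⊨ σ := h.realize_of_mem σ hσ
  obtain ⟨Φ, hΦ⟩ := exists_finset_determines (Δ := Δ) σ
  refine (hΦ M N hM hN default default default default fun φ _ => ?_).1 h1
  exact iff_of_true (by rw [Subsingleton.elim default 0]; exact φ.realize_zero)
    (by rw [Subsingleton.elim default 0]; exact φ.realize_zero)

end Elimination

/-! ### Small pure submodules -/

section LowenheimSkolem

variable {R : Type u}

open Cardinal

theorem aleph0_le_theoryCard : ℵ₀ ≤ theoryCard R := le_add_self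

theorem mk_le_theoryCard : #R ≤ theoryCard R := le_self_add

theorem mk_ppFormula_le (n : ℕ) : #(PPFormula R n) ≤ theoryCard R := by
  have hpow : ∀ (α : Type) [Finite α], #(α → R) ≤ theoryCard R := by
    intro α _
    have := Fintype.ofFinite α
    rw [mk_arrow, lift_uzero, mk_fintype α, lift_natCast, power_natCast]
    exact (power_le_power_right mk_le_theoryCard).trans
      (by exact_mod_cast power_nat_le aleph0_le_theoryCard)
  let f : PPFormula R n → Σ p : ℕ × ℕ, (Fin p.1 × Fin n → R) × (Fin p.1 × Fin p.2 → R) :=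
    fun φ => ⟨(φ.eqs, φ.bound), fun q => φ.A q.1 q.2, fun q => φ.B q.1 q.2⟩
  have hf : Function.Injective f := by
    rintro ⟨e, b, A, B⟩ ⟨e', b', A', B'⟩ h
    simp only [f, Sigma.mk.injEq, Prod.mk.injEq] at h
    obtain ⟨⟨rfl, rfl⟩, h⟩ := h
    rw [heq_iff_eq, Prod.mk.injEq] at h
    have hA : A = A' := funext fun i => funext fun j => congrFun h.1 (i, j)
    have hB : B = B' := funext fun i => funext fun j => congrFun h.2 (i, j)
    rw [hA, hB]
  refine (mk_le_of_injective hf).trans ?_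
  rw [mk_sigma]
  refine (sum_le_sum _ (fun _ => theoryCard R) fun p => ?_).trans ?_
  · rw [mk_prod, lift_id, lift_id]
    exact mul_le_of_le aleph0_le_theoryCard (hpow _) (hpow _)
  · rw [sum_const, mk_eq_aleph0 (ℕ × ℕ), lift_aleph0, lift_uzero]
    exact mul_le_of_le aleph0_le_theoryCard aleph0_le_theoryCard le_rfl

/-- The language of modules expanded by Skolem functions for pp-formulas. -/
def skolemLang (R : Type u) : FirstOrder.Language.{u, 0} :=
  ⟨fun n => Func R n ⊕ Σ φ : PPFormula R n, Fin φ.bound, fun _ => Empty⟩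

theorem mk_skolemLang_functions_le :
    #(Σ n, (skolemLang R).Functions n) ≤ theoryCard R := by
  rw [mk_sigma]
  refine (sum_le_sum _ (fun _ => theoryCard R) fun n => ?_).trans ?_
  · change #(Func R n ⊕ Σ φ : PPFormula R n, Fin φ.bound) ≤ _
    rw [mk_sum, lift_id, lift_id]
    refine add_le_of_le aleph0_le_theoryCard ?_ ?_
    · let f : Func R n → Option (Option (Option R)) := fun g => match g with
        | Func.zero => none
        | Func.neg => some none
        | Func.add => some (some none)
        | Func.smul r => some (some (some r))
      have hf : Function.Injective f := by
        intro a b hab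
        cases a <;> cases b <;> simp_all [f]
      refine (mk_le_of_injective hf).trans ?_
      have h1 : (1 : Cardinal.{u}) ≤ theoryCard R := one_le_aleph0.trans aleph0_le_theoryCard
      rw [mk_option, mk_option, mk_option]
      exact add_le_of_le aleph0_le_theoryCard (add_le_of_le aleph0_le_theoryCard
        (add_le_of_le aleph0_le_theoryCard mk_le_theoryCard h1) h1) h1
    · rw [mk_sigma]
      refine (sum_le_sum _ (fun _ => ℵ₀) fun φ => ?_).trans ?_
      · exact mk_le_aleph0
      · rw [sum_const, lift_uzero, lift_aleph0]
        exact mul_le_of_le aleph0_le_theoryCard (mk_ppFormula_le n) aleph0_le_theoryCard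
  · rw [sum_const, mk_nat, lift_aleph0, lift_uzero]
    exact mul_le_of_le aleph0_le_theoryCard aleph0_le_theoryCard le_rfl

variable [Ring R]

open Classical in
/-- Interpretation of the Skolem functions: they choose witnesses whenever there are some. -/
@[reducible]
noncomputable def skolemStructure (M : Type u) [AddCommGroup M] [Module R M] :
    (skolemLang R).Structure M where
  funMap := fun {_} f x => match f with
    | Sum.inl g => (structureOfModule R M).funMap g x
    | Sum.inr ⟨φ, j⟩ => if h : φ.Realize x then h.choose j else 0
  RelMap := fun r => r.elim

/-- Downward Löwenheim–Skolem theorem for pure submodules. -/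
theorem exists_isPureSubmodule_card_le {M : Type u} [AddCommGroup M] [Module R M] (X : Set M)
    {lam : Cardinal.{u}} (hlam : theoryCard R ≤ lam) (hX : #X ≤ lam) :
    ∃ S : Submodule R M, IsPureSubmodule S ∧ X ⊆ S ∧ #S ≤ lam := by
  classical
  let := skolemStructure (R := R) M
  let C := FirstOrder.Language.Substructure.closure (skolemLang R) X
  have hfun : ∀ {n : ℕ} (f : (skolemLang R).Functions n) (x : Fin n → M), (∀ i, x i ∈ C) →
      FirstOrder.Language.Structure.funMap f x ∈ C := fun f x hx => C.fun_mem f x hx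
  let S : Submodule R M :=
    { carrier := C
      zero_mem' := hfun (n := 0) (Sum.inl Func.zero) ![] (fun i => i.elim0)
      add_mem' := fun {a b} ha hb => hfun (n := 2) (Sum.inl Func.add) ![a, b]
        (fun i => by fin_cases i; exacts [ha, hb])
      smul_mem' := fun r a ha => hfun (n := 1) (Sum.inl (Func.smul r)) ![a]
        (fun i => by fin_cases i; exact ha) }
  refine ⟨S, ?_, FirstOrder.Language.Substructure.subset_closure, ?_⟩
  · refine isPureEmbedding_of_reflect fun n φ x hx => ?_
    have hx' : φ.Realize fun i => (x i : M) := hx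
    refine ⟨fun j => ⟨hx'.choose j, ?_⟩, fun i => ?_⟩
    · have h1 := hfun (n := n) (Sum.inr ⟨φ, j⟩) (fun i => (x i : M)) (fun i => (x i).2)
      change (if h : φ.Realize (fun i => (x i : M)) then h.choose j else 0) ∈ C at h1
      rwa [dif_pos hx'] at h1
    · ext
      simpa using hx'.choose_spec i
  · have h := FirstOrder.Language.Substructure.lift_card_closure_le (L := skolemLang R) (s := X)
    simp only [lift_id] at h
    refine h.trans (max_le (aleph0_le_theoryCard.trans hlam) ?_)
    exact add_le_of_le (aleph0_le_theoryCard.trans hlam) hX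
      (mk_skolemLang_functions_le.trans hlam)

end LowenheimSkolem

/-! ### The definable closure of the class of models -/

section DefinableClosure

variable {R : Type u} [Ring R] (T : (lang R).Theory)

/-- `φ ≤ ψ` in all members of `K^T`. -/
def Implies (φ ψ : PPFormula R 1) : Prop :=
  ∀ (L : Type u) [AddCommGroup L] [Module R L], InClass T L → φ.sol L ≤ ψ.sol L

/-- `M` lies in the definable category generated by `K^T`: each implication between pp-formulas in
one variable that holds in all members of `K^T` holds in `M`. -/
def InDefinableClosure (M : Type u) [AddCommGroup M] [Module R M] : Prop :=
  ∀ φ ψ : PPFormula R 1, Implies T φ ψ → φ.sol M ≤ ψ.sol M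

variable {T} {M N : Type u} [AddCommGroup M] [Module R M] [AddCommGroup N] [Module R N]

theorem InClass.inDefinableClosure (h : InClass T M) : InDefinableClosure T M :=
  fun _ _ hφ => hφ M h

theorem InDefinableClosure.of_pure (hN : InDefinableClosure T N) {f : M →ₗ[R] N}
    (hf : IsPureEmbedding R f) : InDefinableClosure T M :=
  fun φ ψ h _ hx => hf.mem_sol.1 (hN φ ψ h (hf.mem_sol.2 hx))

theorem InDefinableClosure.submodule (hN : InDefinableClosure T N) {S : Submodule R N}
    (hS : IsPureSubmodule S) : InDefinableClosure T S := hN.of_pure hS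

theorem InDefinableClosure.pi {I : Type u} {Y : I → Type u} [∀ i, AddCommGroup (Y i)]
    [∀ i, Module R (Y i)] (h : ∀ i, InDefinableClosure T (Y i)) :
    InDefinableClosure T (∀ i, Y i) := fun φ ψ hφ x hx => by
  rw [PPFormula.mem_sol_pi] at hx ⊢
  exact fun i => h i φ ψ hφ (hx i)

theorem InDefinableClosure.prod (hM : InDefinableClosure T M) (hN : InDefinableClosure T N) :
    InDefinableClosure T (M × N) := fun φ ψ hφ x hx => by
  rw [PPFormula.mem_sol_prod] at hx ⊢
  exact ⟨hM φ ψ hφ hx.1, hN φ ψ hφ hx.2⟩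

theorem InDefinableClosure.quotient (hM : InDefinableClosure T M) {S : Submodule R M}
    (hS : IsPureSubmodule S) : InDefinableClosure T (M ⧸ S) := fun φ ψ hφ x hx => by
  obtain ⟨x, rfl⟩ := S.mkQ_surjective x
  obtain ⟨a, ha⟩ := hS.exists_lift (x := fun _ => x) hx
  have h1 := PPFormula.map_mem_sol (hM φ ψ hφ (x := x - a 0)
    (PPFormula.realize_iff_mem_sol.1 ha)) S.mkQ
  rwa [map_sub, show S.mkQ (a 0) = 0 from (Submodule.Quotient.mk_eq_zero S).2 (a 0).2,
    sub_zero] at h1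

theorem InDefinableClosure.of_directed {ι : Type*} [Nonempty ι] {C : ι → Submodule R M}
    (hdir : Directed (· ≤ ·) C) (hC : ∀ i, InDefinableClosure T (C i)) {S : Submodule R M}
    (hS : (S : Set M) = ⋃ i, (C i : Set M)) : InDefinableClosure T S := by
  intro φ ψ hφ x hx
  obtain ⟨i, x', hx', hr⟩ := exists_realize_of_directed hdir hS (x := fun _ => x) hx
  have hle : C i ≤ S := fun y hy => by
    have : y ∈ (S : Set M) := by rw [hS]; exact Set.mem_iUnion_of_mem i hy
    exact this
  have h1 := PPFormula.map_mem_sol (hC i φ ψ hφ (x := x' 0)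
    (PPFormula.realize_iff_mem_sol.1 hr)) (Submodule.inclusion hle)
  convert h1
  ext
  exact (hx' 0).symm

open Cardinal

/-- `E` is a small infinite model such that every module in the definable closure of `K^T` with a
pure submodule isomorphic to `E` is a model. -/
structure IsAbsorbing (T : (lang R).Theory) (E : Type u) [AddCommGroup E] [Module R E] :
    Prop where
  inClass : InClass T E
  infinite : Infinite E
  card_le : #E ≤ theoryCard R
  absorbs : ∀ (N : Type u) [AddCommGroup N] [Module R N] (f : E →ₗ[R] N),
    InDefinableClosure T N → IsPureEmbedding R f → InClass T N

/-- An absorbing model exists, as a small pure submodule, containing enough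
witnesses, of a direct sum of infinitely many copies of enough models. -/
theorem exists_absorbing_model (h_inf : HasInfiniteModel T) (h_sum : ClosedUnderDirectSums T) :
    ∃ (E : Type u) (_ : AddCommGroup E) (_ : Module R E), IsAbsorbing T E := by
  classical
  let ι := {p : PPFormula R 1 × PPFormula R 1 // ¬ Implies T p.1 p.2}
  have hι : ∀ p : ι, ∃ (L : Type u) (_ : AddCommGroup L) (_ : Module R L), InClass T L ∧
      ∃ x ∈ p.1.1.sol L, x ∉ p.1.2.sol L := by
    rintro ⟨p, hp⟩
    simp only [Implies, not_forall] at hp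
    obtain ⟨L, i₁, i₂, hL, hle⟩ := hp
    obtain ⟨x, hx, hx'⟩ := SetLike.not_le_iff_exists.1 hle
    exact ⟨L, i₁, i₂, hL, x, hx, hx'⟩
  choose L i₁ i₂ hL x hx hx' using hι
  have hne : Nonempty ι := by
    obtain ⟨M, j₁, j₂, hM, hinf⟩ := h_inf
    obtain ⟨a, ha⟩ := exists_ne (0 : M)
    refine ⟨(PPFormula.top, PPFormula.linear fun _ => 1), fun h => ha ?_⟩
    have := h M hM (x := a) (PPFormula.realize_top _)
    rw [PPFormula.mem_sol] at this
    simpa using this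
  let D := DirectSum (ι × ℕ) fun q => L q.1
  have hD : InClass T D := by
    exact h_sum (ι × ℕ) (fun q => L q.1) fun q => hL q.1
  let w : ι × ℕ → D := fun q => DirectSum.lof R (ι × ℕ) (fun q => L q.1) q (x q.1)
  -- the component of `w (p, n) - w (p, m)` at `(p, n)` is `x p`
  have hw : ∀ (p : ι) (n m : ℕ), n ≠ m → w (p, n) - w (p, m) ∉ p.1.2.sol D := by
    intro p n m hnm h
    have h1 := PPFormula.map_mem_sol h (DirectSum.component R (ι × ℕ) (fun q => L q.1) (p, n))
    rw [map_sub, DirectSum.component.lof_self, DirectSum.component.of, dif_neg, sub_zero] at h1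
    · exact hx' p h1
    · intro h2
      exact hnm (Prod.mk.inj h2).2.symm
  have hw' : ∀ (p : ι) (n : ℕ), w (p, n) ∈ p.1.1.sol D := fun p n =>
    PPFormula.map_mem_sol (hx p) _
  have hcard : #(Set.range w) ≤ theoryCard R := by
    refine mk_range_le.trans ?_
    rw [mk_prod, lift_uzero, mk_nat, lift_aleph0]
    refine mul_le_of_le aleph0_le_theoryCard ?_ aleph0_le_theoryCard
    refine (mk_subtype_le _).trans ?_
    rw [mk_prod]
    simp only [lift_id]
    exact mul_le_of_le aleph0_le_theoryCard (mk_ppFormula_le 1) (mk_ppFormula_le 1)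
  obtain ⟨S, hS, hwS, hSc⟩ := exists_isPureSubmodule_card_le _ le_rfl hcard
  have hfull : ∀ (N : Type u) [AddCommGroup N] [Module R N] (f : S →ₗ[R] N),
      InDefinableClosure T N → IsPureEmbedding R f → IsFull (Implies T) N := by
    intro N _ _ f hN hf φ ψ
    refine ⟨hN φ ψ, fun h => ⟨fun n => f ⟨w (⟨(φ, ψ), h⟩, n), hwS ⟨_, rfl⟩⟩, fun n => ?_,
      fun n m hnm hmem => ?_⟩⟩
    · exact hf.mem_sol.2 (hS.mem_sol.1 (hw' ⟨(φ, ψ), h⟩ n))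
    · rw [← map_sub, hf.mem_sol] at hmem
      exact hw ⟨(φ, ψ), h⟩ n m hnm (hS.mem_sol.2 hmem)
  have hSfull := hfull S LinearMap.id (hD.inDefinableClosure.submodule hS) isPureEmbedding_id
  have hDfull := hfull D S.subtype hD.inDefinableClosure hS
  refine ⟨S, inferInstance, inferInstance, hDfull.inClass hSfull hD, ?_, hSc,
    fun N _ _ f hN hf => hDfull.inClass (hfull N f hN hf) hD⟩
  obtain ⟨p⟩ := hne
  refine Infinite.of_injective (fun n : ℕ => (⟨w (p, n), hwS ⟨_, rfl⟩⟩ : S)) fun n m h => ?_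
  by_contra hnm
  refine hw p n m hnm ?_
  rw [sub_eq_zero.2 (congrArg Subtype.val h)]
  exact zero_mem _

end DefinableClosure

/-! ### Algebraic compactness -/

section AlgebraicallyCompact

variable (R : Type u) [Ring R] (M : Type u) [AddCommGroup M] [Module R M]

/-- `M` is algebraically compact: each family of cosets `a + φ[M]` of pp-definable subgroups with
the finite intersection property has a common element. -/
def AlgebraicallyCompact : Prop :=
  ∀ F : Set (PPFormula R 1 × M),
    (∀ s : Finset (PPFormula R 1 × M), ↑s ⊆ F → ∃ x, ∀ p ∈ s, x - p.2 ∈ p.1.sol M) →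
    ∃ x, ∀ p ∈ F, x - p.2 ∈ p.1.sol M

/-- The descending chain condition on pp-definable subgroups of `M`: there is no sequence `φ` of
pp-formulas with `φ 0 ∧ ⋯ ∧ φ n` properly weaker in `M` than `φ 0 ∧ ⋯ ∧ φ (n + 1)` for each `n`. -/
def PPDescending : Prop :=
  ∀ (φ : ℕ → PPFormula R 1) (b : ℕ → M), (∀ n, ∀ k ≤ n, b n ∈ (φ k).sol M) →
    ∃ n, b n ∈ (φ (n + 1)).sol M

variable {R M} {N P : Type u} [AddCommGroup N] [Module R N] [AddCommGroup P] [Module R P]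

theorem PPDescending.of_pure (hN : PPDescending R N) {f : M →ₗ[R] N} (hf : IsPureEmbedding R f) :
    PPDescending R M := fun φ b hb => by
  obtain ⟨n, hn⟩ := hN φ (fun n => f (b n)) fun n k hk => hf.mem_sol.2 (hb n k hk)
  exact ⟨n, hf.mem_sol.1 hn⟩

theorem PPDescending.pi {I : Type u} (hM : PPDescending R M) : PPDescending R (I → M) := by
  intro φ b hb
  by_contra! hcon
  have : ∀ n, ∃ i, b n i ∉ (φ (n + 1)).sol M := fun n => by
    have := hcon n
    rw [PPFormula.mem_sol_pi] at this
    push Not at this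
    exact this
  choose i hi using this
  obtain ⟨n, hn⟩ := hM φ (fun n => b n (i n)) fun n k hk =>
    PPFormula.mem_sol_pi.1 (hb n k hk) (i n)
  exact hi n hn

/-- The descending chain condition makes a suitable finite subfamily of a family of cosets
decisive for the whole family. -/
theorem PPDescending.algebraicallyCompact (hM : PPDescending R M) :
    AlgebraicallyCompact R M := by
  classical
  intro F hF
  obtain ⟨s, hs, hmin⟩ : ∃ s : Finset (PPFormula R 1 × M), ↑s ⊆ F ∧
      ∀ q ∈ F, ∀ x : M, (∀ p ∈ s, x ∈ p.1.sol M) → x ∈ q.1.sol M := by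
    by_contra! hcon
    -- otherwise choose formulas `(f n).1` and elements `(f n).2` showing a descending chain
    obtain ⟨f, hf, hr⟩ := exists_seq_of_forall_finset_exists
      (fun y : (PPFormula R 1 × M) × M => y.1 ∈ F ∧ y.2 ∉ y.1.1.sol M)
      (fun x y => y.2 ∈ x.1.1.sol M) (fun s hs => by
        obtain ⟨q, hq, x, hx, hxq⟩ := hcon (s.image Prod.fst) (by
          intro p hp
          obtain ⟨y, hy, rfl⟩ := Finset.mem_image.1 (Finset.mem_coe.1 hp)
          exact (hs y hy).1)
        exact ⟨(q, x), ⟨hq, hxq⟩, fun y hy => hx _ (Finset.mem_image_of_mem _ hy)⟩)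
    obtain ⟨n, hn⟩ := hM (fun n => (f n).1.1) (fun n => (f (n + 1)).2)
      fun n k hk => hr k (n + 1) (Nat.lt_succ_of_le hk)
    exact (hf (n + 1)).2 hn
  obtain ⟨x, hx⟩ := hF s hs
  refine ⟨x, fun q hq => ?_⟩
  obtain ⟨y, hy⟩ := hF (insert q s) (by
    rw [Finset.coe_insert]; exact Set.insert_subset hq hs)
  have h1 : x - y ∈ q.1.sol M := hmin q hq _ fun p hp => by
    have := (p.1.sol M).sub_mem (hx p hp) (hy p (Finset.mem_insert_of_mem hp))
    rwa [sub_sub_sub_cancel_right] at this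
  have := (q.1.sol M).add_mem h1 (hy q (Finset.mem_insert_self _ _))
  rwa [sub_add_sub_cancel] at this

theorem AlgebraicallyCompact.of_retraction (hN : AlgebraicallyCompact R N) {f : M →ₗ[R] N}
    {g : N →ₗ[R] M} (h : g ∘ₗ f = LinearMap.id) : AlgebraicallyCompact R M := by
  classical
  intro F hF
  have hgf : ∀ x, g (f x) = x := fun x => LinearMap.congr_fun h x
  obtain ⟨x, hx⟩ := hN ((fun p => (p.1, f p.2)) '' F) (by
    intro s hs
    obtain ⟨t, ht, rfl⟩ := Finset.subset_set_image_iff.1 hs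
    obtain ⟨x, hx⟩ := hF t ht
    refine ⟨f x, fun p hp => ?_⟩
    obtain ⟨q, hq, rfl⟩ := Finset.mem_image.1 hp
    rw [← map_sub]
    exact PPFormula.map_mem_sol (hx q hq) f)
  refine ⟨g x, fun p hp => ?_⟩
  have := PPFormula.map_mem_sol (hx _ (Set.mem_image_of_mem _ hp)) g
  rwa [map_sub, hgf] at this

theorem AlgebraicallyCompact.pi {I : Type u} (hM : AlgebraicallyCompact R M) :
    AlgebraicallyCompact R (I → M) := by
  classical
  intro F hF
  have : ∀ i, ∃ x : M, ∀ p ∈ F, x - p.2 i ∈ p.1.sol M := by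
    intro i
    obtain ⟨x, hx⟩ := hM ((fun p => (p.1, p.2 i)) '' F) (by
      intro s hs
      obtain ⟨t, ht, rfl⟩ := Finset.subset_set_image_iff.1 hs
      obtain ⟨x, hx⟩ := hF t ht
      refine ⟨x i, fun p hp => ?_⟩
      obtain ⟨q, hq, rfl⟩ := Finset.mem_image.1 hp
      exact PPFormula.mem_sol_pi.1 (hx q hq) i)
    exact ⟨x, fun p hp => hx _ (Set.mem_image_of_mem _ hp)⟩
  choose x hx using this
  exact ⟨x, fun p hp => PPFormula.mem_sol_pi.2 fun i => hx i p hp⟩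

/-- A relation between `M` and `N` which preserves pp-formulas. -/
def PreservesPP (G : Set (M × N)) : Prop :=
  ∀ (n : ℕ) (φ : PPFormula R n) (x : Fin n → M × N), (∀ i, x i ∈ G) →
    φ.Realize (fun i => (x i).1) → φ.Realize (fun i => (x i).2)

/-- One-step extension of a relation that preserves pp-formulas into an algebraically compact
module: the element to be added solves the formulas `φ (0, y)` shifted by particular solutions. -/
theorem PreservesPP.exists_insert (hN : AlgebraicallyCompact R N) {G : Set (M × N)}
    (hG : PreservesPP (R := R) G) (h0 : (0, 0) ∈ G) (x₀ : M) :
    ∃ y₀ : N, PreservesPP (R := R) (insert (x₀, y₀) G) := by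
  classical
  -- the conditions on `y₀`: formulas over `G` that hold of `x₀`
  let ι := Σ n : ℕ, {q : PPFormula R (n + 1) × (Fin n → M × N) // (∀ i, q.2 i ∈ G) ∧
    q.1.Realize (Fin.snoc (fun i => (q.2 i).1) x₀ : Fin (n + 1) → M)}
  let Sat : ι → N → Prop := fun q y =>
    q.2.1.1.Realize (Fin.snoc (fun i => (q.2.1.2 i).2) y : Fin (q.1 + 1) → N)
  have hex : ∀ q : ι, ∃ y, Sat q y := by
    rintro ⟨n, ⟨φ, a⟩, ha, hφ⟩
    exact (PPFormula.realize_ex _ _).1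
      (hG n φ.ex a ha ((PPFormula.realize_ex _ _).2 ⟨x₀, hφ⟩))
  choose y hy using hex
  have hcoset : ∀ (q : ι) (z : N), Sat q z ↔ z - y q ∈ q.2.1.1.lastVar.sol N := by
    intro q z
    rw [PPFormula.mem_sol, PPFormula.realize_lastVar]
    have h1 : (Fin.snoc 0 (z - y q) : Fin (q.1 + 1) → N) =
        (Fin.snoc (fun i => (q.2.1.2 i).2) z : Fin (q.1 + 1) → N) -
          (Fin.snoc (fun i => (q.2.1.2 i).2) (y q) : Fin (q.1 + 1) → N) := by
      funext j
      refine Fin.lastCases ?_ (fun j => ?_) j <;> simp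
    change _ ↔ q.2.1.1.Realize (Fin.snoc 0 (z - y q) : Fin (q.1 + 1) → N)
    rw [h1]
    refine ⟨fun hq => PPFormula.Realize.sub hq (hy q), fun h => ?_⟩
    have := h.add (hy q)
    rwa [sub_add_cancel] at this
  -- finitely many conditions follow from a single one
  have hfin : ∀ s : Finset ι, ∃ q : ι, ∀ z, Sat q z → ∀ p ∈ s, Sat p z := by
    intro s
    induction s using Finset.induction_on with
    | empty => exact ⟨⟨0, (PPFormula.top, fun i => i.elim0), fun i => i.elim0,
        PPFormula.realize_top _⟩, by simp⟩
    | insert p s _ ih =>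
      obtain ⟨q, hq⟩ := ih
      let e₁ : Fin (p.1 + 1) → Fin (p.1 + q.1 + 1) :=
        Fin.snoc (fun i => (Fin.castAdd q.1 i).castSucc) (Fin.last _)
      let e₂ : Fin (q.1 + 1) → Fin (p.1 + q.1 + 1) :=
        Fin.snoc (fun i => (Fin.natAdd p.1 i).castSucc) (Fin.last _)
      have he₁ : ∀ {L : Type u} (a : Fin p.1 → L) (b : Fin q.1 → L) (c : L),
          (fun j => (Fin.snoc (Fin.append a b) c : Fin (p.1 + q.1 + 1) → L) (e₁ j)) =
            (Fin.snoc a c : Fin (p.1 + 1) → L) := by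
        intro L a b c
        funext j
        refine Fin.lastCases ?_ (fun j => ?_) j <;> simp [e₁]
      have he₂ : ∀ {L : Type u} (a : Fin p.1 → L) (b : Fin q.1 → L) (c : L),
          (fun j => (Fin.snoc (Fin.append a b) c : Fin (p.1 + q.1 + 1) → L) (e₂ j)) =
            (Fin.snoc b c : Fin (q.1 + 1) → L) := by
        intro L a b c
        funext j
        refine Fin.lastCases ?_ (fun j => ?_) j <;>
          simp only [e₂, Fin.snoc_last, Fin.snoc_castSucc, Fin.append_right]
      let ψ : PPFormula R (p.1 + q.1 + 1) := (p.2.1.1.rename e₁).conj (q.2.1.1.rename e₂)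
      have happ : ∀ {L : Type u} (f : M × N → L),
          (fun i => f (Fin.append p.2.1.2 q.2.1.2 i)) =
            Fin.append (fun i => f (p.2.1.2 i)) (fun i => f (q.2.1.2 i)) := by
        intro L f
        funext i
        refine Fin.addCases (fun i => ?_) (fun i => ?_) i <;> simp
      have hψ : ∀ {L : Type u} [AddCommGroup L] [Module R L] (f : M × N → L) (c : L),
          ψ.Realize (Fin.snoc (fun i => f (Fin.append p.2.1.2 q.2.1.2 i)) c :
            Fin (p.1 + q.1 + 1) → L) ↔
          p.2.1.1.Realize (Fin.snoc (fun i => f (p.2.1.2 i)) c : Fin (p.1 + 1) → L) ∧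
          q.2.1.1.Realize (Fin.snoc (fun i => f (q.2.1.2 i)) c : Fin (q.1 + 1) → L) := by
        intro L _ _ f c
        rw [happ, PPFormula.realize_conj, PPFormula.realize_rename, PPFormula.realize_rename,
          he₁, he₂]
      refine ⟨⟨p.1 + q.1, (ψ, Fin.append p.2.1.2 q.2.1.2), fun i => ?_, ?_⟩, fun z hz => ?_⟩
      · refine Fin.addCases (fun i => ?_) (fun i => ?_) i
        · simpa using p.2.2.1 i
        · simpa using q.2.2.1 i
      · exact (hψ Prod.fst x₀).2 ⟨p.2.2.2, q.2.2.2⟩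
      · have hz' := (hψ Prod.snd z).1 hz
        intro r hr
        rcases Finset.mem_insert.1 hr with rfl | hr
        · exact hz'.1
        · exact hq z hz'.2 r hr
  obtain ⟨y₀, hy₀⟩ := hN (Set.range fun q : ι => (q.2.1.1.lastVar, y q)) (by
    intro s hs
    rw [← Set.image_univ] at hs
    obtain ⟨t, -, rfl⟩ := Finset.subset_set_image_iff.1 hs
    obtain ⟨q, hq⟩ := hfin t
    refine ⟨y q, fun p hp => ?_⟩
    obtain ⟨r, hr, rfl⟩ := Finset.mem_image.1 hp
    exact (hcoset r _).1 (hq _ (hy q) r hr))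
  refine ⟨y₀, fun n φ x hx hφ => ?_⟩
  -- replace the occurrences of `(x₀, y₀)` by the last variable, and pad with `(0, 0)`
  let e : Fin n → Fin (n + 1) := fun i => if x i ∈ G then i.castSucc else Fin.last n
  let a : Fin n → M × N := fun i => if x i ∈ G then x i else (0, 0)
  have hea : ∀ {L : Type u} (f : M × N → L),
      (fun j => (Fin.snoc (fun i => f (a i)) (f (x₀, y₀)) : Fin (n + 1) → L) (e j)) =
        fun i => f (x i) := by
    intro L f
    funext j
    by_cases hj : x j ∈ G
    · simp [e, a, hj]
    · have : x j = (x₀, y₀) := (hx j).resolve_right hj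
      have he : e j = Fin.last n := if_neg hj
      simp only [he, Fin.snoc_last, this]
  have ha : ∀ i, a i ∈ G := fun i => by
    by_cases hi : x i ∈ G <;> simp [a, hi, h0]
  let q : ι := ⟨n, (φ.rename e, a), ha, by
    rw [PPFormula.realize_rename]
    have := hea Prod.fst
    rw [this]
    exact hφ⟩
  have h1 : Sat q y₀ := (hcoset q y₀).2 (hy₀ _ ⟨q, rfl⟩)
  have h2 : (φ.rename e).Realize (Fin.snoc (fun i => (a i).2) y₀ : Fin (n + 1) → N) := h1
  rw [PPFormula.realize_rename] at h2
  have h3 := hea Prod.snd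
  rwa [h3] at h2

/-- Linear maps into an algebraically compact module extend along pure embeddings. -/
theorem AlgebraicallyCompact.exists_extension (hP : AlgebraicallyCompact R P) {f : M →ₗ[R] N}
    (hf : IsPureEmbedding R f) (g : M →ₗ[R] P) : ∃ h : N →ₗ[R] P, h ∘ₗ f = g := by
  obtain ⟨G, hle, hmax⟩ := zorn_subset_nonempty {G : Set (N × P) | PreservesPP (R := R) G} (by
    intro c hc hchain hne
    refine ⟨⋃₀ c, fun n φ x hx hφ => ?_, fun s hs => Set.subset_sUnion_of_mem hs⟩
    have hex : ∃ s ∈ c, ∀ i, x i ∈ s := by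
      have hfin := (Set.finite_range x)
      obtain ⟨s, hs, hsub⟩ := DirectedOn.exists_mem_subset_of_finset_subset_biUnion
        (α := N × P) (ι := Set (N × P)) (f := id) (c := c) hne
        (hchain.directedOn) (s := hfin.toFinset) (by
          intro y hy
          obtain ⟨i, rfl⟩ := hfin.mem_toFinset.1 (Finset.mem_coe.1 hy)
          have := hx i
          rwa [Set.sUnion_eq_biUnion] at this)
      exact ⟨s, hs, fun i => hsub (Finset.mem_coe.2 (hfin.mem_toFinset.2 ⟨i, rfl⟩))⟩
    obtain ⟨s, hs, hxs⟩ := hex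
    exact hc hs n φ x hxs hφ) (Set.range fun m => (f m, g m)) (by
      intro n φ x hx hφ
      choose y hy using hx
      have h1 : (fun i => (x i).1) = fun i => f (y i) := funext fun i => by rw [← hy i]
      have h2 : (fun i => (x i).2) = fun i => g (y i) := funext fun i => by rw [← hy i]
      rw [h1, hf.2] at hφ
      rw [h2]
      exact hφ.map g)
  have hG : PreservesPP (R := R) G := hmax.prop
  have h0 : ((0 : N), (0 : P)) ∈ G := hle ⟨0, by simp⟩
  have htot : ∀ x : N, ∃ y : P, (x, y) ∈ G := by
    intro x
    obtain ⟨y, hy⟩ := hG.exists_insert hP h0 x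
    exact ⟨y, hmax.le_of_ge hy (Set.subset_insert _ _) (Set.mem_insert _ _)⟩
  choose h hh using htot
  have hlin : ∀ (r : R) (a b : N) (c : P), (r • a + b, c) ∈ G → c = r • h a + h b := by
    intro r a b c hc
    have := hG 3 (PPFormula.linear ![r, 1, -1]) ![(a, h a), (b, h b), (r • a + b, c)]
      (by intro i; fin_cases i; exacts [hh a, hh b, hc]) (by
        rw [PPFormula.realize_linear]
        simp [Fin.sum_univ_three]
        abel)
    rw [PPFormula.realize_linear] at this
    simp only [Fin.sum_univ_three] at this
    simp at this
    rw [add_neg_eq_zero] at this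
    exact this.symm
  have hz : h 0 = 0 := by
    have := hlin 1 0 0 0 (by simpa using h0)
    have h2 := hlin 1 0 0 (h 0) (by simpa using hh 0)
    simpa using h2
  refine ⟨{ toFun := h, map_add' := fun a b => ?_, map_smul' := fun r a => ?_ }, ?_⟩
  · have := hlin 1 a b _ (by simpa using hh (a + b))
    simpa using this
  · have := hlin r a 0 _ (by simpa using hh (r • a))
    simpa [hz] using this
  · ext m
    have h1 := hlin 1 (f m) 0 (g m) (by simpa using hle ⟨m, rfl⟩)
    rw [hz, one_smul, add_zero] at h1
    exact h1.symm

theorem AlgebraicallyCompact.pureInjective (hM : AlgebraicallyCompact R M) :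
    PureInjective R M := fun _ _ _ _ hf => hM.exists_extension hf LinearMap.id

end AlgebraicallyCompact

/-! ### `Σ`-pure-injectivity and the descending chain condition -/

section SigmaPureInjective

variable {R : Type u} [Ring R] {M : Type u} [AddCommGroup M] [Module R M]

/-- The inclusion of a direct power in the direct product. -/
def finsuppToPi (R : Type u) [Ring R] (I M : Type u) [AddCommGroup M] [Module R M] :
    (I →₀ M) →ₗ[R] (I → M) where
  toFun x := x
  map_add' _ _ := rfl
  map_smul' _ _ := rfl

open Classical in
theorem isPureEmbedding_finsuppToPi {I : Type u} :
    IsPureEmbedding R (finsuppToPi R I M) := by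
  refine isPureEmbedding_of_locallySplit fun n x => ?_
  let s : Finset I := Finset.univ.biUnion fun i => (x i).support
  refine ⟨{ toFun := fun y => Finsupp.onFinset s (fun i => if i ∈ s then y i else 0) (by
              intro i hi
              by_contra h
              simp [h] at hi)
            map_add' := fun a b => by
              ext i
              by_cases h : i ∈ s <;> simp [h]
            map_smul' := fun r a => by
              ext i
              by_cases h : i ∈ s <;> simp [h] }, fun i => ?_⟩
  ext j
  by_cases h : j ∈ s
  · simp [h, finsuppToPi]
    rfl
  · have h2 : j ∉ (x i).support := fun h3 => h (Finset.mem_biUnion.2 ⟨i, Finset.mem_univ _, h3⟩)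
    simp [h, Finsupp.notMem_support_iff.1 h2]

theorem PPDescending.sigmaPureInjective (hM : PPDescending R M) : SigmaPureInjective R M :=
  fun _ => (hM.pi.of_pure isPureEmbedding_finsuppToPi).algebraicallyCompact.pureInjective

/-- If a strictly descending chain of pp-definable subgroups is witnessed by elements `b n`, then a
retraction of `M^ℕ` onto `M^(ℕ)` would send `(b n)` to an element with infinite support. -/
theorem ppDescending_of_pureInjective
    (h : PureInjective R (ULift.{u} ℕ →₀ M)) : PPDescending R M := by
  classical
  intro φ b hb
  by_contra! hcon
  obtain ⟨g, hg⟩ := h _ _ (isPureEmbedding_finsuppToPi (R := R) (I := ULift.{u} ℕ) (M := M))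
  let x : ULift.{u} ℕ → M := fun i => b i.down
  obtain ⟨n, hn⟩ : ∃ n : ℕ, ULift.up n ∉ (g x).support := by
    have := Infinite.exists_notMem_finset (g x).support
    exact ⟨this.choose.down, this.choose_spec⟩
  let a : ULift.{u} ℕ →₀ M := ∑ k ∈ Finset.range (n + 1), Finsupp.single ⟨k⟩ (b k)
  have ha : ∀ k : ℕ, a ⟨k⟩ = if k < n + 1 then b k else 0 := by
    intro k
    simp only [a, Finsupp.finsetSum_apply, Finsupp.single_apply, ULift.up_inj]
    rw [Finset.sum_ite_eq']
    simp
  have h1 : x - finsuppToPi R _ M a ∈ (φ (n + 1)).sol (ULift.{u} ℕ → M) := by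
    rw [PPFormula.mem_sol_pi]
    rintro ⟨k⟩
    change b k - a ⟨k⟩ ∈ _
    rw [ha]
    by_cases hk : k < n + 1
    · simp only [hk, if_true, sub_self]; exact zero_mem _
    · simp only [hk, if_false, sub_zero]; exact hb k (n + 1) (not_lt.1 hk)
  have h2 := PPFormula.map_mem_sol h1 (Finsupp.lapply (R := R) (M := M) (ULift.up n) ∘ₗ g)
  rw [map_sub, LinearMap.comp_apply, LinearMap.comp_apply,
    show g (finsuppToPi R _ M a) = a from LinearMap.congr_fun hg a] at h2
  simp only [Finsupp.lapply_apply, ha, Finsupp.notMem_support_iff.1 hn, Nat.lt_succ_self, if_true,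
    zero_sub, neg_mem_iff] at h2
  exact hcon n h2

theorem SigmaPureInjective.ppDescending (hM : SigmaPureInjective R M) : PPDescending R M :=
  ppDescending_of_pureInjective (hM _)

end SigmaPureInjective

/-! ### The double character dual -/

section Bidual

variable {R : Type u} [Ring R] {M : Type u} [AddCommGroup M] [Module R M]

/-- Injectivity of `ℚ/ℤ`: a character that vanishes on the kernel of `f` factors through `f`. -/
theorem exists_character_factor {X Y : Type u} [AddCommGroup X] [AddCommGroup Y] (f : X →+ Y)
    (g : X →+ AddCircle (1 : ℚ)) (h : ∀ x, f x = 0 → g x = 0) :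
    ∃ k : Y →+ AddCircle (1 : ℚ), ∀ x, k (f x) = g x := by
  let e := QuotientAddGroup.quotientKerEquivRange f
  let g' : X ⧸ f.ker →+ AddCircle (1 : ℚ) := QuotientAddGroup.lift f.ker g h
  let c : CharacterModule f.range := g'.comp e.symm.toAddMonoidHom
  obtain ⟨k, hk⟩ := CharacterModule.dual_surjective_of_injective (R := ℤ)
    f.range.subtype.toIntLinearMap f.range.subtype_injective c
  refine ⟨k, fun x => ?_⟩
  have h1 := DFunLike.congr_fun hk (⟨f x, x, rfl⟩ : f.range)
  have h2 : e.symm ⟨f x, x, rfl⟩ = QuotientAddGroup.mk x := by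
    rw [AddEquiv.symm_apply_eq]; rfl
  change k (f x) = g' (e.symm ⟨f x, x, rfl⟩) at h1
  exact h1.trans (by rw [h2]; rfl)

/-- Characters separate points from subgroups. -/
theorem exists_character_ne_zero {X : Type u} [AddCommGroup X] (H : AddSubgroup X) {x : X}
    (hx : x ∉ H) : ∃ k : X →+ AddCircle (1 : ℚ), (∀ y ∈ H, k y = 0) ∧ k x ≠ 0 := by
  have hne : (QuotientAddGroup.mk x : X ⧸ H) ≠ 0 := by
    rwa [Ne, QuotientAddGroup.eq_zero_iff]
  obtain ⟨c, hc⟩ := CharacterModule.exists_character_apply_ne_zero_of_ne_zero hne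
  refine ⟨AddMonoidHom.comp c (QuotientAddGroup.mk' H), fun y hy => ?_, hc⟩
  have : (QuotientAddGroup.mk' H) y = 0 := (QuotientAddGroup.eq_zero_iff y).2 hy
  exact (congrArg c this).trans (map_zero c)

/-- Multiplication of characters by a ring element: the right action on the character group of a
left module. -/
def precomp (r : R) : (M →+ AddCircle (1 : ℚ)) →+ (M →+ AddCircle (1 : ℚ)) where
  toFun χ := χ.comp (DistribSMul.toAddMonoidHom M r)
  map_zero' := rfl
  map_add' _ _ := rfl

@[simp]
theorem precomp_apply (r : R) (χ : M →+ AddCircle (1 : ℚ)) (x : M) :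
    precomp r χ x = χ (r • x) := rfl

variable (M) in
/-- The double character dual of a left module, with `ℚ/ℤ` as the group of values. -/
def Bidual : Type u := (M →+ AddCircle (1 : ℚ)) →+ AddCircle (1 : ℚ)

namespace Bidual

instance : AddCommGroup (Bidual M) :=
  inferInstanceAs (AddCommGroup ((M →+ AddCircle (1 : ℚ)) →+ AddCircle (1 : ℚ)))

instance : FunLike (Bidual M) (M →+ AddCircle (1 : ℚ)) (AddCircle (1 : ℚ)) :=
  inferInstanceAs (FunLike ((M →+ AddCircle (1 : ℚ)) →+ AddCircle (1 : ℚ)) _ _)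

instance : AddMonoidHomClass (Bidual M) (M →+ AddCircle (1 : ℚ)) (AddCircle (1 : ℚ)) :=
  inferInstanceAs (AddMonoidHomClass ((M →+ AddCircle (1 : ℚ)) →+ AddCircle (1 : ℚ)) _ _)

@[ext]
theorem ext {F G : Bidual M} (h : ∀ χ, F χ = G χ) : F = G := DFunLike.ext _ _ h

@[simp]
theorem add_apply (F G : Bidual M) (χ : M →+ AddCircle (1 : ℚ)) : (F + G) χ = F χ + G χ := rfl

@[simp]
theorem sub_apply (F G : Bidual M) (χ : M →+ AddCircle (1 : ℚ)) : (F - G) χ = F χ - G χ := rfl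

@[simp]
theorem zero_apply (χ : M →+ AddCircle (1 : ℚ)) : (0 : Bidual M) χ = 0 := rfl

theorem sum_apply {ι : Type*} (s : Finset ι) (F : ι → Bidual M) (χ : M →+ AddCircle (1 : ℚ)) :
    (∑ i ∈ s, F i) χ = ∑ i ∈ s, F i χ :=
  AddMonoidHom.finsetSum_apply (M := M →+ AddCircle (1 : ℚ)) F s χ

instance : Module R (Bidual M) where
  smul r F := AddMonoidHom.comp F (precomp r)
  one_smul F := by
    ext χ
    change F (precomp (1 : R) χ) = F χ
    congr 1; ext x; simp
  mul_smul r s F := by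
    ext χ
    change F (precomp (r * s) χ) = F (precomp s (precomp r χ))
    congr 1; ext x; simp [mul_smul]
  smul_zero r := rfl
  smul_add r F G := rfl
  add_smul r s F := by
    ext χ
    change F (precomp (r + s) χ) = F (precomp r χ) + F (precomp s χ)
    rw [← map_add]
    congr 1; ext x; simp [add_smul]
  zero_smul F := by
    ext χ
    change F (precomp (0 : R) χ) = 0
    rw [← map_zero F]
    congr 1; ext x; simp

@[simp]
theorem smul_apply (r : R) (F : Bidual M) (χ : M →+ AddCircle (1 : ℚ)) :
    (r • F) χ = F (precomp r χ) := rfl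

/-- The evaluation map of a module into its double dual. -/
def eval (R : Type u) [Ring R] (M : Type u) [AddCommGroup M] [Module R M] :
    M →ₗ[R] Bidual M where
  toFun x := AddMonoidHom.eval x
  map_add' x y := by
    ext χ
    exact map_add χ x y
  map_smul' r x := rfl

/-- Pp-definable subgroups of the double dual are double annihilators: a tuple `F` satisfies `φ`
iff it kills the annihilator of `φ[M]` in the character group. -/
theorem realize_iff {n : ℕ} (φ : PPFormula R n) (F : Fin n → Bidual M) :
    φ.Realize F ↔ ∀ χ : Fin n → (M →+ AddCircle (1 : ℚ)),
      (∀ x : Fin n → M, φ.Realize x → ∑ j, χ j (x j) = 0) → ∑ j, F j (χ j) = 0 := by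
  constructor
  · rintro ⟨G, hG⟩ χ hχ
    -- `χ` factors through the matrix `(A B)`
    let f : (Fin n → M) × (Fin φ.bound → M) →+ (Fin φ.eqs → M) :=
      { toFun := fun p i => (∑ j, φ.A i j • p.1 j) + ∑ j, φ.B i j • p.2 j
        map_zero' := by funext i; simp
        map_add' := fun p q => by
          funext i
          simp only [Prod.fst_add, Prod.snd_add, Pi.add_apply, smul_add, Finset.sum_add_distrib]
          abel }
    let g : (Fin n → M) × (Fin φ.bound → M) →+ AddCircle (1 : ℚ) :=
      { toFun := fun p => ∑ j, χ j (p.1 j)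
        map_zero' := by simp
        map_add' := fun p q => by simp [Finset.sum_add_distrib] }
    obtain ⟨k, hk⟩ := exists_character_factor f g fun p hp => hχ p.1 ⟨p.2, fun i => congrFun hp i⟩
    let ξ : Fin φ.eqs → (M →+ AddCircle (1 : ℚ)) := fun i =>
      k.comp (AddMonoidHom.single (fun _ => M) i)
    have hsum : ∀ v : Fin φ.eqs → M, ∑ i, ξ i (v i) = k v := by
      intro v
      conv_rhs => rw [← Finset.univ_sum_single v, map_sum]
      rfl
    have hA : ∀ j, χ j = ∑ i, precomp (φ.A i j) (ξ i) := by
      intro j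
      ext x
      have h1 := hk (Pi.single j x, 0)
      rw [← hsum] at h1
      simp only [f, g, AddMonoidHom.coe_mk, ZeroHom.coe_mk] at h1
      rw [Finset.sum_eq_single j (fun b _ hb => by simp [hb]) (by simp), Pi.single_eq_same] at h1
      rw [← h1, AddMonoidHom.finsetSum_apply]
      refine Finset.sum_congr rfl fun i _ => ?_
      rw [Finset.sum_eq_single j (fun b _ hb => by simp [hb]) (by simp), Pi.single_eq_same]
      simp
    have hB : ∀ j, ∑ i, precomp (φ.B i j) (ξ i) = 0 := by
      intro j
      ext x
      have h1 := hk (0, Pi.single j x)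
      rw [← hsum] at h1
      simp only [f, g, AddMonoidHom.coe_mk, ZeroHom.coe_mk] at h1
      simp only [Pi.zero_apply, map_zero, Finset.sum_const_zero, smul_zero, zero_add] at h1
      rw [AddMonoidHom.finsetSum_apply, AddMonoidHom.zero_apply, ← h1]
      refine Finset.sum_congr rfl fun i _ => ?_
      rw [Finset.sum_eq_single j (fun b _ hb => by simp [hb]) (by simp), Pi.single_eq_same]
      simp
    have h2 : ∑ i, ((∑ j, φ.A i j • F j) + ∑ j, φ.B i j • G j) (ξ i) = 0 :=
      Finset.sum_eq_zero fun i _ => by rw [hG i]; rfl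
    simp only [add_apply, sum_apply, smul_apply, Finset.sum_add_distrib] at h2
    rw [Finset.sum_comm, Finset.sum_comm (f := fun i j => G j (precomp (φ.B i j) (ξ i)))] at h2
    simp only [← map_sum, ← hA, hB, map_zero, Finset.sum_const_zero, add_zero] at h2
    exact h2
  · intro h
    -- the witnesses are prescribed on the image of the transpose of `B`
    let f : (Fin φ.eqs → (M →+ AddCircle (1 : ℚ))) →+
        (Fin φ.bound → (M →+ AddCircle (1 : ℚ))) :=
      { toFun := fun ξ j => ∑ i, precomp (φ.B i j) (ξ i)
        map_zero' := by funext i; simp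
        map_add' := fun p q => by funext i; simp [Finset.sum_add_distrib] }
    let g : (Fin φ.eqs → (M →+ AddCircle (1 : ℚ))) →+ AddCircle (1 : ℚ) :=
      { toFun := fun ξ => -∑ j, F j (∑ i, precomp (φ.A i j) (ξ i))
        map_zero' := by simp
        map_add' := fun p q => by simp [Finset.sum_add_distrib]; abel }
    obtain ⟨k, hk⟩ := exists_character_factor f g fun ξ hξ => by
      refine neg_eq_zero.2 (h _ fun x hx => ?_)
      obtain ⟨y, hy⟩ := hx
      have h1 : ∀ j, ∑ i, ξ i (φ.B i j • y j) = 0 := fun j => by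
        have := DFunLike.congr_fun (congrFun hξ j) (y j)
        simpa [f, AddMonoidHom.finsetSum_apply] using this
      have h2 : ∑ i, ξ i ((∑ j, φ.A i j • x j) + ∑ j, φ.B i j • y j) = 0 :=
        Finset.sum_eq_zero fun i _ => by rw [hy i, map_zero]
      simp only [map_add, map_sum, Finset.sum_add_distrib] at h2
      rw [Finset.sum_comm, Finset.sum_comm (f := fun i j => ξ i (φ.B i j • y j))] at h2
      simp only [h1, Finset.sum_const_zero, add_zero] at h2
      simpa [AddMonoidHom.finsetSum_apply] using h2
    refine ⟨fun j => k.comp (AddMonoidHom.single (fun _ => M →+ AddCircle (1 : ℚ)) j),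
      fun i => ?_⟩
    ext χ
    have h1 := hk (Pi.single i χ)
    have h2 : f (Pi.single i χ) = fun j => precomp (φ.B i j) χ := by
      funext j
      change ∑ i', precomp (φ.B i' j) ((Pi.single i χ : Fin φ.eqs → _) i') = _
      rw [Finset.sum_eq_single i (fun b _ hb => by simp [hb]) (by simp), Pi.single_eq_same]
    have h3 : g (Pi.single i χ) = -∑ j, F j (precomp (φ.A i j) χ) := by
      change -∑ j, F j (∑ i', precomp (φ.A i' j) ((Pi.single i χ : Fin φ.eqs → _) i')) = _
      congr 1
      refine Finset.sum_congr rfl fun j _ => ?_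
      rw [Finset.sum_eq_single i (fun b _ hb => by simp [hb]) (by simp), Pi.single_eq_same]
    rw [h2, h3, ← Finset.univ_sum_single (fun j => precomp (φ.B i j) χ), map_sum] at h1
    simp only [add_apply, sum_apply, smul_apply, zero_apply]
    rw [← neg_eq_iff_add_eq_zero, ← h1]
    rfl

theorem mem_sol_iff {φ : PPFormula R 1} {F : Bidual M} :
    F ∈ φ.sol (Bidual M) ↔
      ∀ χ : M →+ AddCircle (1 : ℚ), (∀ x ∈ φ.sol M, χ x = 0) → F χ = 0 := by
  rw [PPFormula.mem_sol, realize_iff]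
  constructor
  · intro h χ hχ
    have := h (fun _ => χ) fun x hx => by
      simpa using hχ (x 0) (PPFormula.realize_iff_mem_sol.1 hx)
    simpa using this
  · intro h χ hχ
    have := h (χ 0) fun x hx => by simpa using hχ (fun _ => x) hx
    simpa using this

theorem isPureEmbedding_eval : IsPureEmbedding R (eval R M) := by
  refine isPureEmbedding_of_reflect fun n φ x hx => ?_
  by_contra hcon
  let H : AddSubgroup (Fin n → M) :=
    { carrier := {x | φ.Realize x}
      zero_mem' := φ.realize_zero
      add_mem' := fun ha hb => PPFormula.Realize.add ha hb
      neg_mem' := fun ha => PPFormula.Realize.neg ha }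
  obtain ⟨k, hk, hkx⟩ := exists_character_ne_zero H (x := x) hcon
  have hsum : ∀ v : Fin n → M, ∑ i, k (Pi.single i (v i)) = k v := by
    intro v
    conv_rhs => rw [← Finset.univ_sum_single v, map_sum]
  have := (realize_iff φ _).1 hx (fun j => k.comp (AddMonoidHom.single (fun _ => M) j))
    fun y hy => (hsum y).trans (hk y hy)
  exact hkx ((hsum x).symm.trans this)

theorem inDefinableClosure {T : (lang R).Theory} (hM : InDefinableClosure T M) :
    InDefinableClosure T (Bidual M) := fun φ ψ h F hF => by
  rw [mem_sol_iff] at hF ⊢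
  exact fun χ hχ => hF χ fun x hx => hχ x (hM φ ψ h hx)

/-- The double dual is algebraically compact: a coset `a + φ[M**]` prescribes the restriction of a
functional to the annihilator of `φ[M]`, and finitely consistent prescriptions have a common
extension since `ℚ/ℤ` is injective. -/
theorem algebraicallyCompact : AlgebraicallyCompact R (Bidual M) := by
  classical
  intro S hS
  let D : S → AddSubgroup (M →+ AddCircle (1 : ℚ)) := fun p =>
    { carrier := {χ | ∀ x ∈ p.1.1.sol M, χ x = 0}
      zero_mem' := fun _ _ => rfl
      add_mem' := fun ha hb x hx => by simp [ha x hx, hb x hx]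
      neg_mem' := fun ha x hx => by simp [ha x hx] }
  let f : (Π₀ p : S, D p) →+ (M →+ AddCircle (1 : ℚ)) :=
    DFinsupp.sumAddHom fun p => (D p).subtype
  let g : (Π₀ p : S, D p) →+ AddCircle (1 : ℚ) :=
    DFinsupp.sumAddHom fun p => AddMonoidHom.comp (p.1.2 : Bidual M) (D p).subtype
  obtain ⟨k, hk⟩ := exists_character_factor f g fun d hd => by
    obtain ⟨F, hF⟩ := hS (d.support.image Subtype.val) (by
      intro p hp
      obtain ⟨q, -, rfl⟩ := Finset.mem_image.1 (Finset.mem_coe.1 hp)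
      exact q.2)
    have h1 : g d = F (f d) := by
      simp only [f, g, DFinsupp.sumAddHom_apply, DFinsupp.sum]
      rw [map_sum]
      refine Finset.sum_congr rfl fun p hp => ?_
      have := mem_sol_iff.1 (hF p.1 (Finset.mem_image_of_mem _ hp)) (d p) (d p).2
      rw [sub_apply, sub_eq_zero] at this
      exact this.symm
    rw [h1, hd, map_zero]
  refine ⟨k, fun p hp => mem_sol_iff.2 fun χ hχ => ?_⟩
  have := hk (DFinsupp.single ⟨p, hp⟩ ⟨χ, hχ⟩)
  simp only [f, g, DFinsupp.sumAddHom_single] at this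
  exact sub_eq_zero.2 this

end Bidual

end Bidual

/-! ### Products with bounded supports -/

section BoundedSupport

open Cardinal

variable {R : Type u} [Ring R] {I Y : Type u} [AddCommGroup Y] [Module R Y] {c : Cardinal.{u}}

theorem mk_biUnion_finset_lt {ι : Type*} (hc : ℵ₀ ≤ c) (s : Finset ι) (f : ι → Set I)
    (hf : ∀ i, #(f i) < c) : #(⋃ i ∈ s, f i : Set I) < c := by
  classical
  induction s using Finset.induction_on with
  | empty => simpa using aleph0_pos.trans_le hc
  | insert i s _ ih =>
    rw [Finset.set_biUnion_insert]
    exact (mk_union_le _ _).trans_lt (add_lt_of_lt hc (hf i) ih)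

variable (R Y) in
/-- The submodule of the power `Y^I` of all functions whose support is contained in `A` and has
fewer than `c` elements. -/
def boundedSupport (hc : ℵ₀ ≤ c) (A : Set I) : Submodule R (I → Y) where
  carrier := {f | Function.support f ⊆ A ∧ #(Function.support f) < c}
  zero_mem' := by simpa using aleph0_pos.trans_le hc
  add_mem' := fun {f g} hf hg => by
    have hsub := Function.support_add f g
    exact ⟨hsub.trans (Set.union_subset hf.1 hg.1),
      (mk_le_mk_of_subset hsub).trans_lt
        ((mk_union_le _ _).trans_lt (add_lt_of_lt hc hf.2 hg.2))⟩
  smul_mem' := fun r f hf => by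
    have hsub : Function.support (r • f) ⊆ Function.support f :=
      Function.support_const_smul_subset r f
    exact ⟨hsub.trans hf.1, (mk_le_mk_of_subset hsub).trans_lt hf.2⟩

theorem boundedSupport_mono {hc : ℵ₀ ≤ c} {A B : Set I} (h : A ⊆ B) :
    boundedSupport R Y hc A ≤ boundedSupport R Y hc B := fun _ hf => ⟨hf.1.trans h, hf.2⟩

theorem single_mem_boundedSupport [DecidableEq I] (hc : ℵ₀ ≤ c) {A : Set I} {i : I} (hi : i ∈ A)
    (y : Y) : (Pi.single i y : I → Y) ∈ boundedSupport R Y hc A := by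
  have hsub : Function.support (Pi.single i y : I → Y) ⊆ {i} := Pi.support_single_subset
  refine ⟨hsub.trans (Set.singleton_subset_iff.2 hi), (mk_le_mk_of_subset hsub).trans_lt ?_⟩
  rw [mk_singleton]
  exact one_lt_aleph0.trans_le hc

open Classical in
theorem isPureSubmodule_boundedSupport (hc : ℵ₀ ≤ c) (A : Set I) :
    IsPureSubmodule (boundedSupport R Y hc A) := by
  refine isPureEmbedding_of_locallySplit fun n x => ?_
  let S : Set I := ⋃ i ∈ (Finset.univ : Finset (Fin n)), Function.support (x i : I → Y)
  have hS : #S < c := mk_biUnion_finset_lt hc _ _ fun i => (x i).2.2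
  have hSA : S ⊆ A := Set.iUnion₂_subset fun i _ => (x i).2.1
  have hind : ∀ f : I → Y, Function.support (S.indicator f) ⊆ S := fun f =>
    Set.support_indicator_subset
  refine ⟨{ toFun := fun f => ⟨S.indicator f, (hind f).trans hSA,
              (mk_le_mk_of_subset (hind f)).trans_lt hS⟩
            map_add' := fun f g => Subtype.ext (Set.indicator_add S f g)
            map_smul' := fun r f => Subtype.ext (Set.indicator_const_smul S r f) }, fun i => ?_⟩
  refine Subtype.ext (Set.indicator_eq_self.2 ?_)
  exact Set.subset_biUnion_of_mem (u := fun i => Function.support (x i : I → Y))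
    (Finset.mem_coe.2 (Finset.mem_univ i))

theorem PPDescending.boundedSupport (hY : PPDescending R Y) (hc : ℵ₀ ≤ c) (A : Set I) :
    PPDescending R (boundedSupport R Y hc A) := hY.pi.of_pure (isPureSubmodule_boundedSupport hc A)

open Classical in
/-- Products with supports of size at most `theoryCard R` are algebraically compact: there are only
so many pp-formulas, and a consistent family of cosets is determined by one coset for each of
them. -/
theorem AlgebraicallyCompact.boundedSupport (hY : AlgebraicallyCompact R Y)
    (hc : ℵ₀ ≤ Order.succ (theoryCard R)) (A : Set I) :
    AlgebraicallyCompact R (boundedSupport R Y hc A) := by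
  intro F hF
  let Q := ModuleClass.boundedSupport R Y hc A
  have hpure : IsPureSubmodule Q := isPureSubmodule_boundedSupport hc A
  let a : PPFormula R 1 → Q := fun φ => if h : ∃ q, (φ, q) ∈ F then h.choose else 0
  have ha : ∀ φ q, (φ, q) ∈ F → (φ, a φ) ∈ F := fun φ q hq => by
    have h : ∃ q, (φ, q) ∈ F := ⟨q, hq⟩
    simp only [a, dif_pos h]
    exact h.choose_spec
  let S : Set I := ⋃ φ, Function.support (a φ : I → Y)
  have hS : #S < Order.succ (theoryCard R) := by
    rw [Order.lt_succ_iff]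
    refine (mk_iUnion_le_sum_mk).trans ((sum_le_sum _ (fun _ => theoryCard R) fun φ =>
      Order.lt_succ_iff.1 (a φ).2.2).trans ?_)
    rw [sum_const, lift_id, lift_id]
    exact mul_le_of_le aleph0_le_theoryCard (mk_ppFormula_le 1) le_rfl
  have hSA : S ⊆ A := Set.iUnion_subset fun φ => (a φ).2.1
  have hsol : ∀ i, ∃ y : Y, ∀ φ q, (φ, q) ∈ F → y - (a φ : I → Y) i ∈ φ.sol Y := by
    intro i
    obtain ⟨y, hy⟩ := hY ((fun p : PPFormula R 1 × Q => (p.1, (p.2 : I → Y) i)) '' F) (by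
      intro s hs
      obtain ⟨t, ht, rfl⟩ := Finset.subset_set_image_iff.1 hs
      obtain ⟨x, hx⟩ := hF t ht
      refine ⟨(x : I → Y) i, fun p hp => ?_⟩
      obtain ⟨q, hq, rfl⟩ := Finset.mem_image.1 hp
      exact PPFormula.map_mem_sol (hx q hq) (LinearMap.proj i ∘ₗ Q.subtype))
    exact ⟨y, fun φ q hq => hy _ ⟨_, ha φ q hq, rfl⟩⟩
  choose y hy using hsol
  have hind : Function.support (S.indicator y) ⊆ S := Set.support_indicator_subset
  refine ⟨⟨S.indicator y, hind.trans hSA, (mk_le_mk_of_subset hind).trans_lt hS⟩, ?_⟩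
  rintro ⟨φ, q⟩ hq
  have h1 : (⟨S.indicator y, hind.trans hSA, (mk_le_mk_of_subset hind).trans_lt hS⟩ : Q) - a φ ∈
      φ.sol Q := by
    rw [← hpure.mem_sol, map_sub, PPFormula.mem_sol_pi]
    intro i
    change S.indicator y i - (a φ : I → Y) i ∈ φ.sol Y
    by_cases hi : i ∈ S
    · rw [Set.indicator_of_mem hi]
      exact hy i φ q hq
    · have : (a φ : I → Y) i = 0 := by
        by_contra h
        exact hi (Set.mem_iUnion_of_mem φ h)
      rw [Set.indicator_of_notMem hi, this, sub_zero]
      exact zero_mem _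
  obtain ⟨z, hz⟩ := hF {(φ, q), (φ, a φ)} (by
    intro p hp
    rcases Finset.mem_insert.1 (Finset.mem_coe.1 hp) with rfl | hp
    · exact hq
    · rw [Finset.mem_singleton.1 hp]
      exact ha φ q hq)
  have h2 := (φ.sol Q).sub_mem (hz (φ, q) (by simp)) (hz (φ, a φ) (by simp))
  rw [sub_sub_sub_cancel_left] at h2
  have := (φ.sol Q).add_mem h1 h2
  rwa [sub_add_sub_cancel] at this

/-- If each small module in the definable closure of `K^T` embeds purely in `Y`, then a module `N`
in the definable closure embeds purely in a product of copies of `Y` with bounded supports, indexed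
by a set of size at least `#N`. A maximal partial embedding is extended along a small extension of
its domain with the help of one more coordinate, labelled by a new element of `N`. -/
theorem exists_pure_boundedSupport {T : (lang R).Theory} {N : Type u} [AddCommGroup N] [Module R N]
    (hN : InDefinableClosure T N) (hc : ℵ₀ ≤ c)
    (hAC : ∀ B : Set I, AlgebraicallyCompact R (boundedSupport R Y hc B))
    (hY : ∀ (C : Type u) [AddCommGroup C] [Module R C], InDefinableClosure T C →
      #C ≤ theoryCard R → ∃ f : C →ₗ[R] Y, IsPureEmbedding R f)
    {A : Set I} (hA : #N ≤ #A) :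
    ∃ g : N →ₗ[R] boundedSupport R Y hc A, IsPureEmbedding R g := by
  classical
  obtain ⟨ν⟩ := hA
  let l : N → I := fun x => ν x
  have hl : Function.Injective l := Subtype.val_injective.comp ν.injective
  let Good : Set (N →ₗ.[R] (I → Y)) := {p | IsPureSubmodule p.domain ∧
    IsPureEmbedding R p.toFun ∧ ∀ x, p x ∈ boundedSupport R Y hc (l '' p.domain)}
  obtain ⟨p, -, hmax⟩ := zorn_le_nonempty₀ Good (by
    intro C hC hchain p₀ hp₀
    have hne : C.Nonempty := ⟨p₀, hp₀⟩
    have hdir : DirectedOn (· ≤ ·) C := hchain.directedOn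
    have : Nonempty C := ⟨⟨p₀, hp₀⟩⟩
    have htuple : ∀ {n : ℕ} (x : Fin n → (LinearPMap.sSup C hdir).domain), ∃ q ∈ C,
        ∃ x' : Fin n → q.domain, ∀ i, (x' i : N) = x i := by
      intro n x
      choose q hq hqx using fun i => (LinearPMap.mem_domain_sSup_iff hne hdir).1 (x i).2
      have hd : Directed (· ≤ ·) (Subtype.val : C → (N →ₗ.[R] (I → Y))) :=
        directedOn_iff_directed.1 hdir
      obtain ⟨z, hz⟩ := hd.finite_le (fun i => (⟨q i, hq i⟩ : C))
      exact ⟨z, z.2, fun i => ⟨x i, (hz i).1 (hqx i)⟩, fun i => rfl⟩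
    have hval : ∀ (q : N →ₗ.[R] (I → Y)), q ∈ C → ∀ (x : (LinearPMap.sSup C hdir).domain)
        (x' : q.domain), (x' : N) = x → LinearPMap.sSup C hdir x = q x' := by
      intro q hq x x' hx
      rw [← LinearPMap.sSup_apply hdir hq x']
      congr 1
      exact Subtype.ext hx.symm
    refine ⟨LinearPMap.sSup C hdir, ⟨?_, ?_, fun x => ?_⟩, fun q hq => LinearPMap.le_sSup hdir hq⟩
    · refine isPureEmbedding_of_reflect fun n φ x hx => ?_
      obtain ⟨q, hq, x', hx'⟩ := htuple x
      have h1 : φ.Realize fun i => q.domain.subtype (x' i) := by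
        have : (fun i => q.domain.subtype (x' i)) = fun i => ((x i : _) : N) := funext hx'
        rw [this]; exact hx
      have h2 := (((hC hq).1.2 n φ x').1 h1).map
        (Submodule.inclusion (LinearPMap.le_sSup hdir hq).1)
      convert h2 using 2 with i
      exact Subtype.ext (hx' i).symm
    · refine isPureEmbedding_of_reflect fun n φ x hx => ?_
      obtain ⟨q, hq, x', hx'⟩ := htuple x
      have h1 : φ.Realize fun i => q.toFun (x' i) := by
        have : (fun i => q.toFun (x' i)) = fun i => (LinearPMap.sSup C hdir).toFun (x i) :=
          funext fun i => (hval q hq (x i) (x' i) (hx' i)).symm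
        rw [this]; exact hx
      have h2 := (((hC hq).2.1.2 n φ x').1 h1).map
        (Submodule.inclusion (LinearPMap.le_sSup hdir hq).1)
      convert h2 using 2 with i
      exact Subtype.ext (hx' i).symm
    · obtain ⟨q, hq, x', hx'⟩ := htuple (fun _ : Fin 1 => x)
      rw [hval q hq x (x' 0) (hx' 0)]
      exact boundedSupport_mono (Set.image_mono (LinearPMap.le_sSup hdir hq).1)
        ((hC hq).2.2 (x' 0))) ⊥ (by
    have hbot : ∀ x : (⊥ : N →ₗ.[R] (I → Y)).domain, x = 0 := fun x =>
      Subtype.ext ((Submodule.mem_bot R).1 x.2)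
    have hreal : ∀ {n : ℕ} (φ : PPFormula R n) (x : Fin n → (⊥ : N →ₗ.[R] (I → Y)).domain),
        φ.Realize x := fun φ x => by
      have : x = 0 := funext fun i => hbot (x i)
      rw [this]
      exact φ.realize_zero
    refine ⟨isPureEmbedding_of_reflect fun n φ x _ => hreal φ x,
      isPureEmbedding_of_reflect fun n φ x _ => hreal φ x, fun x => ?_⟩
    rw [hbot x, LinearPMap.map_zero]
    exact zero_mem _)
  obtain ⟨hpD, hpp, hps⟩ := hmax.prop
  have htop : p.domain = ⊤ := by
    by_contra hne
    obtain ⟨n₀, hn₀⟩ : ∃ n₀, n₀ ∉ p.domain := by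
      by_contra! h
      exact hne (Submodule.eq_top_iff'.2 h)
    obtain ⟨T₀, hT₀, hmem, hcard⟩ := exists_isPureSubmodule_card_le (R := R)
      ({p.domain.mkQ n₀} : Set (N ⧸ p.domain)) (le_refl (theoryCard R)) (by
        rw [mk_singleton]; exact one_le_aleph0.trans aleph0_le_theoryCard)
    have hmem' : p.domain.mkQ n₀ ∈ T₀ := hmem rfl
    let D' : Submodule R N := T₀.comap p.domain.mkQ
    have hD' : IsPureSubmodule D' := hpD.comap_mkQ hT₀
    have hDD' : p.domain ≤ D' := fun x hx => by
      rw [Submodule.mem_comap, show p.domain.mkQ x = 0 from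
        (Submodule.Quotient.mk_eq_zero _).2 hx]
      exact T₀.zero_mem
    let π : D' →ₗ[R] T₀ := (p.domain.mkQ ∘ₗ D'.subtype).codRestrict T₀ fun x => x.2
    have hπ : Function.Surjective π := by
      rintro ⟨y, hy⟩
      obtain ⟨x, rfl⟩ := p.domain.mkQ_surjective y
      exact ⟨⟨x, hy⟩, rfl⟩
    let S : Submodule R D' := p.domain.comap D'.subtype
    have hker : LinearMap.ker π = S := by
      ext x
      rw [LinearMap.mem_ker, Submodule.mem_comap, ← Submodule.Quotient.mk_eq_zero]
      exact Subtype.ext_iff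
    let toD : S →ₗ[R] p.domain := (D'.subtype ∘ₗ S.subtype).codRestrict _ fun x => x.2
    have htoD : IsPureEmbedding R toD :=
      isPureEmbedding_of_retraction (g := (Submodule.inclusion hDD').codRestrict S fun x => x.2)
        rfl
    have hS : IsPureSubmodule S := by
      have : D'.subtype ∘ₗ S.subtype = p.domain.subtype ∘ₗ toD := rfl
      exact IsPureEmbedding.of_comp (g := D'.subtype) (by rw [this]; exact hpD.comp htoD)
    obtain ⟨c₀, hc₀⟩ := hY T₀ ((hN.quotient hpD).submodule hT₀) hcard
    let i₀ := l n₀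
    have hi₀ : i₀ ∉ l '' p.domain := by
      rintro ⟨x, hx, hxn⟩
      exact hn₀ (hl hxn ▸ hx)
    obtain ⟨h, hh⟩ := (hAC (l '' p.domain)).exists_extension (hpD.inclusion hDD')
      (p.toFun.codRestrict _ hps)
    have hhp : ∀ x : p.domain, (h (Submodule.inclusion hDD' x) : I → Y) = p x := fun x =>
      congrArg Subtype.val (LinearMap.congr_fun hh x)
    let g : D' →ₗ[R] (I → Y) :=
      Submodule.subtype _ ∘ₗ h + LinearMap.single R (fun _ : I => Y) i₀ ∘ₗ c₀ ∘ₗ π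
    have hgS : g ∘ₗ S.subtype = p.toFun ∘ₗ toD := by
      ext1 x
      have h0 : π x = 0 := by rw [← LinearMap.mem_ker, hker]; exact x.2
      have h1 := hhp (toD x)
      change (h x : I → Y) + Pi.single i₀ (c₀ (π x)) = p (toD x)
      rw [h0, map_zero, Pi.single_zero, add_zero, ← h1]
      rfl
    have hgpure : IsPureEmbedding R g := by
      refine isPureEmbedding_of_quotient hS hπ hker (g := g)
        (s := LinearMap.proj i₀) (c := c₀) (by rw [hgS]; exact hpp.comp htoD) hc₀ ?_
      ext1 x
      have h1 : (h x : I → Y) i₀ = 0 := by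
        by_contra hne
        exact hi₀ ((h x).2.1 hne)
      change (h x : I → Y) i₀ + (Pi.single i₀ (c₀ (π x)) : I → Y) i₀ = c₀ (π x)
      rw [h1, zero_add, Pi.single_eq_same]
    have hn₀' : n₀ ∈ D' := hmem'
    have hgood : (⟨D', g⟩ : N →ₗ.[R] (I → Y)) ∈ Good := by
      refine ⟨hD', hgpure, fun x => ?_⟩
      refine Submodule.add_mem _ (boundedSupport_mono (Set.image_mono hDD') (h x).2) ?_
      exact single_mem_boundedSupport hc (show i₀ ∈ l '' D' from ⟨n₀, hn₀', rfl⟩) _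
    have hle : p ≤ ⟨D', g⟩ := by
      refine ⟨hDD', fun x y hxy => ?_⟩
      have hyS : y ∈ S := by
        rw [Submodule.mem_comap]
        change (y : N) ∈ p.domain
        rw [← hxy]
        exact x.2
      have h1 : g y = p (toD ⟨y, hyS⟩) := LinearMap.congr_fun hgS ⟨y, hyS⟩
      have h2 : toD ⟨y, hyS⟩ = x := Subtype.ext hxy.symm
      rw [h2] at h1
      exact h1.symm
    exact hn₀ ((hmax.le_of_ge hgood hle).1 hn₀')
  have hle : ∀ x : N, x ∈ p.domain := fun x => htop ▸ Submodule.mem_top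
  let e : N →ₗ[R] p.domain := LinearMap.id.codRestrict p.domain hle
  have he : IsPureEmbedding R e :=
    isPureEmbedding_of_retraction (g := p.domain.subtype) rfl
  have hsub : l '' p.domain ⊆ A := by
    rintro _ ⟨x, -, rfl⟩
    exact (ν x).2
  exact ⟨(p.toFun ∘ₗ e).codRestrict _ fun x => boundedSupport_mono hsub (hps (e x)),
    (hpp.comp he).codRestrict _ _⟩

end BoundedSupport

/-! ### Universal algebraically compact modules -/

section Rich

open Cardinal

variable {R : Type u} [Ring R] {I Y : Type u} [AddCommGroup Y] [Module R Y]

/-- `Y` is an algebraically compact module in the definable closure of `K^T` into which all small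
modules of the definable closure embed purely. -/
structure IsSmallUniversal (T : (lang R).Theory) (Y : Type u) [AddCommGroup Y] [Module R Y] :
    Prop where
  inDefinableClosure : InDefinableClosure T Y
  algebraicallyCompact : AlgebraicallyCompact R Y
  exists_pure : ∀ (C : Type u) [AddCommGroup C] [Module R C], InDefinableClosure T C →
    #C ≤ theoryCard R → ∃ f : C →ₗ[R] Y, IsPureEmbedding R f

/-- A small-universal module: the double dual of the product of all small modules of the definable
closure. -/
theorem exists_isSmallUniversal (T : (lang R).Theory) :
    ∃ (Y : Type u) (_ : AddCommGroup Y) (_ : Module R Y), IsSmallUniversal T Y := by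
  classical
  -- representatives of the small modules, on subsets of a set of cardinality `theoryCard R`
  let X := (theoryCard R).out
  let J := {d : Σ (S : Set X) (_ : AddCommGroup S), Module R S //
    let _ := d.2.1; letI := d.2.2; InDefinableClosure T d.1}
  let i₁ : ∀ j : J, AddCommGroup j.1.1 := fun j => j.1.2.1
  let i₂ : ∀ j : J, Module R j.1.1 := fun j => j.1.2.2
  let G := ∀ j : J, j.1.1
  refine ⟨Bidual G, inferInstance, inferInstance,
    Bidual.inDefinableClosure (InDefinableClosure.pi fun j => j.2),
    Bidual.algebraicallyCompact, fun C _ _ hC hcard => ?_⟩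
  rw [← mk_out (theoryCard R)] at hcard
  obtain ⟨ν⟩ := hcard
  let e : C ≃ Set.range ν := Equiv.ofInjective ν ν.injective
  let _ : AddCommGroup (Set.range ν) := e.symm.addCommGroup
  let _ : Module R (Set.range ν) := e.symm.module R
  let el : Set.range ν ≃ₗ[R] C := e.symm.linearEquiv R
  let j : J := ⟨⟨Set.range ν, inferInstance, inferInstance⟩,
    hC.of_pure (isPureEmbedding_equiv el)⟩
  let s : j.1.1 →ₗ[R] G := LinearMap.single R (fun j : J => j.1.1) j
  have hs : IsPureEmbedding R s :=
    isPureEmbedding_of_retraction (g := LinearMap.proj j) (by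
      ext1 x
      exact Pi.single_eq_same (M := fun j : J => j.1.1) j x)
  exact ⟨Bidual.eval R G ∘ₗ s ∘ₗ (el.symm : C →ₗ[R] Set.range ν),
    Bidual.isPureEmbedding_eval.comp (hs.comp (isPureEmbedding_equiv el.symm))⟩

theorem mk_boundedSupport_succ_le [Infinite I] (hc : ℵ₀ ≤ Order.succ (theoryCard R)) (A : Set I) :
    #(boundedSupport R Y hc A) ≤ (#I * #Y) ^ theoryCard R := by
  classical
  let K := (theoryCard R).out
  have hK : #K = theoryCard R := mk_out _
  obtain ⟨i₀⟩ := (inferInstance : Nonempty I)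
  -- enumerate a set containing the support
  have hex : ∀ f : boundedSupport R Y hc A, ∃ e : K → I,
      Function.support (f : I → Y) ⊆ Set.range e := by
    intro f
    have h1 : #(Function.support (f : I → Y)) ≤ #K := by
      rw [hK]; exact Order.lt_succ_iff.1 f.2.2
    obtain ⟨ν⟩ := h1
    refine ⟨fun k => if h : ∃ s, ν s = k then h.choose else i₀, fun i hi => ⟨ν ⟨i, hi⟩, ?_⟩⟩
    have h : ∃ s, ν s = ν ⟨i, hi⟩ := ⟨_, rfl⟩
    simp only [dif_pos h]
    exact congrArg Subtype.val (ν.injective h.choose_spec)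
  choose e he using hex
  let F : boundedSupport R Y hc A → (K → I × Y) := fun f k => (e f k, (f : I → Y) (e f k))
  have key : ∀ f g, F f = F g → ∀ i, (f : I → Y) i ≠ 0 → (f : I → Y) i = (g : I → Y) i := by
    intro f g hfg i hi
    obtain ⟨k, rfl⟩ := he f hi
    have h1 := congrFun hfg k
    simp only [F, Prod.mk.injEq] at h1
    rw [h1.2, h1.1]
  have hF : Function.Injective F := by
    intro f g hfg
    refine Subtype.ext (funext fun i => ?_)
    by_cases hi : (f : I → Y) i = 0
    · by_cases hi' : (g : I → Y) i = 0
      · rw [hi, hi']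
      · exact (key g f hfg.symm i hi').symm
    · exact key f g hfg i hi
  refine (mk_le_of_injective hF).trans_eq ?_
  rw [mk_arrow, mk_prod, hK]
  simp only [lift_id]

theorem mk_boundedSupport_aleph0_le [Infinite I] [Nontrivial Y] (A : Set I) :
    #(boundedSupport R Y le_rfl A) ≤ max #I #Y := by
  rw [← mk_finsupp_of_infinite I Y]
  let F : boundedSupport R Y le_rfl A → (I →₀ Y) := fun f =>
    Finsupp.ofSupportFinite f (lt_aleph0_iff_set_finite.1 f.2.2)
  refine mk_le_of_injective (f := F) fun f g hfg => Subtype.ext (funext fun i => ?_)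
  exact DFunLike.congr_fun hfg i

theorem le_mk_boundedSupport [Nontrivial Y] {c : Cardinal.{u}} (hc : ℵ₀ ≤ c) :
    #I ≤ #(boundedSupport R Y hc (Set.univ : Set I)) := by
  classical
  obtain ⟨y, hy⟩ := exists_ne (0 : Y)
  let F : I → boundedSupport R Y hc (Set.univ : Set I) := fun i =>
    ⟨Pi.single i y, single_mem_boundedSupport hc (Set.mem_univ i) y⟩
  refine mk_le_of_injective (f := F) fun i j hij => ?_
  by_contra hne
  have := congrFun (congrArg Subtype.val hij) i
  simp only [F, Pi.single_eq_same, Pi.single_eq_of_ne hne] at this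
  exact hy this

/-- `Q` is a model of cardinality `lam`, algebraically compact, and all modules of cardinality at
most `lam` in the definable closure of `K^T` embed purely in it. -/
structure IsRich (T : (lang R).Theory) (lam : Cardinal.{u}) (Q : Type u) [AddCommGroup Q]
    [Module R Q] : Prop where
  inClass : InClass T Q
  card : #Q = lam
  algebraicallyCompact : AlgebraicallyCompact R Q
  exists_pure : ∀ (N : Type u) [AddCommGroup N] [Module R N], InDefinableClosure T N →
    #N ≤ lam → ∃ f : N →ₗ[R] Q, IsPureEmbedding R f

variable {T : (lang R).Theory} {E : Type u} [AddCommGroup E] [Module R E]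

theorem IsSmallUniversal.nontrivial (hY : IsSmallUniversal T Y) (hE : IsAbsorbing T E) :
    Nontrivial Y := by
  have := hE.infinite
  obtain ⟨f, hf⟩ := hY.exists_pure E hE.inClass.inDefinableClosure hE.card_le
  exact hf.1.nontrivial

theorem IsSmallUniversal.isRich_boundedSupport (hY : IsSmallUniversal T Y) (hE : IsAbsorbing T E)
    {c : Cardinal.{u}} (hc : ℵ₀ ≤ c) [Infinite I]
    (hAC : ∀ B : Set I, AlgebraicallyCompact R (boundedSupport R Y hc B))
    (hcard : #(boundedSupport R Y hc (Set.univ : Set I)) ≤ #I) :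
    IsRich T #I (boundedSupport R Y hc (Set.univ : Set I)) := by
  classical
  have := hY.nontrivial hE
  obtain ⟨i⟩ := (inferInstance : Nonempty I)
  obtain ⟨f, hf⟩ := hY.exists_pure E hE.inClass.inDefinableClosure hE.card_le
  have hs : IsPureEmbedding R (LinearMap.single R (fun _ : I => Y) i) :=
    isPureEmbedding_of_retraction (g := LinearMap.proj i) (by ext x; simp)
  refine ⟨hE.absorbs _ ((LinearMap.single R (fun _ : I => Y) i ∘ₗ f).codRestrict _ fun x =>
    single_mem_boundedSupport hc (Set.mem_univ i) (f x)) ?_ ((hs.comp hf).codRestrict _ _),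
    le_antisymm hcard (le_mk_boundedSupport hc), hAC _, fun N _ _ hN hle =>
    exists_pure_boundedSupport hN hc hAC hY.exists_pure (by rwa [mk_univ])⟩
  exact (InDefinableClosure.pi fun _ => hY.inDefinableClosure).submodule
    (isPureSubmodule_boundedSupport hc _)

/-- Rich models exist in suitable cardinals. -/
theorem IsSmallUniversal.exists_isRich (hY : IsSmallUniversal T Y) (hE : IsAbsorbing T E) :
    ∃ lam, Order.succ (theoryCard R) ≤ lam ∧
      ∃ (Q : Type u) (_ : AddCommGroup Q) (_ : Module R Q), IsRich T lam Q := by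
  have hκ := aleph0_le_theoryCard (R := R)
  let ν := max #Y (theoryCard R)
  have hν : theoryCard R ≤ ν := le_max_right _ _
  let I := ((2 : Cardinal.{u}) ^ ν).out
  have hI : #I = 2 ^ ν := mk_out _
  have hνI : ν < #I := by rw [hI]; exact cantor ν
  have hinf : Infinite I := infinite_iff.2 (hκ.trans (hν.trans hνI.le))
  have hc : ℵ₀ ≤ Order.succ (theoryCard R) := hκ.trans (Order.le_succ _)
  have hpow : (#I * #Y) ^ theoryCard R ≤ #I := by
    have h1 : #I * #Y ≤ 2 ^ ν := by
      rw [← hI]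
      exact mul_le_of_le (hκ.trans (hν.trans hνI.le)) le_rfl ((le_max_left _ _).trans hνI.le)
    refine (power_le_power_right h1).trans_eq ?_
    rw [← power_mul, mul_eq_left (hκ.trans hν) hν (aleph0_pos.trans_le hκ).ne', hI]
  exact ⟨#I, Order.succ_le_of_lt (hν.trans_lt hνI), _, _, _, hY.isRich_boundedSupport hE hc
    (fun B => hY.algebraicallyCompact.boundedSupport hc B)
    ((mk_boundedSupport_succ_le hc _).trans hpow)⟩

/-- Under the descending chain condition finite supports suffice, and rich models exist in all
large cardinals. -/
theorem IsSmallUniversal.exists_isRich_of_ppDescending (hY : IsSmallUniversal T Y)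
    (hE : IsAbsorbing T E) (hdcc : PPDescending R Y) {lam : Cardinal.{u}} (h₁ : ℵ₀ ≤ lam)
    (h₂ : #Y ≤ lam) :
    ∃ (Q : Type u) (_ : AddCommGroup Q) (_ : Module R Q), IsRich T lam Q := by
  have hI : #lam.out = lam := mk_out _
  have hinf : Infinite lam.out := infinite_iff.2 (by rwa [hI])
  have := hY.nontrivial hE
  have h := hY.isRich_boundedSupport hE (I := lam.out) le_rfl
    (fun B => (hdcc.boundedSupport le_rfl B).algebraicallyCompact)
    ((mk_boundedSupport_aleph0_le _).trans (max_le le_rfl (by rwa [hI])))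
  rw [hI] at h
  exact ⟨_, _, _, h⟩

end Rich

/-! ### Universal extensions -/

section UniversalExtensions

open Cardinal

variable {R : Type u} [Ring R] {T : (lang R).Theory} {M N M₂ N₂ : Type u} [AddCommGroup M]
  [Module R M] [AddCommGroup N] [Module R N] [AddCommGroup M₂] [Module R M₂] [AddCommGroup N₂]
  [Module R N₂] {E : Type u} [AddCommGroup E] [Module R E]

open FirstOrder in
theorem InClass.congr (h : InClass T M) (e : M ≃ₗ[R] N) : InClass T N := by
  have : M ⊨ T := h
  let f : M ≃[lang R] N :=
    { e.toEquiv with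
      map_fun' := fun {n} g x => by
        cases g with
        | zero => exact map_zero e
        | neg => exact map_neg e _
        | smul r => exact map_smul e r _
        | add => exact map_add e _ _
      map_rel' := fun r => r.elim }
  exact Language.StrongHomClass.theory_model (F := M ≃[lang R] N) f

theorem UniversalOver.congr {e : N →ₗ[R] M} (he : UniversalOver T e) (a : N ≃ₗ[R] N₂)
    (b : M ≃ₗ[R] M₂) {e₂ : N₂ →ₗ[R] M₂} (h : ∀ x, e₂ (a x) = b (e x)) : UniversalOver T e₂ := by
  obtain ⟨hN, hM, hp, hc, hu⟩ := he
  have h' : e₂ = (b : M →ₗ[R] M₂) ∘ₗ e ∘ₗ (a.symm : N₂ →ₗ[R] N) := by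
    ext x
    simpa using h (a.symm x)
  refine ⟨hN.congr a, hM.congr b, ?_, ?_, fun N' _ _ g hN' hcard hg => ?_⟩
  · rw [h']
    exact (isPureEmbedding_equiv b).comp (hp.comp (isPureEmbedding_equiv a.symm))
  · rw [← a.toEquiv.cardinal_eq, ← b.toEquiv.cardinal_eq, hc]
  · obtain ⟨f, hf, hfg⟩ := hu N' (g ∘ₗ (a : N →ₗ[R] N₂)) hN'
      (by rw [hcard, a.toEquiv.cardinal_eq]) (hg.comp (isPureEmbedding_equiv a))
    refine ⟨(b : M →ₗ[R] M₂) ∘ₗ f, (isPureEmbedding_equiv b).comp hf, ?_⟩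
    ext x
    have h1 := LinearMap.congr_fun hfg (a.symm x)
    simp only [LinearMap.comp_apply, LinearEquiv.coe_coe, LinearEquiv.apply_symm_apply] at h1
    rw [h']
    simp [h1]

/-- If `M` is universal over `N`, then each subset of cardinality at most `#N` of a pure extension
`X` of `N` in the definable closure is contained in a pure submodule that embeds in `M` over `N`:
a pure submodule containing the subset and `N` becomes a model after adding `E`. -/
theorem UniversalOver.absorb {e : N →ₗ[R] M} (he : UniversalOver T e) (hE : IsAbsorbing T E)
    (hκ : theoryCard R ≤ #N) {X : Type u} [AddCommGroup X] [Module R X]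
    (hX : InDefinableClosure T X) {g : N →ₗ[R] X} (hg : IsPureEmbedding R g) {S : Set X}
    (hS : #S ≤ #N) :
    ∃ (W : Submodule R X) (hW : ∀ x, g x ∈ W), IsPureSubmodule W ∧ S ⊆ W ∧
      ∃ f : W →ₗ[R] M, IsPureEmbedding R f ∧ f ∘ₗ g.codRestrict W hW = e := by
  have hinf : ℵ₀ ≤ #N := aleph0_le_theoryCard.trans hκ
  obtain ⟨W, hWp, hSW, hcard⟩ := exists_isPureSubmodule_card_le (S ∪ Set.range g) hκ
    ((mk_union_le _ _).trans (add_le_of_le hinf hS mk_range_le))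
  have hW : ∀ x, g x ∈ W := fun x => hSW (Or.inr ⟨x, rfl⟩)
  refine ⟨W, hW, hWp, Set.subset_union_left.trans hSW, ?_⟩
  have hgW : IsPureEmbedding R (g.codRestrict W hW) := hg.codRestrict W hW
  have hWE : InClass T (W × E) := hE.absorbs _ (LinearMap.inr R W E)
    ((hX.submodule hWp).prod hE.inClass.inDefinableClosure) isPureEmbedding_inr
  have hc : #(W × E) = #N := by
    apply le_antisymm
    · rw [mk_prod, lift_id, lift_id]
      exact mul_le_of_le hinf hcard (hE.card_le.trans hκ)
    · exact mk_le_of_injective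
        (f := LinearMap.inl R W E ∘ₗ g.codRestrict W hW) (isPureEmbedding_inl.comp hgW).1
  obtain ⟨f, hf, hfg⟩ := he.2.2.2.2 (W × E) (LinearMap.inl R W E ∘ₗ g.codRestrict W hW) hWE hc
    (isPureEmbedding_inl.comp hgW)
  exact ⟨f ∘ₗ LinearMap.inl R W E, hf.comp isPureEmbedding_inl, hfg⟩

/-- A universal extension of a module of cardinality `lam` is universal for `lam`. -/
theorem UniversalOver.exists_pure {e : N →ₗ[R] M} (he : UniversalOver T e) (hE : IsAbsorbing T E)
    (hκ : theoryCard R ≤ #N) {L : Type u} [AddCommGroup L] [Module R L]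
    (hL : InDefinableClosure T L) (hcard : #L ≤ #N) :
    ∃ f : L →ₗ[R] M, IsPureEmbedding R f := by
  obtain ⟨W, hW, hWp, hSW, f, hf, -⟩ := he.absorb hE hκ
    (he.1.inDefinableClosure.prod hL) (g := LinearMap.inl R N L) isPureEmbedding_inl
    (S := Set.range (LinearMap.inr R N L)) (mk_range_le.trans hcard)
  exact ⟨f ∘ₗ (LinearMap.inr R N L).codRestrict W fun x => hSW ⟨x, rfl⟩,
    hf.comp (isPureEmbedding_inr.codRestrict W _)⟩

/-- If `N` is algebraically compact and `Q` is a complement that is universal in the cardinality of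
`N`, then the sum is universal over `N`, since pure extensions of `N` split. -/
theorem IsRich.universalOver {lam : Cardinal.{u}} {Q : Type u} [AddCommGroup Q] [Module R Q]
    (hQ : IsRich T lam Q) (hN : InClass T N) (hNc : #N = lam) (hNA : AlgebraicallyCompact R N)
    (hM : InClass T M) (hMc : #M = lam) {e : N →ₗ[R] M} (he : IsPureEmbedding R e)
    {j : Q →ₗ[R] M} {s : M →ₗ[R] Q} (hse : s ∘ₗ e = 0) (hsj : s ∘ₗ j = LinearMap.id) :
    UniversalOver T e := by
  refine ⟨hN, hM, he, hMc.trans hNc.symm, fun N' _ _ g hN' hcard hg => ?_⟩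
  obtain ⟨h, hh⟩ := hNA.exists_extension hg LinearMap.id
  obtain ⟨k, hk⟩ := hQ.exists_pure (N' ⧸ LinearMap.range g)
    (hN'.inDefinableClosure.quotient hg.range)
    ((mk_le_of_surjective (Submodule.mkQ_surjective _)).trans (hcard.trans hNc).le)
  let f : N' →ₗ[R] M := e ∘ₗ h + j ∘ₗ k ∘ₗ (LinearMap.range g).mkQ
  have hfg : f ∘ₗ g = e := by
    ext x
    have h1 : (LinearMap.range g).mkQ (g x) = 0 :=
      (Submodule.Quotient.mk_eq_zero _).2 ⟨x, rfl⟩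
    have h2 : h (g x) = x := LinearMap.congr_fun hh x
    simp only [f, LinearMap.comp_apply, LinearMap.add_apply, h1, h2, map_zero, add_zero]
  refine ⟨f, isPureEmbedding_of_range hg (by rw [hfg]; exact he) hk (s := s) ?_, hfg⟩
  ext1 x
  have h1 : ∀ y, s (e y) = 0 := fun y => LinearMap.congr_fun hse y
  have h2 : ∀ y, s (j y) = y := fun y => LinearMap.congr_fun hsj y
  simp only [f, LinearMap.comp_apply, LinearMap.add_apply, map_add, h1, h2, zero_add]

end UniversalExtensions

/-! ### Limit models -/

section LimitModels

open Cardinal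

variable {R : Type u} [Ring R] {T : (lang R).Theory} {M N : Type u} [AddCommGroup M]
  [Module R M] [AddCommGroup N] [Module R N] {E : Type u} [AddCommGroup E] [Module R E]
  {lam : Cardinal.{u}} {α : Ordinal.{u}} {C : Ordinal.{u} → Submodule R M}

namespace IsLimitChain

theorem directed (hC : IsLimitChain T lam α M C) :
    Directed (· ≤ ·) (fun i : Set.Iio α => C i) := by
  intro i j
  rcases le_total i j with h | h
  · exact ⟨j, (hC.increasing i j h j.2).1, le_rfl⟩
  · exact ⟨i, le_rfl, (hC.increasing j i h i.2).1⟩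

theorem exists_mem (hC : IsLimitChain T lam α M C) (x : M) : ∃ i < α, x ∈ C i := by
  have : x ∈ ⋃ i ∈ Set.Iio α, (C i : Set M) := by rw [hC.union]; trivial
  simpa using this

theorem coe_top (hC : IsLimitChain T lam α M C) :
    ((⊤ : Submodule R M) : Set M) = ⋃ i : Set.Iio α, (C i : Set M) := by
  rw [Submodule.top_coe, ← hC.union, Set.biUnion_eq_iUnion]

theorem nonempty (hC : IsLimitChain T lam α M C) : Nonempty (Set.Iio α) := by
  obtain ⟨i, hi, -⟩ := hC.exists_mem 0
  exact ⟨⟨i, hi⟩⟩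

theorem isPureSubmodule (hC : IsLimitChain T lam α M C) {i : Ordinal.{u}} (hi : i < α) :
    IsPureSubmodule (C i) := by
  have := hC.nonempty
  refine isPureEmbedding_of_reflect fun n φ x hx => ?_
  have h1 : φ.Realize fun k => (⟨(x k : M), trivial⟩ : (⊤ : Submodule R M)) :=
    PPFormula.Realize.map hx (LinearMap.id.codRestrict ⊤ fun _ => trivial)
  obtain ⟨j, x', hx', hr⟩ := exists_realize_of_directed hC.directed hC.coe_top h1
  have hmax : max i j < α := max_lt hi j.2
  obtain ⟨hle, hp⟩ := hC.increasing i _ (le_max_left i j) hmax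
  obtain ⟨hle', -⟩ := hC.increasing j _ (le_max_right i j) hmax
  refine (hp.2 n φ x).1 ?_
  convert hr.map (Submodule.inclusion hle') using 2 with k
  exact Subtype.ext (hx' k).symm

theorem inDefinableClosure (hC : IsLimitChain T lam α M C) : InDefinableClosure T M := by
  have := hC.nonempty
  have h := InDefinableClosure.of_directed hC.directed
    (fun i => (hC.mem i i.2).inDefinableClosure) hC.coe_top
  exact h.of_pure (isPureEmbedding_equiv Submodule.topEquiv.symm)

theorem mk_le (hC : IsLimitChain T lam α M C) (hlam : ℵ₀ ≤ lam) (hα : α < (Order.succ lam).ord) :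
    #M ≤ lam := by
  rw [← mk_univ, ← hC.union]
  refine mk_biUnion_le_of_le (Order.lt_succ_iff.1 (lt_ord.1 hα)) hlam _ fun i hi => ?_
  exact (hC.card i hi).le

end IsLimitChain

theorem IsLimitModel.inDefinableClosure (h : IsLimitModel T lam M) : InDefinableClosure T M := by
  obtain ⟨α, -, -, -, C, hC⟩ := h
  exact hC.inDefinableClosure

theorem IsLimitModel.mk_le (h : IsLimitModel T lam M) : #M ≤ lam := by
  obtain ⟨α, hlam, -, hα, C, hC⟩ := h
  exact hC.mk_le hlam hα

/-- A limit model is universal for modules of its cardinality in the definable closure. -/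
theorem IsLimitModel.exists_pure (h : IsLimitModel T lam M) (hE : IsAbsorbing T E)
    (hκ : theoryCard R ≤ lam) {L : Type u} [AddCommGroup L] [Module R L]
    (hL : InDefinableClosure T L) (hcard : #L ≤ lam) : ∃ f : L →ₗ[R] M, IsPureEmbedding R f := by
  obtain ⟨α, hlam, hlim, hα, C, hC⟩ := h
  have h0 : (0 : Ordinal) < α := hlim.bot_lt
  obtain ⟨hle, hu⟩ := hC.universal 0 h0
  have hc : #(C 0) = lam := hC.card 0 h0
  obtain ⟨f, hf⟩ := hu.exists_pure hE (by rwa [hc]) hL (by rwa [hc])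
  exact ⟨(C (Order.succ 0)).subtype ∘ₗ f, (hC.isPureSubmodule (hlim.succ_lt h0)).comp hf⟩

open Classical Ordinal in
/-- The direct sum of countably many copies of a rich model is a limit model of length `ω`. -/
theorem IsRich.isLimitModel (hM : IsRich T lam M) (hE : IsAbsorbing T E)
    (hκ : theoryCard R ≤ lam) : IsLimitModel T lam (ULift.{u} ℕ →₀ M) := by
  have hlam : ℵ₀ ≤ lam := aleph0_le_theoryCard.trans hκ
  let S : Ordinal.{u} → Set (ULift.{u} ℕ) := fun i => {k | (k.down : Ordinal.{u}) ≤ i}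
  have hS : ∀ {i j : Ordinal.{u}}, i ≤ j → S i ⊆ S j := fun h k hk => le_trans hk h
  let C : Ordinal.{u} → Submodule R (ULift.{u} ℕ →₀ M) := fun i => Finsupp.supported M R (S i)
  have hsingle : ∀ (i : Ordinal.{u}) (k : ℕ) (x : M), (k : Ordinal.{u}) ≤ i →
      Finsupp.single ⟨k⟩ x ∈ C i := fun i k x h => Finsupp.single_mem_supported R x h
  have hpure : ∀ i, IsPureSubmodule (C i) := fun i =>
    isPureEmbedding_of_retraction (Finsupp.restrictDom_comp_subtype (M := M) (R := R) (S i))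
  obtain ⟨f, hf⟩ := hM.exists_pure E hE.inClass.inDefinableClosure (hE.card_le.trans hκ)
  have hinfM : Infinite M := infinite_iff.2 (hlam.trans hM.card.ge)
  have hl : ∀ k : ULift.{u} ℕ, IsPureEmbedding R (Finsupp.lsingle (R := R) (M := M) k) := fun k =>
    isPureEmbedding_of_retraction (g := Finsupp.lapply k) (by ext x; simp)
  have h𝒫 : InDefinableClosure T (ULift.{u} ℕ →₀ M) :=
    (InDefinableClosure.pi fun _ => hM.inClass.inDefinableClosure).of_pure
      isPureEmbedding_finsuppToPi
  have hmem : ∀ i, InClass T (C i) := fun i =>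
    hE.absorbs _ ((Finsupp.lsingle (R := R) (M := M) (ULift.up 0) ∘ₗ f).codRestrict _ fun x =>
      hsingle i 0 (f x) (by simp)) (h𝒫.submodule (hpure i)) (((hl _).comp hf).codRestrict _ _)
  have hcard : ∀ i, #(C i) = lam := by
    intro i
    apply le_antisymm
    · refine (mk_subtype_le _).trans ?_
      change #(ULift.{u} ℕ →₀ M) ≤ lam
      rw [mk_finsupp_of_infinite' _ M, hM.card]
      simpa using hlam
    · rw [← hM.card]
      refine mk_le_of_injective (f := fun x : M => (⟨Finsupp.single ⟨0⟩ x, hsingle i 0 x (by simp)⟩ :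
        C i)) fun x y hxy => ?_
      exact Finsupp.single_injective _ (congrArg Subtype.val hxy)
  have hAC : ∀ n : ℕ, AlgebraicallyCompact R (C n) := by
    intro n
    let t : Finset (ULift.{u} ℕ) := (Finset.range (n + 1)).map Equiv.ulift.symm.toEmbedding
    have ht : ∀ k, k ∈ t ↔ k.down ≤ n := by
      rintro ⟨k⟩
      simp only [t, Finset.mem_map_equiv]
      simp
    let g : (ULift.{u} ℕ → M) →ₗ[R] C n :=
      { toFun := fun y => ⟨Finsupp.onFinset t (fun k => if k ∈ t then y k else 0) (by
            intro k hk
            by_contra h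
            simp [h] at hk), by
            rw [Finsupp.mem_supported']
            intro k hk
            have : k ∉ t := fun h => hk (by
              change ((k.down : ℕ) : Ordinal.{u}) ≤ n
              exact_mod_cast (ht k).1 h)
            simp [this]⟩
        map_add' := fun a b => by
          ext k
          by_cases h : k ∈ t <;> simp [h]
        map_smul' := fun r a => by
          ext k
          by_cases h : k ∈ t <;> simp [h] }
    refine (hM.algebraicallyCompact.pi (I := ULift.{u} ℕ)).of_retraction
      (f := finsuppToPi R _ M ∘ₗ (C n).subtype) (g := g) ?_
    ext x k
    change (if k ∈ t then (x : ULift.{u} ℕ →₀ M) k else 0) = (x : ULift.{u} ℕ →₀ M) k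
    by_cases h : k ∈ t
    · rw [if_pos h]
    · have : k ∉ S n := fun hk => h ((ht k).2 (by
        change ((k.down : ℕ) : Ordinal.{u}) ≤ n at hk
        exact_mod_cast hk))
      rw [if_neg h, (Finsupp.mem_supported' R _).1 x.2 k this]
  refine ⟨ω, hlam, isSuccLimit_omega0, ?_, C, ⟨fun i _ => hmem i, fun i _ => hcard i,
    fun i j hij _ => ⟨Finsupp.supported_mono (hS hij), (hpure i).inclusion _⟩, ?_, ?_, ?_⟩⟩
  · rw [lt_ord, card_omega0, Order.lt_succ_iff]
    exact hlam
  · intro δ hδ hlim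
    exact absurd hδ (omega0_le_of_isSuccLimit hlim).not_gt
  · intro i hi
    obtain ⟨n, rfl⟩ := lt_omega0.1 hi
    have hle : C n ≤ C (Order.succ (n : Ordinal.{u})) :=
      Finsupp.supported_mono (hS (Order.le_succ _))
    refine ⟨hle, hM.universalOver (hmem _) (hcard _) (hAC n) (hmem _) (hcard _)
      ((hpure _).inclusion hle)
      (j := (Finsupp.lsingle (R := R) (M := M) (ULift.up (n + 1))).codRestrict _ fun x =>
        hsingle _ (n + 1) x (by rw [Order.succ_eq_add_one]; simp))
      (s := Finsupp.lapply (ULift.up (n + 1)) ∘ₗ (C (Order.succ (n : Ordinal.{u}))).subtype)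
      ?_ ?_⟩
    · ext1 x
      refine (Finsupp.mem_supported' R _).1 x.2 _ fun h => ?_
      change ((n + 1 : ℕ) : Ordinal.{u}) ≤ n at h
      have : n + 1 ≤ n := by exact_mod_cast h
      omega
    · ext x
      exact Finsupp.single_eq_same
  · refine Set.eq_univ_of_forall fun x => ?_
    obtain ⟨n, hn⟩ : ∃ n : ℕ, ∀ k ∈ x.support, k.down ≤ n :=
      ⟨x.support.sup ULift.down, fun k hk => Finset.le_sup (f := ULift.down) hk⟩
    refine Set.mem_biUnion (x := (n : Ordinal.{u})) (natCast_lt_omega0 n) fun k hk => ?_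
    change ((k.down : ℕ) : Ordinal.{u}) ≤ n
    exact_mod_cast hn k hk

end LimitModels

/-! ### Mutually embeddable modules -/

section Bumby

variable {R : Type u} [Ring R] {M N : Type u} [AddCommGroup M] [Module R M] [AddCommGroup N]
  [Module R N]

/-- A Cantor–Bernstein theorem, after Bumby: two modules with the descending chain condition on
pp-definable subgroups that embed purely in each other are isomorphic. If `M = g N ⊕ X`, then the
submodules `(g f)^k X` of `M` are independent and their sum, being pure and `Σ`-pure-injective,
splits off. -/
theorem nonempty_linearEquiv_of_pure (hM : PPDescending R M) (hN : PPDescending R N)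
    {f : M →ₗ[R] N} {g : N →ₗ[R] M} (hf : IsPureEmbedding R f) (hg : IsPureEmbedding R g) :
    Nonempty (M ≃ₗ[R] N) := by
  classical
  obtain ⟨r, hr⟩ := hN.algebraicallyCompact.exists_extension hg LinearMap.id
  have hrg : ∀ x, r (g x) = x := fun x => LinearMap.congr_fun hr x
  let X := LinearMap.ker r
  let pX : M →ₗ[R] X := (LinearMap.id - g ∘ₗ r).codRestrict X fun x => by
    rw [LinearMap.mem_ker]
    simp [hrg]
  have hX : IsPureSubmodule X := isPureEmbedding_of_retraction (g := pX) (by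
    ext x
    have : r x = 0 := x.2
    simp [pX, this])
  have hS : PPDescending R (ULift.{u} ℕ →₀ X) :=
    ((hM.of_pure hX).pi (I := ULift.{u} ℕ)).of_pure isPureEmbedding_finsuppToPi
  let h : M →ₗ[R] M := g ∘ₗ f
  let σ : ULift.{u} ℕ → ULift.{u} ℕ := fun k => ⟨k.down + 1⟩
  have hσ : Function.Injective σ := fun a b hab => by
    have := congrArg ULift.down hab
    exact ULift.down_injective (Nat.succ_injective this)
  let sh : (ULift.{u} ℕ →₀ X) →ₗ[R] ULift.{u} ℕ →₀ X := Finsupp.lcomapDomain σ hσ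
  have hsh : ∀ (s : ULift.{u} ℕ →₀ X) (k : ULift.{u} ℕ), sh s k = s (σ k) := fun s k => rfl
  let Θ : (ULift.{u} ℕ →₀ X) →ₗ[R] M := Finsupp.lsum ℕ fun k : ULift.{u} ℕ => (h ^ k.down) ∘ₗ X.subtype
  have hΘsingle : ∀ (k : ℕ) (x : X), Θ (Finsupp.single ⟨k⟩ x) = (h ^ k) x := fun k x => by
    simp [Θ]
  have hΘ : ∀ s : ULift.{u} ℕ →₀ X, Θ s = s ⟨0⟩ + h (Θ (sh s)) := by
    have key : Θ = X.subtype ∘ₗ Finsupp.lapply ⟨0⟩ + h ∘ₗ Θ ∘ₗ sh := by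
      refine Finsupp.lhom_ext fun k x => ?_
      obtain ⟨k⟩ := k
      rw [hΘsingle]
      rcases k with _ | k
      · have h1 : sh (Finsupp.single ⟨0⟩ x) = 0 := by
          ext j
          rw [hsh, Finsupp.single_apply, if_neg]
          · rfl
          · intro hj
            exact absurd (congrArg ULift.down hj) (Nat.succ_ne_zero _).symm
        simp [h1]
      · have h1 : sh (Finsupp.single ⟨k + 1⟩ x) = Finsupp.single ⟨k⟩ x := by
          ext j
          rw [hsh]
          by_cases hj : j = ⟨k⟩
          · subst hj; simp [σ]
          · rw [Finsupp.single_apply, Finsupp.single_apply, if_neg, if_neg (Ne.symm hj)]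
            intro hj'
            exact hj (hσ hj'.symm)
        simp [h1, hΘsingle, pow_succ']
    intro s
    exact LinearMap.congr_fun key s
  have hrΘ : ∀ s : ULift.{u} ℕ →₀ X, r (Θ s) = f (Θ (sh s)) := fun s => by
    have h1 : r (s ⟨0⟩) = 0 := (s ⟨0⟩).2
    have h2 : r (h (Θ (sh s))) = f (Θ (sh s)) := hrg _
    rw [hΘ s, map_add, h1, h2, zero_add]
  have hΘp : IsPureEmbedding R Θ := by
    refine isPureEmbedding_of_reflect fun n φ x hx => ?_
    have hcoord : ∀ (k : ℕ) (x : Fin n → ULift.{u} ℕ →₀ X), φ.Realize (fun i => Θ (x i)) →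
        φ.Realize (fun i => x i ⟨k⟩) := by
      intro k
      induction k with
      | zero =>
        intro x hx
        have h1 : φ.Realize fun i => f (Θ (sh (x i))) := by
          simpa only [hrΘ] using hx.map r
        have h2 : φ.Realize fun i => X.subtype (x i ⟨0⟩) := by
          convert hx.sub (h1.map g) using 1
          funext i
          rw [Pi.sub_apply, hΘ (x i)]
          exact (add_sub_cancel_right _ _).symm
        exact (hX.2 n φ _).1 h2
      | succ k ih =>
        intro x hx
        have h1 : φ.Realize fun i => f (Θ (sh (x i))) := by
          simpa only [hrΘ] using hx.map r
        exact ih (fun i => sh (x i)) ((hf.2 n φ _).1 h1)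
    refine (isPureEmbedding_finsuppToPi.2 n φ x).1 ?_
    rw [PPFormula.realize_pi]
    exact fun k => hcoord k.down x hx
  obtain ⟨t, ht⟩ := hS.algebraicallyCompact.exists_extension (hf.comp hΘp) LinearMap.id
  have htf : ∀ s, t (f (Θ s)) = s := fun s => LinearMap.congr_fun ht s
  let Ψ : N →ₗ[R] M := Θ ∘ₗ t + g ∘ₗ (LinearMap.id - f ∘ₗ Θ ∘ₗ t)
  have hΨ : ∀ n, Ψ n = Θ (t n) + g (n - f (Θ (t n))) := fun n => rfl
  refine ⟨(LinearEquiv.ofBijective Ψ ⟨?_, ?_⟩).symm⟩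
  · rw [injective_iff_map_eq_zero]
    intro n hn
    rw [hΨ] at hn
    have h1 : f (Θ (sh (t n))) + (n - f (Θ (t n))) = 0 := by
      have := congrArg r hn
      rwa [map_add, hrΘ, hrg, map_zero] at this
    have h2 : sh (t n) = 0 := by
      have := congrArg t h1
      rwa [map_add, map_sub, htf, htf, sub_self, add_zero, map_zero] at this
    have h3 : n - f (Θ (t n)) = 0 := by
      rwa [h2, map_zero, map_zero, zero_add] at h1
    have h4 : Θ (t n) = 0 := by rwa [h3, map_zero, add_zero] at hn
    rwa [h4, map_zero, sub_zero] at h3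
  · intro m
    let x : X := pX m
    have hx : (x : M) = m - g (r m) := rfl
    let s' := t (r m)
    let s : ULift.{u} ℕ →₀ X := Finsupp.single ⟨0⟩ x + Finsupp.mapDomain σ s'
    have hs0 : s ⟨0⟩ = x := by
      have : Finsupp.mapDomain σ s' (⟨0⟩ : ULift.{u} ℕ) = 0 := by
        refine Finsupp.mapDomain_of_notMem_range _ _ ?_
        rintro ⟨k, hk⟩
        exact absurd (congrArg ULift.down hk) (Nat.succ_ne_zero _)
      simp [s, this]
    have hss : sh s = s' := by
      ext k
      rw [hsh]
      have h1 : (Finsupp.single (⟨0⟩ : ULift.{u} ℕ) x) (σ k) = 0 := by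
        rw [Finsupp.single_apply, if_neg]
        intro hj
        exact absurd (congrArg ULift.down hj) (Nat.succ_ne_zero _).symm
      have h2 : Finsupp.mapDomain σ s' (σ k) = s' k := Finsupp.mapDomain_apply hσ _ _
      simp only [s, Finsupp.add_apply, h1, h2, zero_add]
    refine ⟨f (Θ s) + (r m - f (Θ s')), ?_⟩
    have h1 : t (f (Θ s) + (r m - f (Θ s'))) = s := by
      rw [map_add, map_sub, htf, htf]
      simp [s']
    rw [hΨ, h1, add_sub_cancel_left, hΘ s, hs0, hss, hx, map_sub]
    change m - g (r m) + g (f (Θ s')) + (g (r m) - g (f (Θ s'))) = m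
    abel

end Bumby

/-! ### Continuous chains of submodules -/

section TransfiniteChain

variable {X : Type u} [CompleteLattice X]

/-- The continuous chain in a complete lattice that starts with `x₀` and whose successor steps are
given by an inflationary function. -/
noncomputable def transfiniteChain (step : X → X) (x₀ : X) (i : Ordinal.{u}) : X :=
  x₀ ⊔ ⨆ j : Set.Iio i, step (transfiniteChain step x₀ j.1)
termination_by i
decreasing_by exact j.2

variable {step : X → X} {x₀ : X}

theorem le_transfiniteChain (i : Ordinal.{u}) : x₀ ≤ transfiniteChain step x₀ i := by
  rw [transfiniteChain]
  exact le_sup_left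

theorem step_le_transfiniteChain {i j : Ordinal.{u}} (h : j < i) :
    step (transfiniteChain step x₀ j) ≤ transfiniteChain step x₀ i := by
  rw [transfiniteChain.eq_1 step x₀ i]
  exact le_sup_of_le_right (le_iSup (fun j : Set.Iio i => step (transfiniteChain step x₀ j.1))
    ⟨j, h⟩)

theorem transfiniteChain_le {i : Ordinal.{u}} {y : X} (h₀ : x₀ ≤ y)
    (h : ∀ j < i, step (transfiniteChain step x₀ j) ≤ y) : transfiniteChain step x₀ i ≤ y := by
  rw [transfiniteChain]
  exact sup_le h₀ (iSup_le fun j => h j j.2)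

theorem transfiniteChain_zero : transfiniteChain step x₀ 0 = x₀ :=
  le_antisymm (transfiniteChain_le le_rfl fun _ h => absurd h (zero_le).not_gt)
    (le_transfiniteChain 0)

theorem transfiniteChain_mono : Monotone (transfiniteChain step x₀) := fun _ _ hij =>
  transfiniteChain_le (le_transfiniteChain _) fun _ h =>
    step_le_transfiniteChain (h.trans_le hij)

theorem transfiniteChain_succ (hstep : ∀ x, x ≤ step x) (i : Ordinal.{u}) :
    transfiniteChain step x₀ (Order.succ i) = step (transfiniteChain step x₀ i) := by
  refine le_antisymm (transfiniteChain_le ((le_transfiniteChain i).trans (hstep _)) fun j h => ?_)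
    (step_le_transfiniteChain (Order.lt_succ i))
  rcases (Order.lt_succ_iff.1 h).lt_or_eq with h | rfl
  · exact (step_le_transfiniteChain h).trans (hstep _)
  · exact le_rfl

theorem transfiniteChain_limit {δ : Ordinal.{u}} (hδ : Order.IsSuccLimit δ) :
    transfiniteChain step x₀ δ = ⨆ i : Set.Iio δ, transfiniteChain step x₀ i.1 := by
  refine le_antisymm (transfiniteChain_le ?_ fun j h => ?_)
    (iSup_le fun i => transfiniteChain_mono i.2.le)
  · exact (le_transfiniteChain 0).trans
      (le_iSup (fun i : Set.Iio δ => transfiniteChain step x₀ i.1) ⟨0, hδ.bot_lt⟩)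
  · exact (step_le_transfiniteChain (Order.lt_succ j)).trans
      (le_iSup (fun i : Set.Iio δ => transfiniteChain step x₀ i.1) ⟨_, hδ.succ_lt h⟩)

theorem coe_transfiniteChain_limit {R : Type u} [Ring R] {M : Type u} [AddCommGroup M]
    [Module R M] {step : Submodule R M → Submodule R M} {L₀ : Submodule R M} {δ : Ordinal.{u}}
    (hδ : Order.IsSuccLimit δ) :
    ((transfiniteChain step L₀ δ : Submodule R M) : Set M) =
      ⋃ i : Set.Iio δ, ((transfiniteChain step L₀ i.1 : Submodule R M) : Set M) := by
  have : Nonempty (Set.Iio δ) := ⟨⟨0, hδ.bot_lt⟩⟩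
  have hdir : Directed (· ≤ ·) fun i : Set.Iio δ => transfiniteChain step L₀ i.1 :=
    (transfiniteChain_mono.comp (Subtype.mono_coe _)).directed_le
  rw [transfiniteChain_limit hδ, Submodule.coe_iSup_of_directed _ hdir]

end TransfiniteChain

/-! ### Limit models of prescribed length -/

section Lengths

open Cardinal

variable {R : Type u} [Ring R] {T : (lang R).Theory} {M N : Type u} [AddCommGroup M]
  [Module R M] [AddCommGroup N] [Module R N] {E : Type u} [AddCommGroup E] [Module R E]
  {lam : Cardinal.{u}} {α : Ordinal.{u}} {C : Ordinal.{u} → Submodule R M}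

/-- A universal extension of `M` is also universal over the pure submodels of `M` of the same
cardinality. This amounts to amalgamation: a pure extension of `N` and `M` embed over `N` in a
product with the algebraically compact double dual of `M`. -/
theorem UniversalOver.comp_pure {V : Type u} [AddCommGroup V] [Module R V] {v : M →ₗ[R] V}
    (hv : UniversalOver T v) (hE : IsAbsorbing T E) (hκ : theoryCard R ≤ #M) (hN : InClass T N)
    (hNM : #N = #M) {k : N →ₗ[R] M} (hk : IsPureEmbedding R k) : UniversalOver T (v ∘ₗ k) := by
  refine ⟨hN, hv.2.1, hv.2.2.1.comp hk, hv.2.2.2.1.trans hNM.symm, fun N' _ _ g hN' hcard hg => ?_⟩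
  obtain ⟨h, hh⟩ := Bidual.algebraicallyCompact.exists_extension hg (Bidual.eval R M ∘ₗ k)
  let f₀ : N' →ₗ[R] Bidual M × (N' ⧸ LinearMap.range g) := h.prod (LinearMap.range g).mkQ
  have hf₀g : f₀ ∘ₗ g = LinearMap.inl R _ _ ∘ₗ Bidual.eval R M ∘ₗ k := by
    ext1 x
    have h1 : (LinearMap.range g).mkQ (g x) = 0 :=
      (Submodule.Quotient.mk_eq_zero _).2 ⟨x, rfl⟩
    exact Prod.ext (LinearMap.congr_fun hh x) h1
  have hf₀ : IsPureEmbedding R f₀ := by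
    refine isPureEmbedding_of_range hg ?_ (s := LinearMap.snd R _ _) isPureEmbedding_id rfl
    rw [hf₀g]
    exact isPureEmbedding_inl.comp (Bidual.isPureEmbedding_eval.comp hk)
  obtain ⟨W, hW, -, hSW, f, hf, hfe⟩ := hv.absorb hE hκ
    ((Bidual.inDefinableClosure hv.1.inDefinableClosure).prod
      (hN'.inDefinableClosure.quotient hg.range))
    (g := LinearMap.inl R _ _ ∘ₗ Bidual.eval R M)
    (isPureEmbedding_inl.comp Bidual.isPureEmbedding_eval)
    (S := Set.range f₀) (mk_range_le.trans (hcard.trans hNM).le)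
  refine ⟨f ∘ₗ f₀.codRestrict W fun x => hSW ⟨x, rfl⟩, hf.comp (hf₀.codRestrict W _), ?_⟩
  ext1 x
  refine Eq.trans ?_ (LinearMap.congr_fun hfe (k x))
  exact congrArg f (Subtype.ext (LinearMap.congr_fun hf₀g x))

/-- If there is a limit model of cardinality `lam`, then every model of cardinality `lam` has a
universal extension. -/
theorem IsLimitModel.exists_universalOver (h : IsLimitModel T lam M) (hE : IsAbsorbing T E)
    (hκ : theoryCard R ≤ lam) (hN : InClass T N) (hcard : #N = lam) :
    ∃ (V : Type u) (_ : AddCommGroup V) (_ : Module R V) (e : N →ₗ[R] V), UniversalOver T e := by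
  obtain ⟨α, -, hlim, -, C, hC⟩ := h
  have h1 := hlim.succ_lt hlim.bot_lt
  obtain ⟨hle₀, hu⟩ := hC.universal _ hlim.bot_lt
  obtain ⟨hle, hv⟩ := hC.universal _ h1
  have hc := hC.card _ hlim.bot_lt
  obtain ⟨k, hk⟩ := hu.exists_pure hE (by rwa [hc]) hN.inDefinableClosure (by rw [hc, hcard])
  exact ⟨_, _, _, _, hv.comp_pure hE (by rwa [hC.card _ h1]) hN (hcard.trans (hC.card _ h1).symm) hk⟩

/-- A chain of submodules of `M` gives a limit model on each of its members with limit index. -/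
theorem isLimitModelOfLength_of_chain (hlam : ℵ₀ ≤ lam) (hlim : Order.IsSuccLimit α)
    (hα : α < (Order.succ lam).ord) {D : Ordinal.{u} → Submodule R M} (hmono : Monotone D)
    (hpure : ∀ i < α, IsPureSubmodule (D i)) (hmem : ∀ i < α, InClass T (D i))
    (hcard : ∀ i < α, #(D i) = lam)
    (hcont : ∀ δ ≤ α, Order.IsSuccLimit δ → (D δ : Set M) = ⋃ i : Set.Iio δ, (D i.1 : Set M))
    (huniv : ∀ i < α, UniversalOver T (Submodule.inclusion (hmono (Order.le_succ i)))) :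
    IsLimitModelOfLength T lam α (D α) := by
  let F : Ordinal.{u} → Submodule R (D α) := fun i => (D i).comap (D α).subtype
  let e : ∀ i, i ≤ α → (D i ≃ₗ[R] F i) := fun i hi =>
    (Submodule.comapSubtypeEquivOfLe (hmono hi)).symm
  have hF : Monotone F := fun i j hij => Submodule.comap_mono (hmono hij)
  refine ⟨hlam, hlim, hα, F, ?_, ?_, ?_, ?_, ?_, ?_⟩
  · exact fun i hi => (hmem i hi).congr (e i hi.le)
  · exact fun i hi => (e i hi.le).toEquiv.cardinal_eq.symm.trans (hcard i hi)
  · intro i j hij hj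
    refine ⟨hF hij, IsPureSubmodule.inclusion ?_ (hF hij)⟩
    refine IsPureEmbedding.of_comp (g := (D α).subtype) ?_
    exact (hpure i (hij.trans_lt hj)).comp (isPureEmbedding_equiv (e i (hij.trans hj.le)).symm)
  · intro δ hδ hδl
    ext x
    have h1 := Set.ext_iff.1 (hcont δ hδ.le hδl) x
    simpa [F] using h1
  · intro i hi
    exact ⟨hF (Order.le_succ i),
      (huniv i hi).congr (e i hi.le) (e _ (hlim.succ_lt hi).le) fun x => rfl⟩
  · ext x
    have h1 := Set.ext_iff.1 (hcont α le_rfl hlim) x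
    simpa [F] using h1

section Ambient

variable {I Y : Type u} [AddCommGroup Y] [Module R Y]

/-- A universal extension of a small pure submodule `L` of a large module with bounded supports can
be realized inside that module: coordinates outside the supports of the elements of `L` are used
for the quotient by `L`. -/
theorem IsSmallUniversal.exists_universalOver_inclusion (hY : IsSmallUniversal T Y)
    (hκ : theoryCard R ≤ lam) (hI : lam < #I)
    (hc : ℵ₀ ≤ Order.succ (theoryCard R))
    (huniv : ∀ (N : Type u) [AddCommGroup N] [Module R N], InClass T N → #N = lam →
      ∃ (V : Type u) (_ : AddCommGroup V) (_ : Module R V) (e : N →ₗ[R] V), UniversalOver T e)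
    {L : Submodule R (boundedSupport R Y hc (Set.univ : Set I))} (hL : IsPureSubmodule L)
    (hLT : InClass T L) (hLc : #L = lam) :
    ∃ (L' : Submodule R (boundedSupport R Y hc (Set.univ : Set I))) (h : L ≤ L'),
      IsPureSubmodule L' ∧ UniversalOver T (N := L) (M := L') (Submodule.inclusion h) := by
  classical
  have hlam : ℵ₀ ≤ lam := aleph0_le_theoryCard.trans hκ
  have hinf : Infinite I := infinite_iff.2 (hlam.trans hI.le)
  obtain ⟨V, _, _, e, he⟩ := huniv L hLT hLc
  have hVc : #V = lam := he.2.2.2.1.trans hLc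
  let J : Set I := ⋃ l : L, Function.support (l.1.1 : I → Y)
  have hJ : #J ≤ lam := by
    refine (mk_iUnion_le _).trans (mul_le_of_le hlam hLc.le (ciSup_le' fun l => ?_))
    exact (Order.lt_succ_iff.1 l.1.2.2).trans hκ
  have hA : #(Jᶜ : Set I) = #I := mk_compl_of_infinite J (hJ.trans_lt hI)
  let i : L →ₗ[R] boundedSupport R Y hc J :=
    ((boundedSupport R Y hc (Set.univ : Set I)).subtype ∘ₗ L.subtype).codRestrict _ fun l =>
      ⟨Set.subset_iUnion (fun l : L => Function.support (l.1.1 : I → Y))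
        l, l.1.2.2⟩
  obtain ⟨h, hh⟩ :=
    (hY.algebraicallyCompact.boundedSupport hc J).exists_extension he.2.2.1 i
  obtain ⟨k, hk⟩ := exists_pure_boundedSupport
    (he.2.1.inDefinableClosure.quotient he.2.2.1.range) hc
    (fun B => hY.algebraicallyCompact.boundedSupport hc B) hY.exists_pure (A := Jᶜ)
    ((mk_le_of_surjective (Submodule.mkQ_surjective _)).trans (by rw [hVc, hA]; exact hI.le))
  let f : V →ₗ[R] boundedSupport R Y hc (Set.univ : Set I) :=
    Submodule.inclusion (boundedSupport_mono (Set.subset_univ J)) ∘ₗ h +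
      Submodule.inclusion (boundedSupport_mono (Set.subset_univ Jᶜ)) ∘ₗ k ∘ₗ
        (LinearMap.range e).mkQ
  have hfe : f ∘ₗ e = L.subtype := by
    ext1 x
    have h1 : (LinearMap.range e).mkQ (e x) = 0 :=
      (Submodule.Quotient.mk_eq_zero _).2 ⟨x, rfl⟩
    have h2 : h (e x) = i x := LinearMap.congr_fun hh x
    simp only [f, LinearMap.comp_apply, LinearMap.add_apply, h1, h2, map_zero, add_zero]
    rfl
  let s : boundedSupport R Y hc (Set.univ : Set I) →ₗ[R] boundedSupport R Y hc Jᶜ :=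
    { toFun := fun x => ⟨Jᶜ.indicator x, Set.support_indicator_subset, (mk_le_mk_of_subset
        (by rw [Set.support_indicator]; exact Set.inter_subset_right)).trans_lt x.2.2⟩
      map_add' := fun x y => Subtype.ext (Set.indicator_add Jᶜ (x : I → Y) y)
      map_smul' := fun r x => Subtype.ext (Set.indicator_const_smul Jᶜ r (x : I → Y)) }
  have hsf : s ∘ₗ f = k ∘ₗ (LinearMap.range e).mkQ := by
    ext1 x
    refine Subtype.ext ?_
    have h1 : Jᶜ.indicator (h x : I → Y) = 0 := by
      rw [Set.indicator_eq_zero']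
      exact Set.disjoint_compl_right_iff_subset.2 (h x).2.1
    have h2 : Jᶜ.indicator (k ((LinearMap.range e).mkQ x) : I → Y) =
        k ((LinearMap.range e).mkQ x) := Set.indicator_eq_self.2 (k _).2.1
    change Jᶜ.indicator ((h x : I → Y) + (k ((LinearMap.range e).mkQ x) : I → Y)) = _
    rw [Set.indicator_add', h1, h2, zero_add]
    rfl
  have hf : IsPureEmbedding R f :=
    isPureEmbedding_of_range he.2.2.1 (by rw [hfe]; exact hL) hk hsf
  refine ⟨LinearMap.range f, fun l hl => ⟨e ⟨l, hl⟩, LinearMap.congr_fun hfe ⟨l, hl⟩⟩, hf.range,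
    he.congr (LinearEquiv.refl R L) (LinearEquiv.ofInjective f hf.1) fun x => ?_⟩
  exact Subtype.ext (LinearMap.congr_fun hfe x).symm

/-- If every model of cardinality `lam` has a universal extension, then there are limit models of
all lengths. -/
theorem IsSmallUniversal.exists_isLimitModelOfLength (hY : IsSmallUniversal T Y)
    (hE : IsAbsorbing T E) (hκ : theoryCard R ≤ lam) (hN : InClass T N) (hNc : #N = lam)
    (huniv : ∀ (N : Type u) [AddCommGroup N] [Module R N], InClass T N → #N = lam →
      ∃ (V : Type u) (_ : AddCommGroup V) (_ : Module R V) (e : N →ₗ[R] V), UniversalOver T e)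
    (hlim : Order.IsSuccLimit α) (hα : α < (Order.succ lam).ord) :
    ∃ (M : Type u) (_ : AddCommGroup M) (_ : Module R M), IsLimitModelOfLength T lam α M := by
  classical
  have hlam : ℵ₀ ≤ lam := aleph0_le_theoryCard.trans hκ
  have hc : ℵ₀ ≤ Order.succ (theoryCard R) := aleph0_le_theoryCard.trans (Order.le_succ _)
  let I := (Order.succ lam).out
  have hI : lam < #I := by rw [mk_out]; exact Order.lt_succ lam
  let Ω := boundedSupport R Y hc (Set.univ : Set I)
  -- adding `E` to the first module makes all pure submodules above it models
  have hNE : #(N × E) = lam := by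
    apply le_antisymm
    · rw [mk_prod, lift_id, lift_id]
      exact mul_le_of_le hlam hNc.le (hE.card_le.trans hκ)
    · rw [← hNc]
      exact mk_le_of_injective (f := LinearMap.inl R N E) isPureEmbedding_inl.1
  obtain ⟨g, hg⟩ := exists_pure_boundedSupport (I := I) (A := Set.univ)
    (hN.inDefinableClosure.prod hE.inClass.inDefinableClosure) hc
    (fun B => hY.algebraicallyCompact.boundedSupport hc B) hY.exists_pure
    (by rw [hNE, mk_univ]; exact hI.le)
  have hΩ : InDefinableClosure T Ω := (InDefinableClosure.pi fun _ => hY.inDefinableClosure).of_pure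
    (isPureSubmodule_boundedSupport hc _)
  let L₀ : Submodule R Ω := LinearMap.range g
  let Good : Submodule R Ω → Prop := fun L => IsPureSubmodule L ∧ #L = lam ∧ L₀ ≤ L
  have hgood : ∀ {L}, Good L → InClass T L := fun {L} hL =>
    hE.absorbs _ ((g ∘ₗ LinearMap.inr R N E).codRestrict L fun x => hL.2.2 ⟨_, rfl⟩)
      (hΩ.submodule hL.1) ((hg.comp isPureEmbedding_inr).codRestrict L _)
  have hstep : ∀ L : Submodule R Ω, ∃ (L' : Submodule R Ω) (h : L ≤ L'), Good L →
      IsPureSubmodule L' ∧ UniversalOver T (N := L) (M := L') (Submodule.inclusion h) := fun L => by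
    by_cases hL : Good L
    · obtain ⟨L', h, h'⟩ := hY.exists_universalOver_inclusion hκ hI hc huniv hL.1 (hgood hL) hL.2.1
      exact ⟨L', h, fun _ => h'⟩
    · exact ⟨L, le_rfl, fun h => absurd h hL⟩
  choose step hle hu using hstep
  let D := transfiniteChain step L₀
  have hmono : Monotone D := transfiniteChain_mono
  have hD : ∀ i < (Order.succ lam).ord, Good (D i) := by
    intro i
    induction i using Ordinal.limitRecOn with
    | zero =>
      intro _
      refine ⟨?_, ?_, le_transfiniteChain _⟩
      · change IsPureSubmodule (transfiniteChain step L₀ 0)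
        rw [transfiniteChain_zero]
        exact hg.range
      · change #(transfiniteChain step L₀ 0 : Submodule R Ω) = lam
        rw [transfiniteChain_zero, ← hNE]
        exact ((LinearEquiv.ofInjective g hg.1).toEquiv.cardinal_eq).symm
    | add_one i ih =>
      rw [← Order.succ_eq_add_one]
      intro hi
      have hG := ih ((Order.lt_succ i).trans hi)
      refine ⟨?_, ?_, le_transfiniteChain _⟩
      · change IsPureSubmodule (transfiniteChain step L₀ (Order.succ i))
        rw [transfiniteChain_succ hle]
        exact (hu _ hG).1
      · change #(transfiniteChain step L₀ (Order.succ i) : Submodule R Ω) = lam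
        rw [transfiniteChain_succ hle]
        exact (hu _ hG).2.2.2.2.1.trans hG.2.1
    | limit δ hδ ih =>
      intro hi
      have : Nonempty (Set.Iio δ) := ⟨⟨0, hδ.bot_lt⟩⟩
      have hcoe := coe_transfiniteChain_limit (step := step) (L₀ := L₀) hδ
      refine ⟨?_, ?_, le_transfiniteChain _⟩
      · exact isPureSubmodule_of_directed
          (C := fun j : Set.Iio δ => D j.1) (hmono.comp (Subtype.mono_coe _)).directed_le
          (fun j => (ih j.1 j.2 (j.2.trans hi)).1) hcoe
      · apply le_antisymm
        · change #((D δ : Submodule R Ω) : Set Ω) ≤ lam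
          rw [hcoe, ← Set.biUnion_eq_iUnion (Set.Iio δ)
            (fun j _ => ((transfiniteChain step L₀ j : Submodule R Ω) : Set Ω))]
          refine mk_biUnion_le_of_le (Order.lt_succ_iff.1 (lt_ord.1 hi)) hlam _ fun j hj => ?_
          exact (ih j hj (hj.trans hi)).2.1.le
        · rw [← (ih 0 hδ.bot_lt (hδ.bot_lt.trans hi)).2.1]
          exact mk_le_mk_of_subset (hmono (zero_le (a := δ)))
  refine ⟨D α, inferInstance, inferInstance, isLimitModelOfLength_of_chain hlam hlim hα hmono
    (fun i hi => (hD i (hi.trans hα)).1) (fun i hi => hgood (hD i (hi.trans hα)))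
    (fun i hi => (hD i (hi.trans hα)).2.1) (fun δ _ hδ => coe_transfiniteChain_limit hδ)
    fun i hi => ?_⟩
  exact (hu _ (hD i (hi.trans hα))).2.congr (LinearEquiv.refl R _)
    (LinearEquiv.ofEq _ _ (transfiniteChain_succ hle i).symm) fun x => rfl

end Ambient

end Lengths

/-! ### Limit models of length `ω` and `ω₁` -/

section CountablySolvable

open Cardinal

variable {R : Type u} [Ring R] {T : (lang R).Theory} {M N : Type u} [AddCommGroup M]
  [Module R M] [AddCommGroup N] [Module R N] {E : Type u} [AddCommGroup E] [Module R E]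
  {lam : Cardinal.{u}} {α : Ordinal.{u}} {C : Ordinal.{u} → Submodule R M}

variable (R M) in
/-- Coherent sequences of cosets `a n + φ n [M]` of pp-definable subgroups have a common point. -/
def CountablySolvable : Prop :=
  ∀ (φ : ℕ → PPFormula R 1) (a : ℕ → M), (∀ n m, n ≤ m → a m - a n ∈ (φ n).sol M) →
    ∃ x, ∀ n, x - a n ∈ (φ n).sol M

theorem AlgebraicallyCompact.countablySolvable (hM : AlgebraicallyCompact R M) :
    CountablySolvable R M := by
  classical
  intro φ a ha
  obtain ⟨x, hx⟩ := hM (Set.range fun n => (φ n, a n)) fun s hs => by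
    obtain ⟨t, -, rfl⟩ := Finset.subset_set_image_iff.1 (Set.image_univ.symm ▸ hs)
    refine ⟨a (t.sup id), fun p hp => ?_⟩
    obtain ⟨n, hn, rfl⟩ := Finset.mem_image.1 hp
    exact ha n _ (Finset.le_sup (f := id) hn)
  exact ⟨x, fun n => hx _ ⟨n, rfl⟩⟩

theorem CountablySolvable.congr (hM : CountablySolvable R M) (e : M ≃ₗ[R] N) :
    CountablySolvable R N := by
  intro φ a ha
  obtain ⟨x, hx⟩ := hM φ (fun n => e.symm (a n)) fun n m h => by
    rw [← map_sub]
    exact PPFormula.map_mem_sol (ha n m h) (e.symm : N →ₗ[R] M)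
  refine ⟨e x, fun n => ?_⟩
  have := PPFormula.map_mem_sol (hx n) (e : M →ₗ[R] N)
  simpa using this

/-- In a chain of uncountable cofinality a sequence lies in one of its members, and the next member
realizes what is realized in the double dual of that one. -/
theorem IsLimitChain.countablySolvable (hC : IsLimitChain T lam α M C) (hE : IsAbsorbing T E)
    (hκ : theoryCard R ≤ lam) (hcof : ∀ f : ℕ → Ordinal.{u}, (∀ n, f n < α) → ∃ i < α, ∀ n, f n ≤ i) :
    CountablySolvable R M := by
  intro φ a ha
  choose f hf hfa using fun n => hC.exists_mem (a n)
  obtain ⟨i, hi, hfi⟩ := hcof f hf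
  have haC : ∀ n, a n ∈ C i := fun n => (hC.increasing _ _ (hfi n) hi).1 (hfa n)
  let c : ℕ → C i := fun n => ⟨a n, haC n⟩
  obtain ⟨z, hz⟩ := (Bidual.algebraicallyCompact (R := R) (M := C i)).countablySolvable φ
    (fun n => Bidual.eval R (C i) (c n)) fun n m h => by
      rw [← map_sub]
      exact PPFormula.map_mem_sol ((hC.isPureSubmodule hi).mem_sol.1 (ha n m h)) _
  obtain ⟨hle, hu⟩ := hC.universal i hi
  have hc := hC.card i hi
  obtain ⟨W, hW, hWp, hzW, g, -, hg⟩ := hu.absorb hE (by rwa [hc])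
    (Bidual.inDefinableClosure hu.1.inDefinableClosure) Bidual.isPureEmbedding_eval (S := {z}) (by
      rw [mk_singleton, hc]
      exact (one_lt_aleph0.le.trans aleph0_le_theoryCard).trans hκ)
  let w : W := ⟨z, hzW rfl⟩
  refine ⟨g w, fun n => ?_⟩
  have h1 : w - (Bidual.eval R (C i)).codRestrict W hW (c n) ∈ (φ n).sol W :=
    hWp.mem_sol.1 (hz n)
  have h2 := PPFormula.map_mem_sol h1 ((C (Order.succ i)).subtype ∘ₗ g)
  have h3 : ((C (Order.succ i)).subtype ∘ₗ g)
      ((Bidual.eval R (C i)).codRestrict W hW (c n)) = a n :=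
    congrArg Subtype.val (LinearMap.congr_fun hg (c n))
  rw [map_sub, h3] at h2
  exact h2

/-- Each member of a limit chain contains a copy of each small module that is independent of the
preceding member. -/
theorem IsLimitChain.exists_independent (hC : IsLimitChain T lam α M C) (hE : IsAbsorbing T E)
    (hκ : theoryCard R ≤ lam) {i : Ordinal.{u}} (hi : Order.succ i < α)
    (hN : InDefinableClosure T N) (hNc : #N ≤ lam) (b : N) :
    ∃ b' ∈ C (Order.succ i), (∀ φ : PPFormula R 1, b ∈ φ.sol N → b' ∈ φ.sol M) ∧
      ∀ φ : PPFormula R 1, ∀ w ∈ C i, b' - w ∈ φ.sol M → b ∈ φ.sol N := by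
  have hi' := (Order.lt_succ i).trans hi
  obtain ⟨hle, hu⟩ := hC.universal i hi'
  have hc := hC.card i hi'
  obtain ⟨W, hW, hWp, hSW, g, hg, hge⟩ := hu.absorb hE (by rwa [hc])
    (hu.1.inDefinableClosure.prod hN) (g := LinearMap.inl R (C i) N) isPureEmbedding_inl
    (S := Set.range (LinearMap.inr R (C i) N)) (mk_range_le.trans (by rwa [hc]))
  let v : W := ⟨(0, b), hSW ⟨b, rfl⟩⟩
  refine ⟨g v, (g v).2, fun φ hφ => ?_, fun φ w hw hφ => ?_⟩
  · have h1 : v ∈ φ.sol W := hWp.mem_sol.1 (PPFormula.map_mem_sol hφ (LinearMap.inr R (C i) N))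
    exact PPFormula.map_mem_sol h1 ((C (Order.succ i)).subtype ∘ₗ g)
  · let w' : W := (LinearMap.inl R (C i) N).codRestrict W hW ⟨w, hw⟩
    have h1 : (g w' : M) = w := congrArg Subtype.val (LinearMap.congr_fun hge ⟨w, hw⟩)
    have h2 : (C (Order.succ i)).subtype (g (v - w')) ∈ φ.sol M := by
      rw [map_sub, map_sub, Submodule.subtype_apply, Submodule.subtype_apply, h1]
      exact hφ
    have h3 : W.subtype (v - w') ∈ φ.sol (C i × N) :=
      hWp.mem_sol.2 (hg.mem_sol.1 ((hC.isPureSubmodule hi).mem_sol.1 h2))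
    have h4 := (PPFormula.mem_sol_prod.1 h3).2
    change b - 0 ∈ φ.sol N at h4
    rwa [sub_zero] at h4

open Ordinal in
/-- A strictly descending chain of pp-definable subgroups yields a sequence of partial sums of
independent elements that has no limit in a union of countably many steps. -/
theorem IsLimitChain.ppDescending (hC : IsLimitChain T lam ω M C) (hE : IsAbsorbing T E)
    (hκ : theoryCard R ≤ lam) (hM : CountablySolvable R M) (hN : InDefinableClosure T N)
    (hNc : #N ≤ lam) : PPDescending R N := by
  intro φ b hb
  by_contra! hcon
  choose b' hb'C hb'1 hb'2 using fun n : ℕ =>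
    hC.exists_independent hE hκ (i := n) (isSuccLimit_omega0.succ_lt (natCast_lt_omega0 n)) hN hNc
      (b n)
  let a : ℕ → M := fun n => ∑ k ∈ Finset.range n, b' k
  have hmono : ∀ {n m : ℕ}, n ≤ m → C n ≤ C m := fun {n m} h =>
    (hC.increasing n m (by exact_mod_cast h) (natCast_lt_omega0 m)).1
  have hb'C' : ∀ n : ℕ, b' n ∈ C (n + 1 : ℕ) := fun n => by
    have := hb'C n
    rwa [Order.succ_eq_add_one, ← Nat.cast_succ] at this
  have haC : ∀ n : ℕ, a n ∈ C n := fun n =>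
    Submodule.sum_mem _ fun k hk => hmono (Finset.mem_range.1 hk) (hb'C' k)
  obtain ⟨x, hx⟩ := hM φ a fun n m h => by
    rw [← Finset.sum_Ico_eq_sub _ h]
    exact AddSubgroup.sum_mem _ fun k hk => hb'1 k _ (hb k n (Finset.mem_Ico.1 hk).1)
  obtain ⟨i, hi, hxi⟩ := hC.exists_mem x
  obtain ⟨n, rfl⟩ := lt_omega0.1 hi
  refine hcon n (hb'2 n _ (x - a n) (Submodule.sub_mem _ hxi (haC n)) ?_)
  have h1 := AddSubgroup.neg_mem _ (hx (n + 1))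
  have h2 : a (n + 1) = a n + b' n := Finset.sum_range_succ _ _
  rw [h2] at h1
  convert h1 using 1
  abel

open Ordinal in
/-- If limit models of cardinality `lam` are unique, then those of length `ω` are isomorphic to
those of length `ω₁`, which gives the descending chain condition. -/
theorem UniquenessOfLimitModels.ppDescending (h : UniquenessOfLimitModels T lam)
    (hE : IsAbsorbing T E) (hκ : Order.succ (theoryCard R) ≤ lam) (hN : InDefinableClosure T N)
    (hNc : #N ≤ lam) : PPDescending R N := by
  have hκ' : theoryCard R ≤ lam := (Order.le_succ _).trans hκ
  have hlam : ℵ₀ ≤ lam := aleph0_le_theoryCard.trans hκ'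
  have hℵ : ℵ₁ ≤ lam := by
    rw [← succ_aleph0]
    exact (Order.succ_le_succ aleph0_le_theoryCard).trans hκ
  obtain ⟨⟨M₀, _, _, hM₀⟩, huniq⟩ := h
  obtain ⟨Y, _, _, hY⟩ := exists_isSmallUniversal T
  obtain ⟨_, -, hlim₀, -, C₀, hC₀⟩ := id hM₀
  have hex : ∀ α : Ordinal.{u}, Order.IsSuccLimit α → α < (Order.succ lam).ord →
      ∃ (M : Type u) (_ : AddCommGroup M) (_ : Module R M), IsLimitModelOfLength T lam α M :=
    fun α => hY.exists_isLimitModelOfLength hE hκ' (hC₀.mem _ hlim₀.bot_lt)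
      (hC₀.card _ hlim₀.bot_lt) fun _ _ _ => hM₀.exists_universalOver hE hκ'
  obtain ⟨M₁, _, _, h₁⟩ := hex ω isSuccLimit_omega0 (by
    rw [lt_ord, card_omega0, Order.lt_succ_iff]
    exact hlam)
  obtain ⟨M₂, _, _, h₂⟩ := hex (ℵ₁).ord (isSuccLimit_ord (aleph0_le_aleph 1))
    (ord_lt_ord.2 (Order.lt_succ_iff.2 hℵ))
  obtain ⟨e⟩ := huniq M₂ M₁ ⟨_, h₂⟩ ⟨_, h₁⟩
  obtain ⟨-, -, -, C₁, hC₁⟩ := h₁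
  obtain ⟨-, -, -, C₂, hC₂⟩ := h₂
  refine hC₁.ppDescending hE hκ' ((hC₂.countablySolvable hE hκ' fun f hf => ?_).congr e) hN hNc
  refine ⟨⨆ n, f n, ?_, fun n => Ordinal.le_iSup f n⟩
  refine lift_iSup_lt_of_lt_cof ?_ hf
  rw [Ordinal.lift_uzero, isRegular_aleph_one.cof_ord, mk_nat, lift_aleph0]
  exact aleph0_lt_aleph_one

end CountablySolvable

/-! ### The descending chain condition in the definable closure -/

section Descending

open Cardinal

variable {R : Type u} [Ring R] {T : (lang R).Theory} {M N : Type u} [AddCommGroup M]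
  [Module R M] [AddCommGroup N] [Module R N] {E : Type u} [AddCommGroup E] [Module R E]
  {lam : Cardinal.{u}}

/-- A descending chain is witnessed by countably many elements, so small modules suffice. -/
theorem InDefinableClosure.ppDescending_of_small
    (h : ∀ (C : Type u) [AddCommGroup C] [Module R C], InDefinableClosure T C →
      #C ≤ theoryCard R → PPDescending R C) (hN : InDefinableClosure T N) : PPDescending R N := by
  intro φ b hb
  obtain ⟨S, hS, hbS, hcard⟩ := exists_isPureSubmodule_card_le (R := R) (Set.range b) le_rfl
    ((Set.countable_range b).le_aleph0.trans aleph0_le_theoryCard)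
  obtain ⟨n, hn⟩ := h S (hN.submodule hS) hcard φ (fun n => ⟨b n, hbS ⟨n, rfl⟩⟩)
    fun n k hk => hS.mem_sol.1 (hb n k hk)
  exact ⟨n, hS.mem_sol.2 hn⟩

/-- If all members of `K^T` are pure-injective, then in particular the sums `(N ⊕ E)^(ℕ)` are. -/
theorem IsAbsorbing.ppDescending_of_pureInjective (hE : IsAbsorbing T E)
    (h : ∀ (M : Type u) [AddCommGroup M] [Module R M], InClass T M → PureInjective R M)
    (hN : InDefinableClosure T N) : PPDescending R N := by
  have hmem : InClass T (ULift.{u} ℕ →₀ N × E) := by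
    refine hE.absorbs _ (Finsupp.lsingle (R := R) (M := N × E) (ULift.up 0) ∘ₗ LinearMap.inr R N E)
      ((InDefinableClosure.pi fun _ => hN.prod hE.inClass.inDefinableClosure).of_pure
        isPureEmbedding_finsuppToPi) (IsPureEmbedding.comp ?_ isPureEmbedding_inr)
    exact isPureEmbedding_of_retraction (g := Finsupp.lapply (ULift.up 0)) (by
      refine LinearMap.ext fun x => ?_
      exact Finsupp.single_eq_same)
  exact (ModuleClass.ppDescending_of_pureInjective (h _ hmem)).of_pure isPureEmbedding_inl

/-- If a universal model of `K^T_lam` satisfies the descending chain condition, then so do the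
small modules of the definable closure, as they are summands of members of `K^T_lam`. -/
theorem IsUniversalModel.ppDescending (hM : IsUniversalModel T lam M) (hE : IsAbsorbing T E)
    (hκ : theoryCard R ≤ lam) (hdcc : PPDescending R M) (hN : InDefinableClosure T N)
    (hNc : #N ≤ theoryCard R) : PPDescending R N := by
  have hlam : ℵ₀ ≤ lam := aleph0_le_theoryCard.trans hκ
  obtain ⟨hMT, hMc, hu⟩ := hM
  have hmem : InClass T (N × (E × M)) :=
    hE.absorbs _ (LinearMap.inr R N (E × M) ∘ₗ LinearMap.inl R E M)
      (hN.prod (hE.inClass.inDefinableClosure.prod hMT.inDefinableClosure))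
      (isPureEmbedding_inr.comp isPureEmbedding_inl)
  have hcard : #(N × (E × M)) = lam := by
    apply le_antisymm
    · rw [mk_prod, mk_prod, lift_id, lift_id, lift_id, lift_id]
      exact mul_le_of_le hlam (hNc.trans hκ)
        (mul_le_of_le hlam (hE.card_le.trans hκ) hMc.le)
    · rw [← hMc]
      exact mk_le_of_injective (f := LinearMap.inr R N (E × M) ∘ₗ LinearMap.inr R E M)
        (isPureEmbedding_inr.comp isPureEmbedding_inr).1
  obtain ⟨f, hf⟩ := hu _ hmem hcard
  exact (hdcc.of_pure hf).of_pure isPureEmbedding_inl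

/-- Under the descending chain condition limit models exist in all large cardinals, and two limit
models of the same cardinality are isomorphic because they embed purely in each other. -/
theorem IsSmallUniversal.uniquenessOfLimitModels {Y : Type u} [AddCommGroup Y] [Module R Y]
    (hY : IsSmallUniversal T Y) (hE : IsAbsorbing T E)
    (hd : ∀ (N : Type u) [AddCommGroup N] [Module R N], InDefinableClosure T N → PPDescending R N)
    (hκ : theoryCard R ≤ lam) (hYc : #Y ≤ lam) : UniquenessOfLimitModels T lam := by
  obtain ⟨Q, _, _, hQ⟩ := hY.exists_isRich_of_ppDescending hE (hd Y hY.inDefinableClosure)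
    (aleph0_le_theoryCard.trans hκ) hYc
  refine ⟨⟨_, _, _, hQ.isLimitModel hE hκ⟩, fun M N _ _ _ _ hM hN => ?_⟩
  obtain ⟨f, hf⟩ := hN.exists_pure hE hκ hM.inDefinableClosure hM.mk_le
  obtain ⟨g, hg⟩ := hM.exists_pure hE hκ hN.inDefinableClosure hN.mk_le
  exact nonempty_linearEquiv_of_pure (hd M hM.inDefinableClosure) (hd N hN.inDefinableClosure) hf hg

end Descending

end ModuleClass

theorem theorem4p18 {R : Type u} [Ring R] (T : (ModuleClass.lang R).Theory)
    (h_inf : ModuleClass.HasInfiniteModel T)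
    (h_jep : ModuleClass.JointEmbedding T)
    (h_ap : ModuleClass.Amalgamation T)
    (h_sum : ModuleClass.ClosedUnderDirectSums T) :
    List.TFAE [
      ModuleClass.Superstable T,
      ∃ lam : Cardinal.{u}, Order.succ (ModuleClass.theoryCard R) ≤ lam ∧
        ModuleClass.UniquenessOfLimitModels T lam,
      ∀ (M : Type u) [AddCommGroup M] [Module R M],
        ModuleClass.InClass T M → ModuleClass.PureInjective R M,
      ∃ lam : Cardinal.{u}, Order.succ (ModuleClass.theoryCard R) ≤ lam ∧
        ∃ (M : Type u) (_ : AddCommGroup M) (_ : Module R M),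
          ModuleClass.IsUniversalModel T lam M ∧ ModuleClass.SigmaPureInjective R M,
      ∀ (lam : Cardinal.{u}) (M : Type u) [AddCommGroup M] [Module R M],
        ModuleClass.IsLimitModel T lam M → ModuleClass.SigmaPureInjective R M] := by
  obtain ⟨E, _, _, hE⟩ := ModuleClass.exists_absorbing_model h_inf h_sum
  obtain ⟨Y, _, _, hY⟩ := ModuleClass.exists_isSmallUniversal T
  have hκ := Order.le_succ (ModuleClass.theoryCard R)
  -- the small modules of the definable closure decide whether all members are pure-injective
  have small : (∀ (N : Type u) [AddCommGroup N] [Module R N], ModuleClass.InDefinableClosure T N →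
      Cardinal.mk N ≤ ModuleClass.theoryCard R → ModuleClass.PPDescending R N) →
      ∀ (M : Type u) [AddCommGroup M] [Module R M],
        ModuleClass.InClass T M → ModuleClass.PureInjective R M := fun h M _ _ hM =>
    (hM.inDefinableClosure.ppDescending_of_small h).algebraicallyCompact.pureInjective
  tfae_have 1 → 2 := fun ⟨μ, hμ⟩ => ⟨max μ _, le_max_right _ _, hμ _ (le_max_left _ _)⟩
  tfae_have 2 → 3 := fun ⟨lam, hlam, h⟩ => small fun N _ _ hN hNc =>
    h.ppDescending hE hlam hN (hNc.trans (hκ.trans hlam))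
  tfae_have 3 → 1 := fun h => ⟨max (Cardinal.mk Y) (ModuleClass.theoryCard R), fun lam hlam =>
    hY.uniquenessOfLimitModels hE (fun N _ _ hN => hE.ppDescending_of_pureInjective h hN)
      ((le_max_right _ _).trans hlam) ((le_max_left _ _).trans hlam)⟩
  tfae_have 3 → 4 := fun h => by
    let lam := max (Cardinal.mk Y) (Order.succ (ModuleClass.theoryCard R))
    have hlam : Order.succ (ModuleClass.theoryCard R) ≤ lam := le_max_right _ _
    obtain ⟨Q, _, _, hQ⟩ := hY.exists_isRich_of_ppDescending hE
      (hE.ppDescending_of_pureInjective h hY.inDefinableClosure)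
      (ModuleClass.aleph0_le_theoryCard.trans (hκ.trans hlam)) (le_max_left _ _)
    exact ⟨lam, hlam, Q, _, _, ⟨hQ.inClass, hQ.card, fun N _ _ hN hNc =>
      hQ.exists_pure N hN.inDefinableClosure hNc.le⟩,
      (hE.ppDescending_of_pureInjective h hQ.inClass.inDefinableClosure).sigmaPureInjective⟩
  tfae_have 4 → 3 := fun ⟨lam, hlam, M, _, _, hM, hS⟩ => small fun N _ _ hN hNc =>
    hM.ppDescending hE (hκ.trans hlam) hS.ppDescending hN hNc
  tfae_have 3 → 5 := fun h lam M _ _ hM =>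
    (hE.ppDescending_of_pureInjective h hM.inDefinableClosure).sigmaPureInjective
  tfae_have 5 → 3 := fun h => small fun N _ _ hN hNc => by
    obtain ⟨lam, hlam, Q, _, _, hQ⟩ := hY.exists_isRich hE
    have hL := hQ.isLimitModel hE (hκ.trans hlam)
    obtain ⟨f, hf⟩ := hL.exists_pure hE (hκ.trans hlam) hN (hNc.trans (hκ.trans hlam))
    exact (h lam _ hL).ppDescending.of_pure hf
  tfae_finish
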